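/- Let $A$ be a $C^*$-algebra with multiplier algebra $M(A)$. An endomorphism of $A$ is *extendible* if it extends to a strictly continuous endomorphism of $M(A)$. An *Exel system* $(A,\alpha,L)$ consists of an extendible endomorphism $\alpha$ of $A$ and a positive linear map $L:A\to A$ which extends to a positive linear map $\overline L:M(A)\to M(A)$ such that $L(\alpha(a)m)=a\overline L(m)$ for $a\in A$, $m\in M(A)$, and $\overline L(1)=1$. Let $M_L$ be the right-Hilbert $A$-bimodule obtained by completing $A$ (modulo vectors of length zero) in the bimodule structure $a\cdot m=am$, $m\cdot b=m\alpha(b)$ and the pairing $\langle m,n\rangle=L(m^*n)$; let $q:A\to M_L$ be the canonical map and $\phi:A\to\mathcal L(M_L)$ the left action. Put $M_L^{\otimes 0}=A$ and $M_L^{\otimes(i+1)}=M_L\otimes_A M_L^{\otimes i}$. A representation of $M_L$ in a $C^*$-algebra $B$ is a pair $(\psi,\pi)$ of a linear map $\psi:M_L\to B$ and a homomorphism $\pi:A\to B$ with $\psi(m\cdot a)=\psi(m)\pi(a)$, $\psi(m)^*\psi(n)=\pi(\langle m,n\rangle)$ and $\psi(a\cdot m)=\pi(a)\psi(m)$; it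 induces linear maps $\psi^{\otimes i}:M_L^{\otimes i}\to B$ with $\psi^{\otimes 0}=\pi$ and $\psi^{\otimes(i+1)}(m\otimes_A n)=\psi(m)\psi^{\otimes i}(n)$, and a homomorphism $(\psi,\pi)^{(1)}:\mathcal K(M_L)\to B$ with $(\psi,\pi)^{(1)}(\Theta_{m,n})=\psi(m)\psi(n)^*$. Let $J$ be a (closed two-sided) ideal of $A$ contained in $\phi^{-1}(\mathcal K(M_L))$, let $\mathcal O(J,M_L)$ be the relative Cuntz–Pimsner algebra, that is, the $C^*$-algebra generated by a representation $(k_M,k_A)$ universal for the representations which are coisometric on $J$, i.e. satisfy $\pi|_J=(\psi,\pi)^{(1)}\circ\phi|_J$, and let $\gamma:\mathbb T\to\operatorname{Aut}\mathcal O(J,M_L)$ be the gauge action, with $\gamma_z(k_A(a))=k_A(a)$ and $\gamma_z(k_M(m))=zk_M(m)$. For an endomorphism $\beta$ of a $C^*$-algebra $C$, a *Stacey-covariant representation* of $(C,\beta)$ in $B$ consists of a nondegenerate homomorphism $\pi:C\to B$ and an isometry $V\in M(B)$ with $\pi(\beta(c))=V\pi(c)V^*$; the Stacey crossed product $C\times_\beta\mathbb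 N$ is generated by a universal Stacey-covariant representation $(i_C,v)$, and $\pi\times V$ is the homomorphism with $(\pi\times V)\circ i_C=\pi$ and $(\pi\times V)(v)=V$. **Theorem.** Let $(A,\alpha,L)$ be an Exel system and $J$ an ideal of $A$ contained in $\phi^{-1}(\mathcal K(M_L))$. There is a unique isometry $V\in M(\mathcal O(J,M_L))$ such that $k_M(q(a))=k_A(a)V$ for all $a\in A$, and $\operatorname{Ad}V:T\mapsto VTV^*$ restricts to an endomorphism $\alpha'$ of the core $C_J:=\mathcal O(J,M_L)^\gamma$ such that $$\alpha'\big(k_M^{\otimes i}(a\cdot m)\,k_M^{\otimes i}(b\cdot n)^*\big)=k_M^{\otimes(i+1)}(q(\alpha(a))\otimes_A m)\,k_M^{\otimes(i+1)}(q(\alpha(b))\otimes_A n)^*$$ for $i\ge 0$, $a,b\in A$ and $m,n\in M_L^{\otimes i}$. Further, $\alpha'$ is extendible with $\overline{\alpha'}(1)=VV^*$, is injective, and has range $\overline{\alpha'}(1)C_J\overline{\alpha'}(1)$. Finally, $(\operatorname{id},V)$ is a Stacey-covariant representation of $(C_J,\alpha')$ in $\mathcal O(J,M_L)$, and $\operatorname{id}\times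 V$ is an isomorphism of the Stacey crossed product $C_J\times_{\alpha'}\mathbb N$ onto $\mathcal O(J,M_L)$. -/

import Mathlib

open scoped MultiplierAlgebra TensorProduct ENNReal

universe u v w

noncomputable section

namespace ExelStacey

/-- A criterion for positivity of a self-adjoint element in terms of its compressions. -/
lemma exists_compression {M : Type*} [NonUnitalCStarAlgebra M] (X : M) (hX : IsSelfAdjoint X) :
    ∃ Y Z : M, star Y = Y ∧ Y * X * Y + star Z * Z = 0 ∧
      (Z = 0 → ∃ T : M, X = star T * T) := by
  let _ := CStarAlgebra.spectralOrder M
  have := CStarAlgebra.spectralOrderedRing M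
  have hn : 0 ≤ X⁻ := CFC.negPart_nonneg X
  have hs : star X⁻ = X⁻ := (IsSelfAdjoint.of_nonneg hn).star_eq
  have h3 : 0 ≤ X⁻ * X⁻ * X⁻ := by
    have := star_left_conjugate_nonneg hn X⁻
    rwa [hs] at this
  obtain ⟨Z, hZ⟩ := CStarAlgebra.nonneg_iff_eq_star_mul_self.1 h3
  refine ⟨X⁻, Z, hs, ?_, fun h0 => ?_⟩
  · rw [← hZ]
    conv_lhs => enter [1, 1, 2]; rw [← CFC.posPart_sub_negPart X hX]
    rw [mul_sub, CFC.negPart_mul_posPart, zero_sub, neg_mul, neg_add_cancel]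
  · have h : X⁻ = 0 := by
      rw [h0, mul_zero] at hZ
      have h4 : star (X⁻ * X⁻) * (X⁻ * X⁻) = 0 := by
        rw [star_mul, hs, ← mul_assoc, hZ, zero_mul]
      rw [CStarRing.star_mul_self_eq_zero_iff] at h4
      have h5 : star X⁻ * X⁻ = 0 := by rw [hs, h4]
      exact CStarRing.star_mul_self_eq_zero_iff _ |>.1 h5
    have : 0 ≤ X := by
      rw [← CFC.posPart_sub_negPart X hX, h, sub_zero]
      exact CFC.posPart_nonneg X
    exact CStarAlgebra.nonneg_iff_eq_star_mul_self.1 this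

section Correspondences

variable (A : Type u) [NonUnitalCStarAlgebra A] [PartialOrder A] [StarOrderedRing A]

/-- A right pre-Hilbert bimodule over the C⋆-algebra `A`: a complex `A`-bimodule with a positive
semidefinite right `A`-linear pairing `⟨x, y⟩` for which the left action is by adjointable maps.
`lact a x` is `a · x` and `ract a x` is `x · a`. -/
structure PreBimodule where
  carrier : Type u
  [addCommGroup : AddCommGroup carrier]
  [module : Module ℂ carrier]
  inner : carrier →ₗ⋆[ℂ] carrier →ₗ[ℂ] A
  lact : A →ₗ[ℂ] carrier →ₗ[ℂ] carrier
  ract : A →ₗ[ℂ] carrier →ₗ[ℂ] carrier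
  lact_mul : ∀ a b x, lact (a * b) x = lact a (lact b x)
  ract_mul : ∀ a b x, ract (a * b) x = ract b (ract a x)
  lact_ract : ∀ a b x, lact a (ract b x) = ract b (lact a x)
  star_inner : ∀ x y, star (inner x y) = inner y x
  inner_self_nonneg : ∀ x, 0 ≤ inner x x
  inner_ract : ∀ a x y, inner x (ract a y) = inner x y * a
  inner_lact : ∀ a x y, inner (lact a x) y = inner x (lact (star a) y)

/-- A right-Hilbert bimodule over the C⋆-algebra `A` (also called a C⋆-correspondence): a right
Hilbert `A`-module with a left action of `A` by adjointable operators.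
`lact a x` is `a · x` and `ract a x` is `x · a`. Mathlib's `CStarModule` is not used, because its
inner product is linear for a left action. -/
structure HilbertBimodule where
  carrier : Type u
  [normedAddCommGroup : NormedAddCommGroup carrier]
  [normedSpace : NormedSpace ℂ carrier]
  [completeSpace : CompleteSpace carrier]
  inner : carrier →ₗ⋆[ℂ] carrier →ₗ[ℂ] A
  lact : A →ₗ[ℂ] carrier →L[ℂ] carrier
  ract : A →ₗ[ℂ] carrier →L[ℂ] carrier
  lact_mul : ∀ a b x, lact (a * b) x = lact a (lact b x)
  ract_mul : ∀ a b x, ract (a * b) x = ract b (ract a x)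
  lact_ract : ∀ a b x, lact a (ract b x) = ract b (lact a x)
  star_inner : ∀ x y, star (inner x y) = inner y x
  inner_self_nonneg : ∀ x, 0 ≤ inner x x
  inner_ract : ∀ a x y, inner x (ract a y) = inner x y * a
  inner_lact : ∀ a x y, inner (lact a x) y = inner x (lact (star a) y)
  norm_sq : ∀ x, ‖x‖ ^ 2 = ‖inner x x‖

variable {A}

attribute [instance] PreBimodule.addCommGroup PreBimodule.module
  HilbertBimodule.normedAddCommGroup HilbertBimodule.normedSpace HilbertBimodule.completeSpace

namespace PreBimodule

variable (P : PreBimodule A)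

lemma inner_ract_left (a : A) (x y : P.carrier) :
    P.inner (P.ract a x) y = star a * P.inner x y := by
  rw [← P.star_inner, P.inner_ract, star_mul, P.star_inner]

lemma real_smul_inner (r : ℝ) (x y : P.carrier) :
    P.inner ((r : ℂ) • x) y = r • P.inner x y := by
  rw [LinearMap.map_smulₛₗ, LinearMap.smul_apply, Complex.conj_ofReal, Complex.coe_smul]

lemma inner_real_smul (r : ℝ) (x y : P.carrier) :
    P.inner x ((r : ℂ) • y) = r • P.inner x y := by
  simp

lemma norm_inner_sq_le (x y : P.carrier) :
    ‖P.inner x y‖ ^ 2 ≤ ‖P.inner x x‖ * ‖P.inner y y‖ := by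
  have key : ∀ r : ℝ, ‖P.inner x x‖ < r → ‖P.inner x y‖ ^ 2 ≤ r * ‖P.inner y y‖ := by
    intro r hr
    have hr0 : 0 < r := (norm_nonneg _).trans_lt hr
    set a := P.inner x y with ha
    have h0 := P.inner_self_nonneg (P.ract a x - (r : ℂ) • y)
    have h1 : P.inner (P.ract a x - (r : ℂ) • y) (P.ract a x - (r : ℂ) • y)
        = star a * P.inner x x * a - (2 * r) • (star a * a) + (r * r) • P.inner y y := by
      have e : P.inner y x = star a := by rw [ha, P.star_inner]
      simp only [map_sub, LinearMap.sub_apply, P.inner_real_smul, P.real_smul_inner,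
        P.inner_ract, P.inner_ract_left, e, ← ha, smul_smul, two_mul, add_smul,
        mul_assoc]
      abel
    have h2 : star a * P.inner x x * a ≤ r • (star a * a) := by
      refine (CStarAlgebra.star_left_conjugate_le_norm_smul
        (IsSelfAdjoint.of_nonneg (P.inner_self_nonneg x))).trans ?_
      exact smul_le_smul_of_nonneg_right hr.le (star_mul_self_nonneg a)
    have h3 : r • (star a * a) ≤ r • (r • P.inner y y) := by
      rw [h1] at h0
      have h4 : 0 ≤ r • (star a * a) - (2 * r) • (star a * a) + (r * r) • P.inner y y :=
        h0.trans (by gcongr)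
      rw [← sub_nonneg]
      convert h4 using 1
      rw [two_mul, add_smul, smul_smul]
      abel
    have h5 : star a * a ≤ r • P.inner y y := (smul_le_smul_iff_of_pos_left hr0).1 h3
    have h6 := CStarAlgebra.norm_le_norm_of_nonneg_of_le (star_mul_self_nonneg a) h5
    rw [CStarRing.norm_star_mul_self, norm_smul, Real.norm_of_nonneg hr0.le] at h6
    nlinarith
  refine ge_of_tendsto (x := nhdsWithin ‖P.inner x x‖ (Set.Ioi _))
    (f := fun r : ℝ => r * ‖P.inner y y‖) ?_ (Filter.eventually_of_mem self_mem_nhdsWithin key)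
  exact ((continuous_mul_const _).tendsto _).mono_left nhdsWithin_le_nhds

instance : Norm P.carrier := ⟨fun x => √‖P.inner x x‖⟩

lemma norm_def (x : P.carrier) : ‖x‖ = √‖P.inner x x‖ := rfl

lemma norm_sq (x : P.carrier) : ‖x‖ ^ 2 = ‖P.inner x x‖ := Real.sq_sqrt (norm_nonneg _)

lemma norm_nonneg' (x : P.carrier) : 0 ≤ ‖x‖ := Real.sqrt_nonneg _

lemma norm_inner_le (x y : P.carrier) : ‖P.inner x y‖ ≤ ‖x‖ * ‖y‖ := by
  refine le_of_sq_le_sq ?_ (mul_nonneg (P.norm_nonneg' x) (P.norm_nonneg' y))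
  rw [mul_pow, P.norm_sq, P.norm_sq]
  exact P.norm_inner_sq_le x y

lemma core : SeminormedSpace.Core ℂ P.carrier where
  norm_nonneg := P.norm_nonneg'
  norm_smul c x := by
    refine (sq_eq_sq₀ (P.norm_nonneg' _) (mul_nonneg (norm_nonneg _) (P.norm_nonneg' x))).1 ?_
    rw [mul_pow, P.norm_sq, P.norm_sq]
    simp [norm_smul, sq, mul_assoc]
  norm_triangle x y := by
    refine le_of_sq_le_sq ?_ (add_nonneg (P.norm_nonneg' x) (P.norm_nonneg' y))
    rw [P.norm_sq]
    simp only [map_add, LinearMap.add_apply]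
    have h1 := P.norm_inner_le x y
    have h2 := P.norm_inner_le y x
    have h3 := P.norm_sq x
    have h4 := P.norm_sq y
    calc _ ≤ ‖P.inner x x‖ + ‖P.inner y x‖ + (‖P.inner x y‖ + ‖P.inner y y‖) :=
          (norm_add_le _ _).trans (add_le_add (norm_add_le _ _) (norm_add_le _ _))
      _ ≤ _ := by nlinarith

instance : SeminormedAddCommGroup P.carrier := SeminormedAddCommGroup.ofCore P.core

instance : NormedSpace ℂ P.carrier  where
  norm_smul_le r x := (P.core.norm_smul r x).le

/-- For `h = a⋆a` and `t = ‖a‖` there is a self-adjoint `d` in `A` with `(t - d)² = t² - h`. -/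
lemma exists_sqrt_defect (a : A) :
    ∃ d : A, star d = d ∧ (2 * ‖a‖) • d - d * d = star a * a := by
  set t := ‖a‖
  set h := star a * a with hh
  have hpos : 0 ≤ h := star_mul_self_nonneg a
  have hsa : IsSelfAdjoint h := IsSelfAdjoint.of_nonneg hpos
  let f : ℝ → ℝ := fun s => t - √(t ^ 2 - s)
  have hf : Continuous f := by fun_prop
  have hf0 : f 0 = 0 := by simp [f, t]
  refine ⟨cfcₙ f h, (cfcₙ_predicate (R := ℝ) f h).star_eq, ?_⟩
  rw [← cfcₙ_mul f f h, ← cfcₙ_smul (2 * t) f h, ← cfcₙ_sub _ _ h]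
  conv_rhs => rw [← cfcₙ_id ℝ h]
  refine cfcₙ_congr fun s hs => ?_
  have hs' : s ≤ t ^ 2 := by
    have := NonUnitalIsometricContinuousFunctionalCalculus.norm_quasispectrum_le (𝕜 := ℝ) h hs
    rw [hh, CStarRing.norm_star_mul_self] at this
    exact (le_abs_self s).trans (this.trans (sq t).ge)
  have := Real.sq_sqrt (sub_nonneg.2 hs')
  simp only [f, smul_eq_mul, id]
  nlinarith

lemma norm_lact_le (a : A) (x : P.carrier) : ‖P.lact a x‖ ≤ ‖a‖ * ‖x‖ := by
  obtain ⟨d, hd, hda⟩ := exists_sqrt_defect a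
  have h0 := P.inner_self_nonneg ((‖a‖ : ℂ) • x - P.lact d x)
  have h1 : P.inner ((‖a‖ : ℂ) • x - P.lact d x) ((‖a‖ : ℂ) • x - P.lact d x)
      = (‖a‖ ^ 2) • P.inner x x - P.inner (P.lact a x) (P.lact a x) := by
    rw [P.inner_lact a, ← P.lact_mul, ← hda]
    simp only [map_sub, LinearMap.sub_apply, P.inner_real_smul, P.real_smul_inner,
      P.inner_lact, hd, ← P.lact_mul]
    have : P.lact ((2 * ‖a‖) • d) x = ((2 * ‖a‖ : ℝ) : ℂ) • P.lact d x := by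
      rw [← Complex.coe_smul, map_smul]; rfl
    rw [this, P.inner_real_smul, sq, mul_smul, two_mul, add_smul]
    abel
  rw [h1, sub_nonneg] at h0
  have h2 := CStarAlgebra.norm_le_norm_of_nonneg_of_le (P.inner_self_nonneg _) h0
  rw [norm_smul, ← P.norm_sq, ← P.norm_sq, norm_pow, norm_norm, ← mul_pow] at h2
  exact le_of_sq_le_sq h2 (by positivity)

lemma norm_ract_le (a : A) (x : P.carrier) : ‖P.ract a x‖ ≤ ‖a‖ * ‖x‖ := by
  refine le_of_sq_le_sq ?_ (by positivity)
  rw [P.norm_sq, P.inner_ract, P.inner_ract_left, mul_pow, P.norm_sq]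
  calc _ ≤ ‖star a‖ * ‖P.inner x x‖ * ‖a‖ :=
        (norm_mul_le _ _).trans (by gcongr; exact norm_mul_le _ _)
    _ = _ := by rw [norm_star]; ring

/-- `a · x` as a continuous operator. -/
def lactL (a : A) : P.carrier →L[ℂ] P.carrier :=
  (P.lact a).mkContinuous ‖a‖ (P.norm_lact_le a)

/-- `x · a` as a continuous operator. -/
def ractL (a : A) : P.carrier →L[ℂ] P.carrier :=
  (P.ract a).mkContinuous ‖a‖ (P.norm_ract_le a)

/-- The continuous extension of a continuous linear map to the completion. -/
def ext {F : Type*} [NormedAddCommGroup F] [NormedSpace ℂ F] [CompleteSpace F]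
    (f : P.carrier →L[ℂ] F) : UniformSpace.Completion P.carrier →L[ℂ] F :=
  f.extend (UniformSpace.Completion.toComplL (𝕜 := ℂ))

lemma ext_coe {F : Type*} [NormedAddCommGroup F] [NormedSpace ℂ F] [CompleteSpace F]
    (f : P.carrier →L[ℂ] F) (x : P.carrier) :
    P.ext f (x : UniformSpace.Completion P.carrier) = f x :=
  f.extend_eq (e := UniformSpace.Completion.toComplL (𝕜 := ℂ))
    UniformSpace.Completion.denseRange_coe (UniformSpace.Completion.isUniformInducing_coe _) x

/-- The left action on the completion. -/
def lactC (a : A) :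
    UniformSpace.Completion P.carrier →L[ℂ] UniformSpace.Completion P.carrier :=
  P.ext ((UniformSpace.Completion.toComplL (𝕜 := ℂ)).comp (P.lactL a))

/-- The right action on the completion. -/
def ractC (a : A) :
    UniformSpace.Completion P.carrier →L[ℂ] UniformSpace.Completion P.carrier :=
  P.ext ((UniformSpace.Completion.toComplL (𝕜 := ℂ)).comp (P.ractL a))

lemma lactC_coe (a : A) (x : P.carrier) :
    P.lactC a (x : UniformSpace.Completion P.carrier) = (P.lact a x : P.carrier) :=
  P.ext_coe _ x

lemma ractC_coe (a : A) (x : P.carrier) :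
    P.ractC a (x : UniformSpace.Completion P.carrier) = (P.ract a x : P.carrier) :=
  P.ext_coe _ x

lemma clm_ext {F : Type*} [NormedAddCommGroup F] [NormedSpace ℂ F]
    {f g : UniformSpace.Completion P.carrier →L[ℂ] F}
    (h : ∀ x : P.carrier, f (x : UniformSpace.Completion P.carrier) = g x) : f = g :=
  ContinuousLinearMap.ext fun x => UniformSpace.Completion.induction_on x
    (isClosed_eq f.continuous g.continuous) h

lemma lactC_add (a b : A) : P.lactC (a + b) = P.lactC a + P.lactC b :=
  P.clm_ext fun x => by
    rw [add_apply, lactC_coe, lactC_coe, lactC_coe, map_add, LinearMap.add_apply,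
      UniformSpace.Completion.coe_add]

lemma lactC_smul (c : ℂ) (a : A) : P.lactC (c • a) = c • P.lactC a :=
  P.clm_ext fun x => by
    rw [smul_apply, lactC_coe, lactC_coe, map_smul, LinearMap.smul_apply,
      UniformSpace.Completion.coe_smul]

lemma ractC_add (a b : A) : P.ractC (a + b) = P.ractC a + P.ractC b :=
  P.clm_ext fun x => by
    rw [add_apply, ractC_coe, ractC_coe, ractC_coe, map_add, LinearMap.add_apply,
      UniformSpace.Completion.coe_add]

lemma ractC_smul (c : ℂ) (a : A) : P.ractC (c • a) = c • P.ractC a :=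
  P.clm_ext fun x => by
    rw [smul_apply, ractC_coe, ractC_coe, map_smul, LinearMap.smul_apply,
      UniformSpace.Completion.coe_smul]

/-- The pairing on the completion. -/
def innerC (x y : UniformSpace.Completion P.carrier) : A :=
  (UniformSpace.Completion.isDenseInducing_coe.prodMap
    UniformSpace.Completion.isDenseInducing_coe).extend
      (fun p : P.carrier × P.carrier => P.inner p.1 p.2) (x, y)

lemma continuous_inner : Continuous fun p : P.carrier × P.carrier => P.inner p.1 p.2 := by
  let f : P.carrier →L⋆[ℂ] P.carrier →L[ℂ] A := LinearMap.mkContinuous₂ P.inner 1 fun x y => by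
    rw [one_mul]; exact P.norm_inner_le x y
  have h : Continuous fun p : P.carrier × P.carrier => f p.1 p.2 :=
    (f.continuous.comp continuous_fst).clm_apply continuous_snd
  exact h

lemma innerC_coe (x y : P.carrier) : P.innerC x y = P.inner x y :=
  (UniformSpace.Completion.isDenseInducing_coe.prodMap
    UniformSpace.Completion.isDenseInducing_coe).extend_eq P.continuous_inner (x, y)

lemma continuous_innerC_pair :
    Continuous fun p : UniformSpace.Completion P.carrier × UniformSpace.Completion P.carrier =>
      P.innerC p.1 p.2 := by
  let inner' : P.carrier →+ P.carrier →+ A :=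
    { toFun := fun x => (P.inner x).toAddMonoidHom
      map_zero' := by ext x; simp
      map_add' := fun x y => by ext z; simp }
  have : Continuous fun p : P.carrier × P.carrier => inner' p.1 p.2 := P.continuous_inner
  exact (UniformSpace.Completion.isDenseInducing_toCompl P.carrier).extend_Z_bilin
    (UniformSpace.Completion.isDenseInducing_toCompl P.carrier) this

@[fun_prop]
lemma continuous_innerC {X : Type*} [TopologicalSpace X]
    {f g : X → UniformSpace.Completion P.carrier}
    (hf : Continuous f) (hg : Continuous g) : Continuous fun x => P.innerC (f x) (g x) :=
  P.continuous_innerC_pair.comp (hf.prodMk hg)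

lemma innerC_add_left (x y z : UniformSpace.Completion P.carrier) :
    P.innerC (x + y) z = P.innerC x z + P.innerC y z := by
  refine UniformSpace.Completion.induction_on₃ x y z (isClosed_eq (by fun_prop) (by fun_prop))
    fun x y z => ?_
  rw [← UniformSpace.Completion.coe_add, innerC_coe, innerC_coe, innerC_coe, map_add,
    LinearMap.add_apply]

lemma innerC_add_right (x y z : UniformSpace.Completion P.carrier) :
    P.innerC x (y + z) = P.innerC x y + P.innerC x z := by
  refine UniformSpace.Completion.induction_on₃ x y z (isClosed_eq (by fun_prop) (by fun_prop))
    fun x y z => ?_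
  rw [← UniformSpace.Completion.coe_add, innerC_coe, innerC_coe, innerC_coe, map_add]

lemma innerC_smul_left (c : ℂ) (x y : UniformSpace.Completion P.carrier) :
    P.innerC (c • x) y = (starRingEnd ℂ c) • P.innerC x y := by
  refine UniformSpace.Completion.induction_on₂ x y (isClosed_eq
    (P.continuous_innerC (continuous_fst.const_smul c) continuous_snd)
    ((P.continuous_innerC continuous_fst continuous_snd).const_smul (starRingEnd ℂ c)))
    fun x y => ?_
  rw [← UniformSpace.Completion.coe_smul, innerC_coe, innerC_coe, LinearMap.map_smulₛₗ,
    LinearMap.smul_apply]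

lemma innerC_smul_right (c : ℂ) (x y : UniformSpace.Completion P.carrier) :
    P.innerC x (c • y) = c • P.innerC x y := by
  refine UniformSpace.Completion.induction_on₂ x y (isClosed_eq
    (P.continuous_innerC continuous_fst (continuous_snd.const_smul c))
    ((P.continuous_innerC continuous_fst continuous_snd).const_smul c))
    fun x y => ?_
  rw [← UniformSpace.Completion.coe_smul, innerC_coe, innerC_coe, map_smul]

/-- The pairing on the completion as a sesquilinear map. -/
def innerS : UniformSpace.Completion P.carrier →ₗ⋆[ℂ] UniformSpace.Completion P.carrier →ₗ[ℂ] A :=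
  LinearMap.mk₂'ₛₗ _ _ P.innerC P.innerC_add_left P.innerC_smul_left P.innerC_add_right
    P.innerC_smul_right

lemma lactC_mul (a b : A) (x : UniformSpace.Completion P.carrier) :
    P.lactC (a * b) x = P.lactC a (P.lactC b x) := by
  refine UniformSpace.Completion.induction_on x (isClosed_eq (by fun_prop) (by fun_prop))
    fun x => ?_
  rw [lactC_coe, lactC_coe, lactC_coe, lact_mul]

lemma ractC_mul (a b : A) (x : UniformSpace.Completion P.carrier) :
    P.ractC (a * b) x = P.ractC b (P.ractC a x) := by
  refine UniformSpace.Completion.induction_on x (isClosed_eq (by fun_prop) (by fun_prop))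
    fun x => ?_
  rw [ractC_coe, ractC_coe, ractC_coe, ract_mul]

lemma lactC_ractC (a b : A) (x : UniformSpace.Completion P.carrier) :
    P.lactC a (P.ractC b x) = P.ractC b (P.lactC a x) := by
  refine UniformSpace.Completion.induction_on x (isClosed_eq (by fun_prop) (by fun_prop))
    fun x => ?_
  rw [lactC_coe, ractC_coe, lactC_coe, ractC_coe, lact_ract]

lemma star_innerC (x y : UniformSpace.Completion P.carrier) :
    star (P.innerC x y) = P.innerC y x := by
  refine UniformSpace.Completion.induction_on₂ x y (isClosed_eq (by fun_prop) (by fun_prop))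
    fun x y => ?_
  rw [innerC_coe, innerC_coe, star_inner]

lemma innerC_self_nonneg (x : UniformSpace.Completion P.carrier) : 0 ≤ P.innerC x x := by
  refine UniformSpace.Completion.induction_on x (isClosed_le (by fun_prop) (by fun_prop))
    fun x => ?_
  rw [innerC_coe]
  exact P.inner_self_nonneg x

lemma innerC_ractC (a : A) (x y : UniformSpace.Completion P.carrier) :
    P.innerC x (P.ractC a y) = P.innerC x y * a := by
  refine UniformSpace.Completion.induction_on₂ x y (isClosed_eq (by fun_prop) (by fun_prop))
    fun x y => ?_
  rw [ractC_coe, innerC_coe, innerC_coe, inner_ract]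

lemma innerC_lactC (a : A) (x y : UniformSpace.Completion P.carrier) :
    P.innerC (P.lactC a x) y = P.innerC x (P.lactC (star a) y) := by
  refine UniformSpace.Completion.induction_on₂ x y (isClosed_eq (by fun_prop) (by fun_prop))
    fun x y => ?_
  rw [lactC_coe, lactC_coe, innerC_coe, innerC_coe, inner_lact]

lemma normC_sq (x : UniformSpace.Completion P.carrier) : ‖x‖ ^ 2 = ‖P.innerC x x‖ := by
  refine UniformSpace.Completion.induction_on x (isClosed_eq (by fun_prop) (by fun_prop))
    fun x => ?_
  rw [innerC_coe, UniformSpace.Completion.norm_coe, P.norm_sq]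

/-- The Hausdorff completion of a right pre-Hilbert bimodule: vectors of length zero are divided
out and the quotient is completed. -/
def completion : HilbertBimodule A where
  carrier := UniformSpace.Completion P.carrier
  inner := P.innerS
  lact := { toFun := P.lactC, map_add' := P.lactC_add, map_smul' := P.lactC_smul }
  ract := { toFun := P.ractC, map_add' := P.ractC_add, map_smul' := P.ractC_smul }
  lact_mul := P.lactC_mul
  ract_mul := P.ractC_mul
  lact_ract := P.lactC_ractC
  star_inner := P.star_innerC
  inner_self_nonneg := P.innerC_self_nonneg
  inner_ract := P.innerC_ractC
  inner_lact := P.innerC_lactC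
  norm_sq := P.normC_sq

/-- The canonical map of a right pre-Hilbert bimodule into its completion. -/
def toCompletion : P.carrier →ₗ[ℂ] P.completion.carrier :=
  (UniformSpace.Completion.toComplL (𝕜 := ℂ)).toLinearMap

end PreBimodule

namespace HilbertBimodule

variable (E F : HilbertBimodule A)

lemma inner_ract_left (a : A) (x y : E.carrier) :
    E.inner (E.ract a x) y = star a * E.inner x y := by
  rw [← E.star_inner, E.inner_ract, star_mul, E.star_inner]

lemma norm_sq_inner_le (x y : E.carrier) : ‖E.inner x y‖ ^ 2 ≤ ‖E.inner x x‖ * ‖E.inner y y‖ :=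
  PreBimodule.norm_inner_sq_le
    { carrier := E.carrier
      inner := E.inner
      lact := (ContinuousLinearMap.coeLM ℂ).comp E.lact
      ract := (ContinuousLinearMap.coeLM ℂ).comp E.ract
      lact_mul := E.lact_mul
      ract_mul := E.ract_mul
      lact_ract := E.lact_ract
      star_inner := E.star_inner
      inner_self_nonneg := E.inner_self_nonneg
      inner_ract := E.inner_ract
      inner_lact := E.inner_lact } x y

/-- The matrix `(⟨m i, m j⟩)` of inner products in a right Hilbert module is positive. -/
lemma gram_eq_star_mul_self {ι : Type} [Fintype ι] [DecidableEq ι] (m : ι → E.carrier) :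
    ∃ T : CStarMatrix ι ι A, ∀ i j, E.inner (m i) (m j) = ∑ k, star (T k i) * T k j := by
  let X : CStarMatrix ι ι A := CStarMatrix.ofMatrix (Matrix.of fun i j => E.inner (m i) (m j))
  have hX : ∀ i j, X i j = E.inner (m i) (m j) := fun i j => rfl
  have hsa : IsSelfAdjoint X := by
    ext i j
    rw [CStarMatrix.star_apply, hX, hX, E.star_inner]
  obtain ⟨Y, Z, hY, hYZ, hT⟩ := exists_compression X hsa
  have hYs : ∀ i j, star (Y j i) = Y i j := fun i j => by
    conv_rhs => rw [← hY]
    rw [CStarMatrix.star_apply]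
  have hZ : Z = 0 := by
    ext k i
    have h1 := congrFun₂ hYZ i i
    have h2 : (Y * X * Y + star Z * Z) i i = (Y * X * Y) i i + (star Z * Z) i i := rfl
    have h3 : (Y * X * Y) i i
        = E.inner (∑ j, E.ract (Y j i) (m j)) (∑ j, E.ract (Y j i) (m j)) := by
      simp only [CStarMatrix.mul_apply, hX, map_sum, LinearMap.sum_apply, E.inner_ract,
        E.inner_ract_left, hYs, Finset.sum_mul]
    have h4 : (star Z * Z) i i = ∑ k, star (Z k i) * Z k i := by
      simp only [CStarMatrix.mul_apply, CStarMatrix.star_apply]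
    rw [h2] at h1
    have h5 : ∑ k, star (Z k i) * Z k i = 0 := by
      refine le_antisymm ?_ (Finset.sum_nonneg fun k _ => star_mul_self_nonneg _)
      have h6 : E.inner (∑ j, E.ract (Y j i) (m j)) (∑ j, E.ract (Y j i) (m j))
          + ∑ k, star (Z k i) * Z k i = 0 := by
        rw [← h3, ← h4]
        exact h1
      exact (le_add_of_nonneg_left (E.inner_self_nonneg _)).trans h6.le
    rw [Finset.sum_eq_zero_iff_of_nonneg fun k _ => star_mul_self_nonneg _] at h5
    exact CStarRing.star_mul_self_eq_zero_iff _ |>.1 (h5 k (Finset.mem_univ k))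
  obtain ⟨T, hT⟩ := hT hZ
  refine ⟨T, fun i j => ?_⟩
  rw [← hX, hT, CStarMatrix.mul_apply]
  simp only [CStarMatrix.star_apply]

/-- The pairing `⟨m ⊗ n, m' ⊗ n'⟩ = ⟨n, ⟨m, m'⟩ · n'⟩` on the algebraic tensor product. -/
def tensorInner : E.carrier ⊗[ℂ] F.carrier →ₗ⋆[ℂ] E.carrier ⊗[ℂ] F.carrier →ₗ[ℂ] A :=
  TensorProduct.lift <| LinearMap.mk₂'ₛₗ (starRingEnd ℂ) (starRingEnd ℂ)
    (fun m n => TensorProduct.lift <| LinearMap.mk₂ ℂ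
      (fun m' n' => F.inner n (F.lact (E.inner m m') n'))
      (fun x y z => by simp only [map_add, add_apply])
      (fun c x y => by simp only [map_smul, smul_apply])
      (fun x y z => by simp only [map_add])
      (fun c x y => by simp only [map_smul]))
    (fun x y z => TensorProduct.ext' fun m' n' => by
      simp [LinearMap.mk₂_apply])
    (fun c x y => TensorProduct.ext' fun m' n' => by
      simp [LinearMap.mk₂_apply])
    (fun x y z => TensorProduct.ext' fun m' n' => by
      simp [LinearMap.mk₂_apply])
    (fun c x y => TensorProduct.ext' fun m' n' => by
      simp [LinearMap.mk₂_apply])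

lemma tensorInner_tmul (m m' : E.carrier) (n n' : F.carrier) :
    E.tensorInner F (m ⊗ₜ n) (m' ⊗ₜ n') = F.inner n (F.lact (E.inner m m') n') := rfl

lemma tensorInner_self_nonneg (x : E.carrier ⊗[ℂ] F.carrier) : 0 ≤ E.tensorInner F x x := by
  obtain ⟨k, m, n, rfl⟩ := TensorProduct.exists_sum_tmul_eq x
  obtain ⟨T, hT⟩ := E.gram_eq_star_mul_self m
  have : E.tensorInner F (∑ j, m j ⊗ₜ n j) (∑ j, m j ⊗ₜ n j)
      = ∑ l, F.inner (∑ j, F.lact (T l j) (n j)) (∑ j, F.lact (T l j) (n j)) := by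
    simp only [map_sum, LinearMap.sum_apply, tensorInner_tmul, hT, sum_apply, F.lact_mul,
      F.inner_lact]
    conv_rhs => rw [Finset.sum_comm]
    exact Finset.sum_congr rfl fun j _ => Finset.sum_comm
  rw [this]
  exact Finset.sum_nonneg fun l _ => F.inner_self_nonneg _

/-- The algebraic tensor product of two right-Hilbert bimodules. The relations
`m · a ⊗ n = m ⊗ a · n` hold up to vectors of length zero. -/
def tensorPre : PreBimodule A where
  carrier := E.carrier ⊗[ℂ] F.carrier
  inner := E.tensorInner F
  lact :=
    { toFun := fun a => (E.lact a).toLinearMap.rTensor F.carrier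
      map_add' := fun a b => by rw [map_add]; exact LinearMap.rTensor_add _ _ _
      map_smul' := fun c a => by rw [map_smul]; exact LinearMap.rTensor_smul _ _ _ }
  ract :=
    { toFun := fun a => (F.ract a).toLinearMap.lTensor E.carrier
      map_add' := fun a b => by rw [map_add]; exact LinearMap.lTensor_add _ _ _
      map_smul' := fun c a => by rw [map_smul]; exact LinearMap.lTensor_smul _ _ _ }
  lact_mul a b x := by
    induction x with
    | zero => simp only [map_zero]
    | add x y hx hy => simp only [map_add, hx, hy]
    | tmul m n => simp [E.lact_mul]
  ract_mul a b x := by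
    induction x with
    | zero => simp only [map_zero]
    | add x y hx hy => simp only [map_add, hx, hy]
    | tmul m n => simp [F.ract_mul]
  lact_ract a b x := by
    induction x with
    | zero => simp only [map_zero]
    | add x y hx hy => simp only [map_add, hx, hy]
    | tmul m n => simp
  star_inner x y := by
    induction x with
    | zero => simp
    | add x x' hx hx' => simp only [map_add, LinearMap.add_apply, star_add, hx, hx']
    | tmul m n =>
      induction y with
      | zero => simp
      | add y y' hy hy' => simp only [map_add, LinearMap.add_apply, star_add, hy, hy']
      | tmul m' n' => rw [tensorInner_tmul, tensorInner_tmul, F.star_inner, F.inner_lact,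
          E.star_inner]
  inner_self_nonneg := E.tensorInner_self_nonneg F
  inner_ract a x y := by
    induction x with
    | zero => simp
    | add x x' hx hx' => simp only [map_add, LinearMap.add_apply, add_mul, hx, hx']
    | tmul m n =>
      induction y with
      | zero => simp
      | add y y' hy hy' => simp only [map_add, add_mul, hy, hy']
      | tmul m' n' =>
        simp only [LinearMap.coe_mk, AddHom.coe_mk, LinearMap.lTensor_tmul,
          ContinuousLinearMap.coe_coe, tensorInner_tmul, F.lact_ract, F.inner_ract]
  inner_lact a x y := by
    induction x with
    | zero => simp
    | add x x' hx hx' => simp only [map_add, LinearMap.add_apply, hx, hx']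
    | tmul m n =>
      induction y with
      | zero => simp
      | add y y' hy hy' => simp only [map_add, hy, hy']
      | tmul m' n' =>
        simp only [LinearMap.coe_mk, AddHom.coe_mk, LinearMap.rTensor_tmul,
          ContinuousLinearMap.coe_coe, tensorInner_tmul, E.inner_lact]

/-- The internal tensor product `E ⊗_A F`. -/
def tensor : HilbertBimodule A := (E.tensorPre F).completion

/-- The elementary tensor `m ⊗_A n`. -/
def tmul (m : E.carrier) (n : F.carrier) : (E.tensor F).carrier :=
  (E.tensorPre F).toCompletion (m ⊗ₜ[ℂ] n : E.carrier ⊗[ℂ] F.carrier)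

variable (A) in
/-- `A` as a right-Hilbert bimodule over itself, with `⟨a, b⟩ = a⋆b`. -/
def self : HilbertBimodule A where
  carrier := A
  inner := LinearMap.mk₂'ₛₗ (starRingEnd ℂ) (RingHom.id ℂ) (fun a b => star a * b)
    (fun x y z => by rw [star_add, add_mul])
    (fun c x y => by rw [star_smul, smul_mul_assoc]; rfl)
    (fun x y z => mul_add _ _ _)
    (fun c x y => by rw [mul_smul_comm]; rfl)
  lact := (ContinuousLinearMap.mul ℂ A).toLinearMap
  ract := (ContinuousLinearMap.mul ℂ A).flip.toLinearMap
  lact_mul a b x := mul_assoc a b x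
  ract_mul a b x := (mul_assoc x a b).symm
  lact_ract a b x := (mul_assoc a x b).symm
  star_inner x y := by
    change star (star x * y) = star y * x
    rw [star_mul, star_star]
  inner_self_nonneg x := star_mul_self_nonneg x
  inner_ract a x y := (mul_assoc _ _ _).symm
  inner_lact a x y := by
    change star (a * x) * y = star x * (star a * y)
    rw [star_mul, mul_assoc]
  norm_sq x := by
    change ‖x‖ ^ 2 = ‖star x * x‖
    rw [CStarRing.norm_star_mul_self, sq]

/-- The tensor powers `E^{⊗ 0} = A` and `E^{⊗ (i + 1)} = E ⊗_A E^{⊗ i}`. -/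
def pow : ℕ → HilbertBimodule A
  | 0 => self A
  | i + 1 => E.tensor (pow i)

lemma norm_inner_le (x y : E.carrier) : ‖E.inner x y‖ ≤ ‖x‖ * ‖y‖ := by
  refine le_of_sq_le_sq ?_ (by positivity)
  rw [mul_pow, E.norm_sq, E.norm_sq]
  exact E.norm_sq_inner_le x y

lemma norm_ract_le (a : A) (x : E.carrier) : ‖E.ract a x‖ ≤ ‖a‖ * ‖x‖ := by
  refine le_of_sq_le_sq ?_ (by positivity)
  rw [E.norm_sq, E.inner_ract, E.inner_ract_left, mul_pow, E.norm_sq]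
  calc _ ≤ ‖star a‖ * ‖E.inner x x‖ * ‖a‖ :=
        (norm_mul_le _ _).trans (by gcongr; exact norm_mul_le _ _)
    _ = _ := by rw [norm_star]; ring

/-- The rank-one operator `Θ_{m, n} : p ↦ m · ⟨n, p⟩`. -/
def rankOne (m n : E.carrier) : E.carrier →L[ℂ] E.carrier :=
  LinearMap.mkContinuous
    { toFun := fun p => E.ract (E.inner n p) m
      map_add' := fun x y => by rw [map_add, map_add, add_apply]
      map_smul' := fun c x => by rw [map_smul, map_smul, smul_apply, RingHom.id_apply] }
    (‖m‖ * ‖n‖) fun p => (E.norm_ract_le _ m).trans <| by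
      have := mul_le_mul_of_nonneg_right (E.norm_inner_le n p) (norm_nonneg m)
      linarith

/-- The compact operators `𝒦(E)`: the closed linear span of the rank-one operators. -/
def compacts : Submodule ℂ (E.carrier →L[ℂ] E.carrier) :=
  (Submodule.span ℂ
    (Set.range fun p : E.carrier × E.carrier => E.rankOne p.1 p.2)).topologicalClosure

lemma rankOne_mem (m n : E.carrier) : E.rankOne m n ∈ E.compacts :=
  Submodule.le_topologicalClosure _ (Submodule.subset_span ⟨(m, n), rfl⟩)

end HilbertBimodule

end Correspondences

section Representations

variable {A : Type u} [NonUnitalCStarAlgebra A] [PartialOrder A] [StarOrderedRing A]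

/-- A representation `(ψ, π)` of a right-Hilbert bimodule `E` in a C⋆-algebra `B`, with the
homomorphism `π : A → B` as a parameter. -/
structure Rep (E : HilbertBimodule A) {B : Type v} [NonUnitalCStarAlgebra B]
    (π : A →⋆ₙₐ[ℂ] B) where
  ψ : E.carrier →ₗ[ℂ] B
  map_ract : ∀ a m, ψ (E.ract a m) = ψ m * π a
  star_mul_map : ∀ m n, star (ψ m) * ψ n = π (E.inner m n)
  map_lact : ∀ a m, ψ (E.lact a m) = π a * ψ m

namespace Rep

variable {E F : HilbertBimodule A} {B : Type v} [NonUnitalCStarAlgebra B] {π : A →⋆ₙₐ[ℂ] B}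

lemma norm_le (r : Rep E π) (m : E.carrier) : ‖r.ψ m‖ ≤ ‖m‖ := by
  refine le_of_sq_le_sq ?_ (norm_nonneg _)
  rw [sq, ← CStarRing.norm_star_mul_self, r.star_mul_map, E.norm_sq]
  exact NonUnitalStarAlgHom.norm_apply_le π _

/-- The linear map `m ⊗ n ↦ ψ(m) ψ'(n)` on the algebraic tensor product. -/
def tensorAlg (r : Rep E π) (r' : Rep F π) : E.carrier ⊗[ℂ] F.carrier →ₗ[ℂ] B :=
  TensorProduct.lift ((LinearMap.mul ℂ B).compl₁₂ r.ψ r'.ψ)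

lemma tensorAlg_tmul (r : Rep E π) (r' : Rep F π) (m : E.carrier) (n : F.carrier) :
    r.tensorAlg r' (m ⊗ₜ n) = r.ψ m * r'.ψ n := rfl

lemma star_mul_tensorAlg (r : Rep E π) (r' : Rep F π) (x y : E.carrier ⊗[ℂ] F.carrier) :
    star (r.tensorAlg r' x) * r.tensorAlg r' y = π (E.tensorInner F x y) := by
  induction x with
  | zero => simp
  | add x x' hx hx' => simp only [map_add, LinearMap.add_apply, star_add, add_mul, hx, hx']
  | tmul m n =>
    induction y with
    | zero => simp
    | add y y' hy hy' => simp only [map_add, mul_add, hy, hy']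
    | tmul m' n' =>
      rw [tensorAlg_tmul, tensorAlg_tmul, HilbertBimodule.tensorInner_tmul, star_mul,
        ← r'.star_mul_map, r'.map_lact, ← r.star_mul_map]
      simp only [mul_assoc]

/-- The continuous linear map `m ⊗ n ↦ ψ(m) ψ'(n)` on the algebraic tensor product. -/
def tensorPreL (r : Rep E π) (r' : Rep F π) : (E.tensorPre F).carrier →L[ℂ] B :=
  LinearMap.mkContinuous (r.tensorAlg r') 1 fun x => by
    rw [one_mul]
    refine le_of_sq_le_sq ?_ (norm_nonneg _)
    rw [sq, ← CStarRing.norm_star_mul_self, PreBimodule.norm_sq]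
    refine (congrArg norm (r.star_mul_tensorAlg r' x x)).le.trans ?_
    exact NonUnitalStarAlgHom.norm_apply_le π _

lemma tensorPreL_apply (r : Rep E π) (r' : Rep F π) (x : E.carrier ⊗[ℂ] F.carrier) :
    r.tensorPreL r' x = r.tensorAlg r' x := rfl

/-- The continuous linear map `m ⊗_A n ↦ ψ(m) ψ'(n)` on the internal tensor product. -/
def tensorL (r : Rep E π) (r' : Rep F π) : (E.tensor F).carrier →L[ℂ] B :=
  (E.tensorPre F).ext (r.tensorPreL r')

lemma tensorL_tmul (r : Rep E π) (r' : Rep F π) (m : E.carrier) (n : F.carrier) :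
    r.tensorL r' (E.tmul F m n) = r.ψ m * r'.ψ n :=
  (E.tensorPre F).ext_coe _ _

lemma tensorL_coe (r : Rep E π) (r' : Rep F π) (x : (E.tensorPre F).carrier) :
    r.tensorL r' ((E.tensorPre F).toCompletion x) = r.tensorAlg r' x :=
  (E.tensorPre F).ext_coe _ _

lemma tensor_induction {p : (E.tensor F).carrier → Prop} (x : (E.tensor F).carrier)
    (hp : IsClosed {x | p x}) (h : ∀ y, p ((E.tensorPre F).toCompletion y)) : p x :=
  UniformSpace.Completion.induction_on x hp h

lemma tensorAlg_ract (r : Rep E π) (r' : Rep F π) (a : A) (x : E.carrier ⊗[ℂ] F.carrier) :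
    r.tensorAlg r' ((F.ract a).toLinearMap.lTensor E.carrier x) = r.tensorAlg r' x * π a := by
  induction x with
  | zero => simp
  | add x y hx hy => simp only [map_add, add_mul, hx, hy]
  | tmul m n =>
    rw [LinearMap.lTensor_tmul, tensorAlg_tmul, tensorAlg_tmul, mul_assoc, ← r'.map_ract]
    rfl

lemma tensorAlg_lact (r : Rep E π) (r' : Rep F π) (a : A) (x : E.carrier ⊗[ℂ] F.carrier) :
    r.tensorAlg r' ((E.lact a).toLinearMap.rTensor F.carrier x) = π a * r.tensorAlg r' x := by
  induction x with
  | zero => simp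
  | add x y hx hy => simp only [map_add, mul_add, hx, hy]
  | tmul m n =>
    rw [LinearMap.rTensor_tmul, tensorAlg_tmul, tensorAlg_tmul, ← mul_assoc, ← r.map_lact]
    rfl

lemma tensorL_ract (r : Rep E π) (r' : Rep F π) (a : A) (x : (E.tensor F).carrier) :
    r.tensorL r' ((E.tensor F).ract a x) = r.tensorL r' x * π a :=
  tensor_induction (p := fun x => r.tensorL r' ((E.tensor F).ract a x) = r.tensorL r' x * π a) x
    (isClosed_eq ((r.tensorL r').continuous.comp ((E.tensor F).ract a).continuous)
      ((r.tensorL r').continuous.mul continuous_const))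
    fun y => (congrArg (r.tensorL r') ((E.tensorPre F).ractC_coe a y)).trans <|
      (r.tensorL_coe r' _).trans <| (r.tensorAlg_ract r' a y).trans <|
        congrArg (· * π a) (r.tensorL_coe r' y).symm

lemma tensorL_lact (r : Rep E π) (r' : Rep F π) (a : A) (x : (E.tensor F).carrier) :
    r.tensorL r' ((E.tensor F).lact a x) = π a * r.tensorL r' x :=
  tensor_induction (p := fun x => r.tensorL r' ((E.tensor F).lact a x) = π a * r.tensorL r' x) x
    (isClosed_eq ((r.tensorL r').continuous.comp ((E.tensor F).lact a).continuous)
      (continuous_const.mul (r.tensorL r').continuous))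
    fun y => (congrArg (r.tensorL r') ((E.tensorPre F).lactC_coe a y)).trans <|
      (r.tensorL_coe r' _).trans <| (r.tensorAlg_lact r' a y).trans <|
        congrArg (π a * ·) (r.tensorL_coe r' y).symm

lemma star_mul_tensorL (r : Rep E π) (r' : Rep F π) (x y : (E.tensor F).carrier) :
    star (r.tensorL r' x) * r.tensorL r' y = π ((E.tensor F).inner x y) := by
  have hπ : Continuous π :=
    AddMonoidHomClass.continuous_of_bound π 1 fun a => by
      rw [one_mul]; exact NonUnitalStarAlgHom.norm_apply_le π a
  refine UniformSpace.Completion.induction_on₂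
    (p := fun x y => star (r.tensorL r' x) * r.tensorL r' y = π ((E.tensor F).inner x y)) x y
    (isClosed_eq (((r.tensorL r').continuous.comp continuous_fst).star.mul
      ((r.tensorL r').continuous.comp continuous_snd))
    (hπ.comp (E.tensorPre F).continuous_innerC_pair)) fun x y => ?_
  exact (congrArg₂ (fun b c => star b * c) (r.tensorL_coe r' x) (r.tensorL_coe r' y)).trans <|
    (r.star_mul_tensorAlg r' x y).trans <| congrArg π ((E.tensorPre F).innerC_coe x y).symm

/-- The representation `(ψ ⊗ ψ', π)` of `E ⊗_A F` with `(ψ ⊗ ψ')(m ⊗_A n) = ψ(m) ψ'(n)`. -/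
def tensor (r : Rep E π) (r' : Rep F π) : Rep (E.tensor F) π where
  ψ := r.tensorL r'
  map_ract := r.tensorL_ract r'
  star_mul_map := r.star_mul_tensorL r'
  map_lact := r.tensorL_lact r'

variable (π) in
/-- The representation `(π, π)` of the bimodule `A`. -/
def self : Rep (HilbertBimodule.self A) π where
  ψ := (π : A →ₗ[ℂ] B)
  map_ract a (m : A) := map_mul π m a
  star_mul_map (m n : A) := by
    change star (π m) * π n = π (star m * n)
    rw [map_mul, map_star]
  map_lact a (m : A) := map_mul π a m

/-- The representation `(ψ^{⊗ i}, π)` of `E^{⊗ i}`. -/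
def pow (r : Rep E π) : (i : ℕ) → Rep (E.pow i) π
  | 0 => self π
  | i + 1 => r.tensor (r.pow i)

/-- The representation `(ψ, π)` is coisometric on `J`: the homomorphism `(ψ, π)^{(1)}` of `𝒦(E)`,
that is the unique bounded linear map `T` with `T(Θ_{m, n}) = ψ(m) ψ(n)⋆`, satisfies
`T(φ(a)) = π(a)` for all `a ∈ J`. -/
def IsCoisometric (r : Rep E π) (J : Set A) (hJ : ∀ a ∈ J, E.lact a ∈ E.compacts) : Prop :=
  ∃ T : E.compacts →L[ℂ] B,
    (∀ m n, T ⟨E.rankOne m n, E.rankOne_mem m n⟩ = r.ψ m * star (r.ψ n)) ∧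
    ∀ a (ha : a ∈ J), T ⟨E.lact a, hJ a ha⟩ = π a

end Rep
end Representations

section Multipliers

/-- The strict topology on `M(A)`: pointwise norm convergence of `a ↦ m a` and `a ↦ a m`. -/
abbrev strictTopology (A : Type u) [NonUnitalCStarAlgebra A] : TopologicalSpace 𝓜(ℂ, A) :=
  TopologicalSpace.induced
    (fun m => ((fun a => m.fst a, fun a => m.snd a) : (A → A) × (A → A))) inferInstance

/-- `αbar` is a strictly continuous endomorphism of `M(A)` that extends the endomorphism `α`
of `A`. There is at most one such `αbar`. -/
structure IsStrictExtension {A : Type u} [NonUnitalCStarAlgebra A] (α : A →⋆ₙₐ[ℂ] A)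
    (αbar : 𝓜(ℂ, A) →⋆ₙₐ[ℂ] 𝓜(ℂ, A)) : Prop where
  map_coe : ∀ a : A, αbar (a : 𝓜(ℂ, A)) = (α a : 𝓜(ℂ, A))
  strictly_continuous : @Continuous _ _ (strictTopology A) (strictTopology A) αbar

/-- The endomorphism `α` of `A` is extendible. -/
def Extendible {A : Type u} [NonUnitalCStarAlgebra A] (α : A →⋆ₙₐ[ℂ] A) : Prop :=
  ∃ αbar : 𝓜(ℂ, A) →⋆ₙₐ[ℂ] 𝓜(ℂ, A), IsStrictExtension α αbar

/-- The homomorphism `π : A → B` is nondegenerate: `π(A)B` spans a dense subspace of `B`. -/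
def Nondegenerate {A : Type u} {B : Type v} [NonUnitalCStarAlgebra A] [NonUnitalCStarAlgebra B]
    (π : A →⋆ₙₐ[ℂ] B) : Prop :=
  Dense (Submodule.span ℂ (Set.range fun p : A × B => π p.1 * p.2) : Set B)

end Multipliers

section ExelSystems

variable (A : Type u) [NonUnitalCStarAlgebra A] [PartialOrder A] [StarOrderedRing A]

/-- An Exel system `(A, α, L)`: an extendible endomorphism `α` of `A` and a transfer operator `L`,
with its (unique) extension `Lbar` to `M(A)`. -/
structure ExelSystem where
  α : A →⋆ₙₐ[ℂ] A
  extendible : Extendible α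
  L : A →ₚ[ℂ] A
  Lbar : 𝓜(ℂ, A) →ₗ[ℂ] 𝓜(ℂ, A)
  /-- `Lbar` is positive. -/
  Lbar_pos : ∀ m, ∃ n, Lbar (star m * m) = star n * n
  /-- `Lbar` extends `L`. -/
  Lbar_coe : ∀ a : A, Lbar (a : 𝓜(ℂ, A)) = (L a : 𝓜(ℂ, A))
  /-- `L(α(a) m) = a Lbar(m)`; here `m.snd x` is the product `x m` in `A`. -/
  transfer : ∀ (a : A) (m : 𝓜(ℂ, A)), L (m.snd (α a)) = (Lbar m).snd a
  Lbar_one : Lbar 1 = 1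

variable {A}

namespace ExelSystem

variable (S : ExelSystem A)

lemma L_alpha_mul (a x : A) : S.L (S.α a * x) = a * S.L x := by
  have := S.transfer a (x : 𝓜(ℂ, A))
  rw [S.Lbar_coe] at this
  exact this

lemma L_mul_alpha (a x : A) : S.L (x * S.α a) = S.L x * a := by
  have := S.L_alpha_mul (star a) (star x)
  rw [map_star, ← star_mul, map_star, map_star, ← star_mul] at this
  exact star_injective this

/-- `A` with the bimodule structure `a · m = am`, `m · b = m α(b)` and the pairing
`⟨m, n⟩ = L(m⋆ n)`. -/
def preModule : PreBimodule A where
  carrier := A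
  inner := LinearMap.mk₂'ₛₗ (starRingEnd ℂ) (RingHom.id ℂ) (fun m n => S.L (star m * n))
    (fun x y z => by rw [star_add, add_mul, map_add])
    (fun c x y => by rw [star_smul, smul_mul_assoc, map_smul]; rfl)
    (fun x y z => by rw [mul_add, map_add])
    (fun c x y => by rw [mul_smul_comm, map_smul]; rfl)
  lact := LinearMap.mk₂ ℂ (fun a m => a * m) add_mul (fun c x y => smul_mul_assoc c x y) mul_add
    (fun c x y => mul_smul_comm c x y)
  ract := LinearMap.mk₂ ℂ (fun b m => m * S.α b) (fun x y z => by rw [map_add, mul_add])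
    (fun c x y => by rw [map_smul, mul_smul_comm]) (fun x y z => by rw [add_mul])
    (fun c x y => by rw [smul_mul_assoc])
  lact_mul a b x := mul_assoc a b x
  ract_mul a b x := by
    change x * S.α (a * b) = x * S.α a * S.α b
    rw [map_mul, mul_assoc]
  lact_ract a b x := (mul_assoc a x _).symm
  star_inner x y := by
    change star (S.L (star x * y)) = S.L (star y * x)
    rw [← map_star, star_mul, star_star]
  inner_self_nonneg x := map_nonneg S.L (star_mul_self_nonneg x)
  inner_ract a x y := by
    change S.L (star x * (y * S.α a)) = S.L (star x * y) * a
    rw [← mul_assoc, S.L_mul_alpha]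
  inner_lact a x y := by
    change S.L (star (a * x) * y) = S.L (star x * (star a * y))
    rw [star_mul, mul_assoc]

/-- The right-Hilbert bimodule `M_L`. Its left action `φ` is `S.M.lact`. -/
def M : HilbertBimodule A := S.preModule.completion

/-- The canonical map `q : A → M_L`. -/
def q : A →ₗ[ℂ] S.M.carrier := S.preModule.toCompletion

end ExelSystem
end ExelSystems

section RelativeCuntzPimsner

variable {A : Type u} [NonUnitalCStarAlgebra A] [PartialOrder A] [StarOrderedRing A]
variable (E : HilbertBimodule A) (J : Set A) (hJ : ∀ a ∈ J, E.lact a ∈ E.compacts)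

/-- A representation of `E` in some C⋆-algebra, coisometric on `J`. -/
structure CoisometricRep where
  B : Type u
  [cstar : NonUnitalCStarAlgebra B]
  π : A →⋆ₙₐ[ℂ] B
  rep : Rep E π
  coisometric : rep.IsCoisometric J hJ

attribute [instance] CoisometricRep.cstar

/-- The C⋆-algebra of bounded families indexed by the representations coisometric on `J`. -/
abbrev RepProduct : Type (u + 1) := lp (fun r : CoisometricRep E J hJ => r.B) ∞

/-- The direct sum of the homomorphisms `π`. -/
def prodA : A →⋆ₙₐ[ℂ] RepProduct E J hJ where
  toFun a := ⟨fun r => r.π a, memℓp_infty ⟨‖a‖, by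
    rintro _ ⟨r, rfl⟩
    exact NonUnitalStarAlgHom.norm_apply_le r.π a⟩⟩
  map_smul' c a := Subtype.ext <| funext fun r => map_smul r.π c a
  map_zero' := Subtype.ext <| funext fun r => map_zero r.π
  map_add' a b := Subtype.ext <| funext fun r => map_add r.π a b
  map_mul' a b := Subtype.ext <| funext fun r => map_mul r.π a b
  map_star' a := Subtype.ext <| funext fun r => map_star r.π a

/-- The direct sum of the linear maps `ψ`. -/
def prodM : E.carrier →ₗ[ℂ] RepProduct E J hJ where
  toFun m := ⟨fun r => r.rep.ψ m, memℓp_infty ⟨‖m‖, by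
    rintro _ ⟨r, rfl⟩
    exact r.rep.norm_le m⟩⟩
  map_smul' c a := Subtype.ext <| funext fun r => map_smul r.rep.ψ c a
  map_add' a b := Subtype.ext <| funext fun r => map_add r.rep.ψ a b

/-- The relative Cuntz–Pimsner algebra `𝒪(J, E)`: the C⋆-algebra generated by the universal
representation `(k_M, k_A)` coisometric on `J`, realised as the direct sum of all such
representations. The C⋆-algebra generated by a representation is bounded in size in terms of `A`
and `E`, so that representations in C⋆-algebras in `Type u` suffice. -/
def relCP : NonUnitalStarSubalgebra ℂ (RepProduct E J hJ) :=
  (NonUnitalStarAlgebra.adjoin ℂ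
    (Set.range (prodA E J hJ) ∪ Set.range (prodM E J hJ))).topologicalClosure

instance : IsClosed (relCP E J hJ : Set (RepProduct E J hJ)) :=
  NonUnitalStarSubalgebra.isClosed_topologicalClosure _

lemma prodA_mem (a : A) : prodA E J hJ a ∈ relCP E J hJ :=
  NonUnitalStarSubalgebra.le_topologicalClosure _
    (NonUnitalStarAlgebra.subset_adjoin ℂ _ (Or.inl ⟨a, rfl⟩))

lemma prodM_mem (m : E.carrier) : prodM E J hJ m ∈ relCP E J hJ :=
  NonUnitalStarSubalgebra.le_topologicalClosure _
    (NonUnitalStarAlgebra.subset_adjoin ℂ _ (Or.inr ⟨m, rfl⟩))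

/-- The C⋆-algebra `𝒪(J, E)` as a type. -/
def RelCP : Type (u + 1) := relCP E J hJ

instance : NonUnitalCStarAlgebra (RelCP E J hJ) :=
  inferInstanceAs (NonUnitalCStarAlgebra (relCP E J hJ))

/-- The canonical homomorphism `k_A : A → 𝒪(J, E)`. -/
def kA : A →⋆ₙₐ[ℂ] RelCP E J hJ :=
  NonUnitalStarAlgHom.codRestrict (prodA E J hJ) _ (prodA_mem E J hJ)

/-- The universal representation `(k_M, k_A)` of `E` in `𝒪(J, E)`; its linear map is `k_M`. -/
def k : Rep E (kA E J hJ) where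
  ψ := (prodM E J hJ).codRestrict (relCP E J hJ).toNonUnitalSubalgebra.toSubmodule
    (prodM_mem E J hJ)
  map_ract a m := Subtype.ext <| Subtype.ext <| funext fun r => r.rep.map_ract a m
  star_mul_map m n := Subtype.ext <| Subtype.ext <| funext fun r => r.rep.star_mul_map m n
  map_lact a m := Subtype.ext <| Subtype.ext <| funext fun r => r.rep.map_lact a m

lemma circle_star_mul (z : Circle) : star (z : ℂ) * (z : ℂ) = 1 := by
  rw [Complex.star_def, ← Circle.coe_inv_eq_conj, ← Circle.coe_mul, inv_mul_cancel, Circle.coe_one]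

variable {E J hJ} in
/-- The representation `(zψ, π)`. -/
def CoisometricRep.twist (z : Circle) (r : CoisometricRep E J hJ) : CoisometricRep E J hJ where
  B := r.B
  π := r.π
  rep :=
    { ψ := (z : ℂ) • r.rep.ψ
      map_ract := fun a m => by
        rw [LinearMap.smul_apply, LinearMap.smul_apply, r.rep.map_ract, smul_mul_assoc]
      star_mul_map := fun m n => by
        rw [LinearMap.smul_apply, LinearMap.smul_apply, star_smul, smul_mul_smul_comm,
          r.rep.star_mul_map, circle_star_mul, one_smul]
      map_lact := fun a m => by
        rw [LinearMap.smul_apply, LinearMap.smul_apply, r.rep.map_lact, mul_smul_comm] }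
  coisometric := by
    obtain ⟨T, hT, hTJ⟩ := r.coisometric
    refine ⟨T, fun m n => ?_, hTJ⟩
    rw [hT, LinearMap.smul_apply, LinearMap.smul_apply, star_smul, smul_mul_smul_comm, mul_comm,
      circle_star_mul, one_smul]

/-- Reindexing of bounded families along `(ψ, π) ↦ (zψ, π)`. -/
def prodGauge (z : Circle) : RepProduct E J hJ →⋆ₙₐ[ℂ] RepProduct E J hJ where
  toFun x := ⟨fun r => (x : ∀ r : CoisometricRep E J hJ, r.B) (r.twist z), memℓp_infty ⟨‖x‖, by
    rintro _ ⟨r, rfl⟩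
    exact lp.norm_apply_le_norm ENNReal.top_ne_zero x (r.twist z)⟩⟩
  map_smul' c a := rfl
  map_zero' := rfl
  map_add' a b := rfl
  map_mul' a b := rfl
  map_star' a := rfl

lemma prodGauge_mem (z : Circle) (x : RepProduct E J hJ) (hx : x ∈ relCP E J hJ) :
    prodGauge E J hJ z x ∈ relCP E J hJ := by
  have hc : Continuous (prodGauge E J hJ z) :=
    AddMonoidHomClass.continuous_of_bound (prodGauge E J hJ z) 1 fun a => by
      rw [one_mul]; exact NonUnitalStarAlgHom.norm_apply_le (prodGauge E J hJ z) a
  have h : relCP E J hJ ≤ (relCP E J hJ).comap (prodGauge E J hJ z) := by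
    refine NonUnitalStarSubalgebra.topologicalClosure_minimal _ (NonUnitalStarAlgebra.adjoin_le ?_)
      (IsClosed.preimage hc (NonUnitalStarSubalgebra.isClosed_topologicalClosure _))
    rintro _ (⟨a, rfl⟩ | ⟨m, rfl⟩)
    · exact prodA_mem E J hJ a
    · have : prodGauge E J hJ z (prodM E J hJ m) = prodM E J hJ ((z : ℂ) • m) := by
        rw [map_smul]; rfl
      change prodGauge E J hJ z (prodM E J hJ m) ∈ relCP E J hJ
      rw [this]
      exact prodM_mem E J hJ _
  exact h hx

/-- The gauge action: `γ_z(k_A(a)) = k_A(a)` and `γ_z(k_M(m)) = z k_M(m)`. -/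
def gauge (z : Circle) : RelCP E J hJ →⋆ₙₐ[ℂ] RelCP E J hJ :=
  NonUnitalStarAlgHom.codRestrict
    ((prodGauge E J hJ z).comp (NonUnitalStarSubalgebraClass.subtype (relCP E J hJ))) _
    fun x => prodGauge_mem E J hJ z x x.2

lemma gauge_kA (z : Circle) (a : A) : gauge E J hJ z (kA E J hJ a) = kA E J hJ a := rfl

lemma gauge_kM (z : Circle) (m : E.carrier) :
    gauge E J hJ z ((k E J hJ).ψ m) = (z : ℂ) • (k E J hJ).ψ m := rfl

/-- The core `𝒪(J, E)^γ`, the fixed-point algebra of the gauge action. -/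
def core : NonUnitalStarSubalgebra ℂ (RelCP E J hJ) where
  carrier := {x | ∀ z, gauge E J hJ z x = x}
  add_mem' hx hy z := by rw [map_add, hx z, hy z]
  zero_mem' z := map_zero _
  mul_mem' hx hy z := by rw [map_mul, hx z, hy z]
  smul_mem' c x hx z := by rw [map_smul, hx z]
  star_mem' hx z := by rw [map_star, hx z]

instance : IsClosed (core E J hJ : Set (RelCP E J hJ)) := by
  have h : (core E J hJ : Set (RelCP E J hJ)) = ⋂ z, {x | gauge E J hJ z x = x} := by
    ext x
    simp only [Set.mem_iInter]
    rfl
  rw [h]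
  refine isClosed_iInter fun z => isClosed_eq ?_ continuous_id
  exact AddMonoidHomClass.continuous_of_bound (gauge E J hJ z) 1 fun a => by
    rw [one_mul]; exact NonUnitalStarAlgHom.norm_apply_le (gauge E J hJ z) a

/-- The core as a type. -/
def Core : Type (u + 1) := core E J hJ

instance : NonUnitalCStarAlgebra (Core E J hJ) :=
  inferInstanceAs (NonUnitalCStarAlgebra (core E J hJ))

/-- The inclusion of the core in `𝒪(J, E)`. -/
def coreIncl : Core E J hJ →⋆ₙₐ[ℂ] RelCP E J hJ :=
  NonUnitalStarSubalgebraClass.subtype (core E J hJ)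

end RelativeCuntzPimsner

section Stacey

variable {C : Type w} [NonUnitalCStarAlgebra C] (β : C →⋆ₙₐ[ℂ] C)

/-- `(π, V)` is a Stacey-covariant representation of `(C, β)` in `B`. -/
structure IsStaceyCovariant {B : Type v} [NonUnitalCStarAlgebra B] (π : C →⋆ₙₐ[ℂ] B)
    (V : 𝓜(ℂ, B)) : Prop where
  nondegenerate : Nondegenerate π
  isometry : star V * V = 1
  covariant : ∀ c, (π (β c) : 𝓜(ℂ, B)) = V * (π c : 𝓜(ℂ, B)) * star V

/-- A Stacey-covariant representation of `(C, β)` in some C⋆-algebra. -/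
structure StaceyRep where
  B : Type w
  [cstar : NonUnitalCStarAlgebra B]
  π : C →⋆ₙₐ[ℂ] B
  V : 𝓜(ℂ, B)
  isStacey : IsStaceyCovariant β π V

attribute [instance] StaceyRep.cstar

/-- The C⋆-algebra of bounded families indexed by the Stacey-covariant representations. -/
abbrev StaceyProduct : Type (w + 1) := lp (fun r : StaceyRep β => r.B) ∞

/-- The direct sum of the homomorphisms `π`. -/
def staceyProdA : C →⋆ₙₐ[ℂ] StaceyProduct β where
  toFun a := ⟨fun r => r.π a, memℓp_infty ⟨‖a‖, by
    rintro _ ⟨r, rfl⟩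
    exact NonUnitalStarAlgHom.norm_apply_le r.π a⟩⟩
  map_smul' c a := Subtype.ext <| funext fun r => map_smul r.π c a
  map_zero' := Subtype.ext <| funext fun r => map_zero r.π
  map_add' a b := Subtype.ext <| funext fun r => map_add r.π a b
  map_mul' a b := Subtype.ext <| funext fun r => map_mul r.π a b
  map_star' a := Subtype.ext <| funext fun r => map_star r.π a

lemma norm_V_le (r : StaceyRep β) : ‖r.V‖ ≤ 1 := by
  have h1 : ‖(1 : 𝓜(ℂ, r.B))‖ ≤ 1 := by
    rw [← DoubleCentralizer.norm_fst, DoubleCentralizer.one_fst]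
    exact ContinuousLinearMap.norm_id_le
  have h2 : ‖star r.V * r.V‖ = ‖r.V‖ * ‖r.V‖ := CStarRing.norm_star_mul_self
  rw [r.isStacey.isometry] at h2
  nlinarith [norm_nonneg r.V]

/-- The bounded family `(T_r (x_r))_r` for contractions `T_r`. -/
def prodMap (T : ∀ r : StaceyRep β, r.B →L[ℂ] r.B) (hT : ∀ r, ‖T r‖ ≤ 1) :
    StaceyProduct β →L[ℂ] StaceyProduct β :=
  have h : ∀ (x : StaceyProduct β) (r : StaceyRep β),
      ‖T r ((x : ∀ r : StaceyRep β, r.B) r)‖ ≤ ‖x‖ := fun x r =>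
    ((T r).le_of_opNorm_le (hT r) _).trans <| by
      rw [one_mul]; exact lp.norm_apply_le_norm ENNReal.top_ne_zero x r
  LinearMap.mkContinuous
    { toFun := fun x => ⟨fun r => T r ((x : ∀ r : StaceyRep β, r.B) r), memℓp_infty ⟨‖x‖, by
        rintro _ ⟨r, rfl⟩
        exact h x r⟩⟩
      map_add' := fun x y => Subtype.ext <| funext fun r => map_add (T r) _ _
      map_smul' := fun c x => Subtype.ext <| funext fun r => map_smul (T r) c _ } 1
    fun x => by
      rw [one_mul]
      exact lp.norm_le_of_forall_le (norm_nonneg x) (h x)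

/-- The direct sum of the isometries `V`, as a multiplier. -/
def staceyProdV : 𝓜(ℂ, StaceyProduct β) where
  fst := prodMap β (fun r => r.V.fst) fun r =>
    (DoubleCentralizer.norm_fst _).trans_le (norm_V_le β r)
  snd := prodMap β (fun r => r.V.snd) fun r =>
    (DoubleCentralizer.norm_snd _).trans_le (norm_V_le β r)
  central _ _ := Subtype.ext <| funext fun r => r.V.central _ _

/-- The Stacey crossed product `C ×_β ℕ`: the C⋆-algebra generated by the universal
Stacey-covariant representation `(i_C, v)`, realised as the direct sum of all such representations.
It is the smallest C⋆-algebra that contains `i_C(C)` and has `v` as a multiplier. -/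
def staceyCrossedProduct : NonUnitalStarSubalgebra ℂ (StaceyProduct β) :=
  sInf {D | IsClosed (D : Set (StaceyProduct β)) ∧ (∀ c, staceyProdA β c ∈ D) ∧
    ∀ x ∈ D, (staceyProdV β).fst x ∈ D ∧ (staceyProdV β).snd x ∈ D}

instance : IsClosed (staceyCrossedProduct β : Set (StaceyProduct β)) := by
  rw [staceyCrossedProduct, NonUnitalStarAlgebra.coe_sInf]
  exact isClosed_biInter fun D hD => hD.1

/-- The Stacey crossed product as a type. -/
def StaceyCrossedProduct : Type (w + 1) := staceyCrossedProduct β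

instance : NonUnitalCStarAlgebra (StaceyCrossedProduct β) :=
  inferInstanceAs (NonUnitalCStarAlgebra (staceyCrossedProduct β))

/-- The canonical homomorphism `i_C : C → C ×_β ℕ`. -/
def staceyI : C →⋆ₙₐ[ℂ] StaceyCrossedProduct β :=
  NonUnitalStarAlgHom.codRestrict (staceyProdA β) _ fun c =>
    NonUnitalStarAlgebra.mem_sInf.2 fun _ hD => hD.2.1 c

lemma staceyProdV_mem {x : StaceyProduct β} (hx : x ∈ staceyCrossedProduct β) :
    (staceyProdV β).fst x ∈ staceyCrossedProduct β ∧
      (staceyProdV β).snd x ∈ staceyCrossedProduct β :=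
  ⟨NonUnitalStarAlgebra.mem_sInf.2 fun D hD =>
      (hD.2.2 x (NonUnitalStarAlgebra.mem_sInf.1 hx D hD)).1,
    NonUnitalStarAlgebra.mem_sInf.2 fun D hD =>
      (hD.2.2 x (NonUnitalStarAlgebra.mem_sInf.1 hx D hD)).2⟩

/-- The canonical isometry `v ∈ M(C ×_β ℕ)`. -/
def staceyV : 𝓜(ℂ, StaceyCrossedProduct β) where
  fst := LinearMap.mkContinuous
    { toFun := fun x => ⟨(staceyProdV β).fst x.1, (staceyProdV_mem β x.2).1⟩
      map_add' := fun x y => Subtype.ext <| map_add (staceyProdV β).fst x.1 y.1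
      map_smul' := fun c x => Subtype.ext <| map_smul (staceyProdV β).fst c x.1 }
    ‖(staceyProdV β).fst‖ fun x => (staceyProdV β).fst.le_opNorm x.1
  snd := LinearMap.mkContinuous
    { toFun := fun x => ⟨(staceyProdV β).snd x.1, (staceyProdV_mem β x.2).2⟩
      map_add' := fun x y => Subtype.ext <| map_add (staceyProdV β).snd x.1 y.1
      map_smul' := fun c x => Subtype.ext <| map_smul (staceyProdV β).snd c x.1 }
    ‖(staceyProdV β).snd‖ fun x => (staceyProdV β).snd.le_opNorm x.1
  central x y := Subtype.ext <| (staceyProdV β).central x.1 y.1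

end Stacey

end ExelStacey

end

open ExelStacey

/-!
The isometry `V` is the strict limit of `k_M(q(e))` along an approximate unit of `A`, and
`k_A(a) V = k_M(q(a))`. It is homogeneous of degree one for the gauge action, so both `Ad V` and the
compression `Ad V⋆` preserve the core. This makes `α'` an isomorphism of the core onto its corner by
`V V⋆`. For `c` in the core, a factorization `V V⋆ c = s y` with `s` in that corner gives the strict
continuity of `T ↦ V T V⋆` on the whole multiplier algebra of the core.

Averaging over roots of unity in the gauge group shows that the core is the smallest C⋆-subalgebra
that contains `k_A(A)` and is invariant under `Ad V` and `Ad V⋆`. A Stacey-covariant representation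
`(ρ, W)` of the core gives the representation `m ↦ ρ(k_M(m) V⋆) W` of `M_L`, which is coisometric on
`J` and so integrates to `𝒪(J, M_L)`; by this minimality of the core the integrated form extends `ρ`
and carries `V` to `W`. Thus `𝒪(J, M_L)` has the universal property of the Stacey crossed product.
-/

noncomputable section

namespace ExelStacey

open Filter Topology

section Multipliers

variable {B : Type v} [NonUnitalCStarAlgebra B]

lemma eq_of_forall_mul_left {x y : B} (h : ∀ z, z * x = z * y) : x = y := by
  rw [← sub_eq_zero, ← CStarRing.star_mul_self_eq_zero_iff, mul_sub, h, sub_self]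

lemma eq_of_forall_mul_right {x y : B} (h : ∀ z, x * z = y * z) : x = y := by
  rw [← sub_eq_zero, ← CStarRing.mul_star_self_eq_zero_iff, sub_mul, h, sub_self]

lemma ext_of_fst {V W : 𝓜(ℂ, B)} (h : ∀ x, V.fst x = W.fst x) : V = W :=
  DoubleCentralizer.ext _ _ _ _ <| Prod.ext (ContinuousLinearMap.ext h) <|
    ContinuousLinearMap.ext fun x => eq_of_forall_mul_right fun y => by
      rw [V.central, W.central, h]

lemma ext_of_snd {V W : 𝓜(ℂ, B)} (h : ∀ x, V.snd x = W.snd x) : V = W :=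
  ext_of_fst fun x => eq_of_forall_mul_left fun y => by rw [← V.central, ← W.central, h]

lemma fst_mul (V : 𝓜(ℂ, B)) (x y : B) : V.fst (x * y) = V.fst x * y :=
  eq_of_forall_mul_left fun z => by
    rw [← mul_assoc, ← V.central, ← V.central, mul_assoc]

lemma snd_mul (V : 𝓜(ℂ, B)) (x y : B) : V.snd (x * y) = x * V.snd y :=
  eq_of_forall_mul_right fun z => by rw [mul_assoc, V.central, V.central, mul_assoc]

lemma coe_fst (x y : B) : (x : 𝓜(ℂ, B)).fst y = x * y := rfl

lemma coe_snd (x y : B) : (x : 𝓜(ℂ, B)).snd y = y * x := rfl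

lemma mul_coe_eq (V : 𝓜(ℂ, B)) (x : B) : V * (x : 𝓜(ℂ, B)) = (V.fst x : B) :=
  ext_of_fst fun y => fst_mul V x y

lemma coe_mul_eq (V : 𝓜(ℂ, B)) (x : B) : (x : 𝓜(ℂ, B)) * V = (V.snd x : B) :=
  ext_of_snd fun y => snd_mul V y x

lemma coe_inj {x y : B} : (x : 𝓜(ℂ, B)) = (y : 𝓜(ℂ, B)) ↔ x = y :=
  ⟨fun h => eq_of_forall_mul_right fun z => congrArg (fun V : 𝓜(ℂ, B) => V.fst z) h,
    congrArg _⟩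

lemma norm_coe (x : B) : ‖(x : 𝓜(ℂ, B))‖ = ‖x‖ := by
  rw [← DoubleCentralizer.norm_fst, DoubleCentralizer.coe_fst, ContinuousLinearMap.opNorm_mul_apply]

lemma coe_star (x : B) : ((star x : B) : 𝓜(ℂ, B)) = star (x : 𝓜(ℂ, B)) :=
  map_star (DoubleCentralizer.coeHom (𝕜 := ℂ) (A := B)) x

lemma coe_mul (x y : B) : ((x * y : B) : 𝓜(ℂ, B)) = (x : 𝓜(ℂ, B)) * (y : 𝓜(ℂ, B)) :=
  map_mul (DoubleCentralizer.coeHom (𝕜 := ℂ) (A := B)) x y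

lemma star_fst (V : 𝓜(ℂ, B)) (x : B) : (star V).fst x = star (V.snd (star x)) := rfl

lemma star_snd (V : 𝓜(ℂ, B)) (x : B) : (star V).snd x = star (V.fst (star x)) := rfl

lemma mul_fst (V W : 𝓜(ℂ, B)) (x : B) : (V * W).fst x = V.fst (W.fst x) := rfl

lemma mul_snd (V W : 𝓜(ℂ, B)) (x : B) : (V * W).snd x = W.snd (V.snd x) := rfl

end Multipliers

section ApproximateUnit

variable {B : Type v} [NonUnitalCStarAlgebra B]

variable (B) in
/-- The canonical approximate unit of a C⋆-algebra, taken for its spectral order so that no order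
has to be carried along. -/
def approxUnit : Filter B :=
  letI := CStarAlgebra.spectralOrder B
  haveI := CStarAlgebra.spectralOrderedRing B
  CStarAlgebra.approximateUnit B

instance : (approxUnit B).NeBot := by
  let _ := CStarAlgebra.spectralOrder B
  have := CStarAlgebra.spectralOrderedRing B
  exact (CStarAlgebra.increasingApproximateUnit B).neBot

lemma tendsto_approxUnit_mul (x : B) : Tendsto (fun e => e * x) (approxUnit B) (𝓝 x) := by
  let _ := CStarAlgebra.spectralOrder B
  have := CStarAlgebra.spectralOrderedRing B
  exact (CStarAlgebra.increasingApproximateUnit B).tendsto_mul_right x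

lemma tendsto_mul_approxUnit (x : B) : Tendsto (fun e => x * e) (approxUnit B) (𝓝 x) := by
  let _ := CStarAlgebra.spectralOrder B
  have := CStarAlgebra.spectralOrderedRing B
  exact (CStarAlgebra.increasingApproximateUnit B).tendsto_mul_left x

lemma eventually_norm_approxUnit : ∀ᶠ e in approxUnit B, ‖e‖ ≤ 1 := by
  let _ := CStarAlgebra.spectralOrder B
  have := CStarAlgebra.spectralOrderedRing B
  exact (CStarAlgebra.increasingApproximateUnit B).eventually_norm

lemma eventually_star_approxUnit : ∀ᶠ e in approxUnit B, star e = e := by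
  let _ := CStarAlgebra.spectralOrder B
  have := CStarAlgebra.spectralOrderedRing B
  exact (CStarAlgebra.increasingApproximateUnit B).eventually_star_eq

end ApproximateUnit

section StrictLimits

lemma exists_tendsto_of_approx {ι X : Type*} [PseudoMetricSpace X] [CompleteSpace X] {l : Filter ι}
    [l.NeBot] {f : ι → X}
    (h : ∀ ε > 0, ∃ g : ι → X, (∃ y, Tendsto g l (𝓝 y)) ∧ ∀ᶠ i in l, dist (f i) (g i) < ε) :
    ∃ y, Tendsto f l (𝓝 y) := by
  refine CompleteSpace.complete (f := map f l)
    (Metric.cauchy_iff.2 ⟨inferInstance, fun ε hε => ?_⟩)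
  obtain ⟨g, ⟨y, hy⟩, hfg⟩ := h (ε / 4) (by positivity)
  have near : ∀ᶠ i in l, dist (f i) y < ε / 2 := by
    filter_upwards [hfg, Metric.tendsto_nhds.1 hy (ε / 4) (by positivity)] with i hf hg
    linarith [dist_triangle (f i) (g i) y]
  refine ⟨Metric.ball y (ε / 2), near, fun a ha b hb => ?_⟩
  linarith [dist_triangle_right a b y, Metric.mem_ball.1 ha, Metric.mem_ball.1 hb]

variable {X : Type*} [NormedAddCommGroup X] [NormedSpace ℂ X] {ι : Type*} {l : Filter ι}
  {T : ι → X →L[ℂ] X}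

lemma exists_tendsto_of_mem_span {D : Set X} (h : ∀ x ∈ D, ∃ y, Tendsto (fun i => T i x) l (𝓝 y))
    {x : X} (hx : x ∈ Submodule.span ℂ D) : ∃ y, Tendsto (fun i => T i x) l (𝓝 y) := by
  induction hx using Submodule.span_induction with
  | mem x hx => exact h x hx
  | zero => exact ⟨0, by simpa using tendsto_const_nhds⟩
  | add x y _ _ hx hy =>
    obtain ⟨a, ha⟩ := hx
    obtain ⟨b, hb⟩ := hy
    exact ⟨a + b, by simpa using ha.add hb⟩
  | smul c x _ hx =>
    obtain ⟨a, ha⟩ := hx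
    exact ⟨c • a, by simpa using ha.const_smul c⟩

lemma exists_tendsto_of_dense_span [CompleteSpace X] [l.NeBot] {C : ℝ} (hC : ∀ᶠ i in l, ‖T i‖ ≤ C)
    {D : Set X} (hD : Dense (Submodule.span ℂ D : Set X))
    (h : ∀ x ∈ D, ∃ y, Tendsto (fun i => T i x) l (𝓝 y)) (x : X) :
    ∃ y, Tendsto (fun i => T i x) l (𝓝 y) := by
  have hC_pos : 0 < C + 1 := by
    obtain ⟨i, hi⟩ := hC.exists
    linarith [norm_nonneg (T i)]
  refine exists_tendsto_of_approx fun ε hε => ?_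
  obtain ⟨x', hxx', hx'⟩ := Metric.dense_iff.1 hD x (ε / (C + 1)) (by positivity)
  refine ⟨fun i => T i x', exists_tendsto_of_mem_span h hx', hC.mono fun i hi => ?_⟩
  rw [dist_eq_norm, ← map_sub]
  calc ‖T i (x - x')‖ ≤ (C + 1) * ‖x - x'‖ := (T i).le_of_opNorm_le (by linarith) _
    _ < (C + 1) * (ε / (C + 1)) := by
      gcongr
      rwa [← dist_eq_norm, dist_comm]
    _ = ε := by field_simp

lemma exists_clm_of_tendsto [CompleteSpace X] [l.NeBot] {C : ℝ} (hC : ∀ᶠ i in l, ‖T i‖ ≤ C)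
    {D : Set X} (hD : Dense (Submodule.span ℂ D : Set X))
    (h : ∀ x ∈ D, ∃ y, Tendsto (fun i => T i x) l (𝓝 y)) :
    ∃ S : X →L[ℂ] X, ∀ x, Tendsto (fun i => T i x) l (𝓝 (S x)) := by
  choose S hS using exists_tendsto_of_dense_span hC hD h
  refine ⟨LinearMap.mkContinuous
    { toFun := S
      map_add' := fun x y => tendsto_nhds_unique (hS (x + y)) (by simpa using (hS x).add (hS y))
      map_smul' := fun c x => tendsto_nhds_unique (hS (c • x))
        (by simpa using (hS x).const_smul c) } C fun x => ?_, hS⟩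
  exact le_of_tendsto (hS x).norm (hC.mono fun i hi => (T i).le_of_opNorm_le hi x)

lemma exists_multiplier_of_tendsto {B : Type v} [NonUnitalCStarAlgebra B] [l.NeBot] {f : ι → B}
    {C : ℝ} (hC : ∀ᶠ i in l, ‖f i‖ ≤ C) {D D' : Set B}
    (hD : Dense (Submodule.span ℂ D : Set B)) (hD' : Dense (Submodule.span ℂ D' : Set B))
    (hleft : ∀ x ∈ D, ∃ y, Tendsto (fun i => f i * x) l (𝓝 y))
    (hright : ∀ x ∈ D', ∃ y, Tendsto (fun i => x * f i) l (𝓝 y)) :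
    ∃ V : 𝓜(ℂ, B), (∀ x, Tendsto (fun i => f i * x) l (𝓝 (V.fst x))) ∧
      ∀ x, Tendsto (fun i => x * f i) l (𝓝 (V.snd x)) := by
  obtain ⟨S, hS⟩ := exists_clm_of_tendsto (T := fun i => ContinuousLinearMap.mul ℂ B (f i))
    (hC.mono fun i hi => (ContinuousLinearMap.opNorm_mul_apply_le ℂ B (f i)).trans hi) hD hleft
  obtain ⟨S', hS'⟩ := exists_clm_of_tendsto
    (T := fun i => (ContinuousLinearMap.mul ℂ B).flip (f i))
    (hC.mono fun i hi =>
      ContinuousLinearMap.opNorm_le_bound _ ((norm_nonneg _).trans hi) fun x => by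
        rw [mul_comm C]
        exact (norm_mul_le x (f i)).trans (by gcongr)) hD' hright
  refine ⟨⟨(S, S'), fun x y => ?_⟩, hS, hS'⟩
  refine tendsto_nhds_unique ((hS' x).mul_const y) ?_
  simpa [mul_assoc] using (hS y).const_mul x

end StrictLimits

section NondegenerateHoms

variable {C : Type u} {B : Type v} [NonUnitalCStarAlgebra C] [NonUnitalCStarAlgebra B]
  {π : C →⋆ₙₐ[ℂ] B}

lemma continuous_hom (π : C →⋆ₙₐ[ℂ] B) : Continuous π :=
  AddMonoidHomClass.continuous_of_bound π 1 fun a => by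
    rw [one_mul]; exact NonUnitalStarAlgHom.norm_apply_le π a

lemma eventually_norm_map_approxUnit (π : C →⋆ₙₐ[ℂ] B) : ∀ᶠ e in approxUnit C, ‖π e‖ ≤ 1 :=
  eventually_norm_approxUnit.mono fun e he => (NonUnitalStarAlgHom.norm_apply_le π e).trans he

lemma tendsto_map_approxUnit_mul (π : C →⋆ₙₐ[ℂ] B) (c : C) (x : B) :
    Tendsto (fun e => π e * (π c * x)) (approxUnit C) (𝓝 (π c * x)) := by
  simpa [mul_assoc] using
    (((continuous_hom π).tendsto _).comp (tendsto_approxUnit_mul c)).mul_const x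

namespace Nondegenerate

lemma tendsto_mul (hπ : Nondegenerate π) (x : B) :
    Tendsto (fun e => π e * x) (approxUnit C) (𝓝 x) := by
  obtain ⟨S, hS⟩ := exists_clm_of_tendsto (l := approxUnit C)
    (T := fun e => ContinuousLinearMap.mul ℂ B (π e))
    ((eventually_norm_map_approxUnit π).mono fun i hi =>
      (ContinuousLinearMap.opNorm_mul_apply_le ℂ B (π i)).trans hi) hπ
    (by rintro _ ⟨p, rfl⟩; exact ⟨_, tendsto_map_approxUnit_mul π p.1 p.2⟩)
  have hS_id : S = ContinuousLinearMap.id ℂ B := ContinuousLinearMap.ext_on hπ <| by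
    rintro _ ⟨p, rfl⟩
    exact tendsto_nhds_unique (hS _) (tendsto_map_approxUnit_mul π p.1 p.2)
  simpa [hS_id] using hS x

lemma tendsto_mul_right (hπ : Nondegenerate π) (x : B) :
    Tendsto (fun e => x * π e) (approxUnit C) (𝓝 x) := by
  have h := (hπ.tendsto_mul (star x)).star
  rw [star_star] at h
  refine h.congr' (eventually_star_approxUnit.mono fun e he => ?_)
  rw [star_mul, star_star, ← map_star, he]

lemma of_tendsto (h : ∀ x : B, Tendsto (fun e => π e * x) (approxUnit C) (𝓝 x)) :
    Nondegenerate π := fun x =>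
  mem_closure_of_tendsto (h x)
    (Eventually.of_forall fun e => Submodule.subset_span ⟨(e, x), rfl⟩)

lemma dense_right (hπ : Nondegenerate π) :
    Dense (Submodule.span ℂ (Set.range fun p : B × C => p.1 * π p.2) : Set B) := fun x =>
  mem_closure_of_tendsto (hπ.tendsto_mul_right x)
    (Eventually.of_forall fun e => Submodule.subset_span ⟨(x, e), rfl⟩)

lemma eq_of_left (hπ : Nondegenerate π) {X : Type*} [TopologicalSpace X] [T2Space X] {f g : B → X}
    (hf : Continuous f) (hg : Continuous g) (h : ∀ c y, f (π c * y) = g (π c * y)) (x : B) :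
    f x = g x :=
  tendsto_nhds_unique ((hf.tendsto x).comp (hπ.tendsto_mul x))
    (((hg.tendsto x).comp (hπ.tendsto_mul x)).congr fun e => (h e x).symm)

lemma ext_fst (hπ : Nondegenerate π) {V W : 𝓜(ℂ, B)} (h : ∀ c, V.fst (π c) = W.fst (π c)) :
    V = W :=
  ext_of_fst <| hπ.eq_of_left V.fst.continuous W.fst.continuous fun c y => by
    rw [fst_mul, fst_mul, h]

lemma ext_snd (hπ : Nondegenerate π) {V W : 𝓜(ℂ, B)} (h : ∀ c, V.snd (π c) = W.snd (π c)) :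
    V = W :=
  star_injective <| hπ.ext_fst fun c => by
    rw [star_fst, star_fst, ← map_star π, h]

lemma eq_of_forall_mul (hπ : Nondegenerate π) {x y : B} (h : ∀ c, π c * x = π c * y) : x = y :=
  coe_inj.1 <| hπ.ext_snd fun c => by rw [coe_snd, coe_snd, h]

lemma of_comp {D : Type w} [NonUnitalCStarAlgebra D] {ρ : D →⋆ₙₐ[ℂ] C}
    (h : Nondegenerate (π.comp ρ)) : Nondegenerate π :=
  Dense.mono (Submodule.span_mono <| by rintro _ ⟨⟨d, x⟩, rfl⟩; exact ⟨(ρ d, x), rfl⟩) h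

lemma of_injective_comp {D : Type w} [NonUnitalCStarAlgebra D] {ρ : D →⋆ₙₐ[ℂ] C}
    (hπ : Function.Injective π) (h : Nondegenerate (π.comp ρ)) : Nondegenerate ρ :=
  .of_tendsto fun c => (NonUnitalStarAlgHom.isometry π hπ).isEmbedding.tendsto_nhds_iff.2 <| by
    simpa only [Function.comp_def, NonUnitalStarAlgHom.comp_apply, map_mul] using
      h.tendsto_mul (π c)

lemma comp {D : Type w} [NonUnitalCStarAlgebra D] {ρ : D →⋆ₙₐ[ℂ] C}
    (hπ : Nondegenerate π) (hρ : Nondegenerate ρ) : Nondegenerate (π.comp ρ) := by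
  have mem_closure (c : C) (x : B) : π c * x ∈ (Submodule.span ℂ
      (Set.range fun p : D × B => π.comp ρ p.1 * p.2)).topologicalClosure :=
    mem_closure_of_tendsto
      ((((continuous_hom π).tendsto _).comp (hρ.tendsto_mul c)).mul_const x)
      (Eventually.of_forall fun e => Submodule.subset_span ⟨(e, π c * x), by
        simp only [NonUnitalStarAlgHom.comp_apply, Function.comp_apply, map_mul, mul_assoc]⟩)
  exact fun x => (Submodule.isClosed_topologicalClosure _).mem_of_tendsto (hπ.tendsto_mul x)
    (Eventually.of_forall fun e => mem_closure e x)

end Nondegenerate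

end NondegenerateHoms

section Intertwines

variable {C : Type u} {B : Type v} [NonUnitalCStarAlgebra C] [NonUnitalCStarAlgebra B]

/-- The multiplier `R` of `B` restricts along `π : C → B` to the multiplier `T` of `C`. For
nondegenerate `π` this says that `R` is the image of `T` under the extension `M(C) → M(B)` of `π`,
but the relation also makes sense for degenerate `π`. -/
structure Intertwines (π : C →⋆ₙₐ[ℂ] B) (T : 𝓜(ℂ, C)) (R : 𝓜(ℂ, B)) : Prop where
  fst : ∀ c, R.fst (π c) = π (T.fst c)
  snd : ∀ c, R.snd (π c) = π (T.snd c)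

namespace Intertwines

variable {π : C →⋆ₙₐ[ℂ] B} {T T' : 𝓜(ℂ, C)} {R R' : 𝓜(ℂ, B)}

lemma one : Intertwines π 1 1 := ⟨fun _ => rfl, fun _ => rfl⟩

lemma coe (c : C) : Intertwines π (c : 𝓜(ℂ, C)) (π c : B) :=
  ⟨fun d => (map_mul π c d).symm, fun d => (map_mul π d c).symm⟩

lemma mul (h : Intertwines π T R) (h' : Intertwines π T' R') :
    Intertwines π (T * T') (R * R') :=
  ⟨fun c => by rw [mul_fst, h'.fst, h.fst]; rfl, fun c => by rw [mul_snd, h.snd, h'.snd]; rfl⟩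

lemma add (h : Intertwines π T R) (h' : Intertwines π T' R') :
    Intertwines π (T + T') (R + R') :=
  ⟨fun c => by
      change R.fst (π c) + R'.fst (π c) = π (T.fst c + T'.fst c)
      rw [h.fst, h'.fst, map_add],
    fun c => by
      change R.snd (π c) + R'.snd (π c) = π (T.snd c + T'.snd c)
      rw [h.snd, h'.snd, map_add]⟩

lemma zero : Intertwines π 0 0 := ⟨fun _ => (map_zero π).symm, fun _ => (map_zero π).symm⟩

lemma smul (z : ℂ) (h : Intertwines π T R) : Intertwines π (z • T) (z • R) :=
  ⟨fun c => by
      change z • R.fst (π c) = π (z • T.fst c)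
      rw [h.fst, map_smul],
    fun c => by
      change z • R.snd (π c) = π (z • T.snd c)
      rw [h.snd, map_smul]⟩

lemma star (h : Intertwines π T R) : Intertwines π (star T) (star R) :=
  ⟨fun c => by rw [star_fst, star_fst, ← map_star π, h.snd, map_star π],
    fun c => by rw [star_snd, star_snd, ← map_star π, h.fst, map_star π]⟩

lemma left_unique (hπ : Function.Injective π) (h : Intertwines π T R) (h' : Intertwines π T' R) :
    T = T' :=
  ext_of_fst fun c => hπ <| by rw [← h.fst, h'.fst]

lemma right_unique (hπ : Nondegenerate π) (h : Intertwines π T R) (h' : Intertwines π T R') :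
    R = R' :=
  hπ.ext_fst fun c => by rw [h.fst, h'.fst]

lemma of_fst (hπ : Nondegenerate π) (h : ∀ c, R.fst (π c) = π (T.fst c)) : Intertwines π T R :=
  ⟨h, fun c => coe_inj.1 <| hπ.ext_fst fun d => by
    rw [coe_fst, coe_fst, R.central, h, ← map_mul, ← map_mul, T.central]⟩

lemma map_mul_mul (h : Intertwines π T R) (h' : Intertwines π T' R') {c d : C}
    (hd : (d : 𝓜(ℂ, C)) = T * (c : 𝓜(ℂ, C)) * T') :
    (π d : 𝓜(ℂ, B)) = R * (π c : 𝓜(ℂ, B)) * R' := by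
  rw [mul_coe_eq, coe_mul_eq, coe_inj] at hd
  rw [hd, mul_coe_eq, coe_mul_eq, h.fst, h'.snd]

end Intertwines

lemma Nondegenerate.exists_intertwines {π : C →⋆ₙₐ[ℂ] B} (hπ : Nondegenerate π) (T : 𝓜(ℂ, C)) :
    ∃ R : 𝓜(ℂ, B), Intertwines π T R := by
  have tendsto_fst : ∀ c, Tendsto (fun e => π (T.fst e) * π c) (approxUnit C)
      (𝓝 (π (T.fst c))) := fun c => by
    simpa [Function.comp_def, fst_mul] using
      (((continuous_hom π).comp T.fst.continuous).tendsto _).comp (tendsto_approxUnit_mul c)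
  have tendsto_snd : ∀ c, Tendsto (fun e => π c * π (T.fst e)) (approxUnit C)
      (𝓝 (π (T.snd c))) := fun c =>
    (((continuous_hom π).tendsto _).comp (tendsto_mul_approxUnit (T.snd c))).congr fun e => by
      rw [Function.comp_apply, T.central, map_mul]
  obtain ⟨R, hR, -⟩ := exists_multiplier_of_tendsto (l := approxUnit C)
    (f := fun e => π (T.fst e)) (C := ‖T.fst‖)
    (eventually_norm_approxUnit.mono fun e he =>
      (NonUnitalStarAlgHom.norm_apply_le π _).trans <| (T.fst.le_opNorm e).trans <|
        mul_le_of_le_one_right (norm_nonneg _) he) hπ hπ.dense_right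
    (by
      rintro _ ⟨p, rfl⟩
      exact ⟨_, by simpa [mul_assoc] using (tendsto_fst p.1).mul_const p.2⟩)
    (by
      rintro _ ⟨p, rfl⟩
      exact ⟨_, by simpa [mul_assoc] using (tendsto_snd p.2).const_mul p.1⟩)
  exact ⟨R, .of_fst hπ fun c => tendsto_nhds_unique (hR _) (tendsto_fst c)⟩

lemma exists_intertwines_of_mem_range {π : C →⋆ₙₐ[ℂ] B} (hπ : Function.Injective π) {R : 𝓜(ℂ, B)}
    (hfst : ∀ c, ∃ d, π d = R.fst (π c)) (hsnd : ∀ c, ∃ d, π d = R.snd (π c)) :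
    ∃ T, Intertwines π T R := by
  have norm_map : ∀ c, ‖π c‖ = ‖c‖ := fun c => NonUnitalStarAlgHom.norm_map π hπ c
  have lift (F : B →L[ℂ] B) (hF : ∀ c, ∃ d, π d = F (π c)) :
      ∃ G : C →L[ℂ] C, ∀ c, π (G c) = F (π c) := by
    choose g hg using hF
    refine ⟨LinearMap.mkContinuous
      { toFun := g
        map_add' := fun c d => hπ <| by simp only [hg, map_add]
        map_smul' := fun z c => hπ <| by simp only [hg, map_smul, RingHom.id_apply] } ‖F‖
      fun c => ?_, hg⟩
    rw [← norm_map, ← norm_map c]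
    exact (congrArg norm (hg c)).trans_le (F.le_opNorm _)
  obtain ⟨G, hG⟩ := lift R.fst hfst
  obtain ⟨G', hG'⟩ := lift R.snd hsnd
  refine ⟨⟨(G, G'), fun c d => hπ ?_⟩, fun c => (hG c).symm, fun c => (hG' c).symm⟩
  rw [map_mul, map_mul, hG, hG', R.central]

end Intertwines

section Factorization

variable {B : Type v} [NonUnitalCStarAlgebra B]

lemma abs_mul_div_sub_le {t δ : ℝ} (ht : 0 ≤ t) (hδ : 0 < δ) :
    |t ^ 3 / (t ^ 4 + δ ^ 4) * (t * t) - t| ≤ δ := by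
  have hden : 0 < t ^ 4 + δ ^ 4 := by positivity
  have hdiff : t ^ 3 / (t ^ 4 + δ ^ 4) * (t * t) - t = -(t * δ ^ 4 / (t ^ 4 + δ ^ 4)) := by
    field_simp
    ring
  rw [hdiff, abs_neg, abs_of_nonneg (by positivity), div_le_iff₀ hden]
  rcases le_total t δ with h | h
  · nlinarith [mul_le_mul_of_nonneg_right h (pow_nonneg hδ.le 4),
      mul_nonneg hδ.le (pow_nonneg ht 4)]
  · have hcube : δ ^ 3 ≤ t ^ 3 := by gcongr
    nlinarith [mul_le_mul_of_nonneg_left hcube (mul_nonneg ht hδ.le),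
      mul_nonneg hδ.le (pow_nonneg hδ.le 4)]

lemma exists_norm_mul_mul_self_sub_le [PartialOrder B] [StarOrderedRing B] {s : B} (hs : 0 ≤ s)
    {δ : ℝ} (hδ : 0 < δ) : ∃ g : B, ‖g * (s * s) - s‖ ≤ δ := by
  have hsa : IsSelfAdjoint s := .of_nonneg hs
  let g : ℝ → ℝ := fun t => t ^ 3 / (t ^ 4 + δ ^ 4)
  have hg : ContinuousOn g (quasispectrum ℝ s) :=
    (Continuous.div (by fun_prop) (by fun_prop) fun t => by positivity).continuousOn
  have hg_zero : g 0 = 0 := by simp [g]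
  have hss : s * s = cfcₙ (fun t : ℝ => t * t) s := by
    rw [cfcₙ_mul (fun t : ℝ => t) (fun t : ℝ => t) s, cfcₙ_id' ℝ s]
  refine ⟨cfcₙ g s, ?_⟩
  rw [hss, ← cfcₙ_mul g (fun t : ℝ => t * t) s hg hg_zero]
  conv_lhs => enter [1, 2]; rw [← cfcₙ_id' ℝ s]
  rw [← cfcₙ_sub (fun t => g t * (t * t)) (fun t => t) s (by fun_prop) (by simp)]
  exact norm_cfcₙ_le fun t ht => abs_mul_div_sub_le (quasispectrum_nonneg_of_nonneg s hs t ht) hδ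

lemma norm_mul_sub_smul_eq {s d : B} (hs : star s = s) (hsd : s * s * (s * s) = d * star d)
    (a : B) (c : ℂ) : ‖a * d - c • d‖ = ‖a * (s * s) - c • (s * s)‖ := by
  have hsd_assoc : s * (s * (s * s)) = d * star d := by rw [← hsd]; simp only [mul_assoc]
  have hsd_mul : ∀ y, s * (s * (s * (s * y))) = d * (star d * y) := fun y => by
    rw [← mul_assoc d, ← hsd]; simp only [mul_assoc]
  have hsq : (a * d - c • d) * star (a * d - c • d)
      = (a * (s * s) - c • (s * s)) * star (a * (s * s) - c • (s * s)) := by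
    simp only [star_sub, star_mul, star_smul, sub_mul, mul_sub, smul_mul_assoc, mul_smul_comm,
      mul_assoc, hs, hsd_assoc, hsd_mul]
  refine (mul_self_inj (norm_nonneg _) (norm_nonneg _)).1 ?_
  rw [← CStarRing.norm_self_mul_star, ← CStarRing.norm_self_mul_star, hsq]

/- The second factor is the limit of `gₙ d`, where `gₙ s² → s`; the identity
`‖a d - c d‖ = ‖a s² - c s²‖` transports the convergence. -/
lemma exists_eq_mul_of_mul_pow_four {s d : B} {g : ℕ → B} (hs : star s = s)
    (hsd : s * s * (s * s) = d * star d)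
    (hg : Tendsto (fun n => g n * (s * s)) atTop (𝓝 s)) : ∃ y, d = s * y := by
  have hcauchy : CauchySeq fun n => g n * d := by
    refine Metric.cauchySeq_iff.2 fun ε hε => ?_
    obtain ⟨N, hN⟩ := Metric.cauchySeq_iff.1 hg.cauchySeq ε hε
    refine ⟨N, fun m hm n hn => ?_⟩
    have hnorm := norm_mul_sub_smul_eq hs hsd (g m - g n) 0
    rw [zero_smul, zero_smul, sub_zero, sub_zero, sub_mul, sub_mul] at hnorm
    rw [dist_eq_norm, hnorm, ← dist_eq_norm]
    exact hN m hm n hn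
  obtain ⟨y, hy⟩ := cauchySeq_tendsto_of_complete hcauchy
  refine ⟨y, tendsto_nhds_unique ?_ (hy.const_mul s)⟩
  refine tendsto_iff_norm_sub_tendsto_zero.2
    ((tendsto_iff_norm_sub_tendsto_zero.1 (hg.const_mul s)).congr fun n => ?_)
  have hnorm := norm_mul_sub_smul_eq hs hsd (s * g n) 1
  rw [one_smul, one_smul] at hnorm
  rw [← mul_assoc, ← mul_assoc s (g n) d, hnorm]

lemma exists_eq_selfAdjoint_mul (d : B) :
    ∃ s y : B, star s = s ∧ s * s * (s * s) = d * star d ∧ d = s * y := by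
  let _ := CStarAlgebra.spectralOrder B
  have := CStarAlgebra.spectralOrderedRing B
  set s := CFC.sqrt (CFC.sqrt (d * star d))
  have hs : 0 ≤ s := CFC.sqrt_nonneg _
  have hs_star : star s = s := (IsSelfAdjoint.of_nonneg hs).star_eq
  have hsd : s * s * (s * s) = d * star d := by
    rw [CFC.sqrt_mul_sqrt_self _ (CFC.sqrt_nonneg _),
      CFC.sqrt_mul_sqrt_self _ (mul_star_self_nonneg d)]
  choose g hg using fun n : ℕ =>
    exists_norm_mul_mul_self_sub_le hs (Nat.one_div_pos_of_nat (α := ℝ) (n := n))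
  have hg_tendsto : Tendsto (fun n => g n * (s * s)) atTop (𝓝 s) :=
    tendsto_iff_norm_sub_tendsto_zero.2 <|
      squeeze_zero (fun _ => norm_nonneg _) hg tendsto_one_div_add_atTop_nhds_zero_nat
  obtain ⟨y, hy⟩ := exists_eq_mul_of_mul_pow_four hs_star hsd hg_tendsto
  exact ⟨s, y, hs_star, hsd, hy⟩

end Factorization

section Corners

variable {C : Type u} {B : Type v} [NonUnitalCStarAlgebra C] [NonUnitalCStarAlgebra B]

lemma isometry_cancel {M : Type*} [Monoid M] [Star M] {V : M} (hV : star V * V = 1) (T : M) :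
    star V * (V * T) = T := by
  rw [← mul_assoc, hV, one_mul]

lemma mul_eq_zero_of_mul_pow_four {M : Type*} [CStarAlgebra M] {x s : M} (hs : star s = s)
    (h : x * (s * s * (s * s)) = 0) : x * s = 0 := by
  have hsq : x * (s * s) = 0 := by
    rw [← CStarRing.mul_star_self_eq_zero_iff]
    calc x * (s * s) * star (x * (s * s)) = x * (s * s * (s * s)) * star x := by
          simp only [star_mul, hs, mul_assoc]
      _ = 0 := by rw [h, zero_mul]
  rw [← CStarRing.mul_star_self_eq_zero_iff]
  calc x * s * star (x * s) = x * (s * s) * star x := by simp only [star_mul, hs, mul_assoc]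
    _ = 0 := by rw [hsq, zero_mul]

/-- `C` is embedded in `B` by `ι` in such a way that both `Ad V` and the compression `Ad V⋆` by
the isometry `V ∈ M(B)` map the image of `C` into itself. -/
structure IsCornerStable (ι : C →⋆ₙₐ[ℂ] B) (V : 𝓜(ℂ, B)) : Prop where
  injective : Function.Injective ι
  nondegenerate : Nondegenerate ι
  isometry : star V * V = 1
  conj_mem : ∀ c, ∃ d, (ι d : 𝓜(ℂ, B)) = V * (ι c : 𝓜(ℂ, B)) * star V
  compress_mem : ∀ c, ∃ d, (ι d : 𝓜(ℂ, B)) = star V * (ι c : 𝓜(ℂ, B)) * V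

namespace IsCornerStable

variable {ι : C →⋆ₙₐ[ℂ] B} {V : 𝓜(ℂ, B)} (h : IsCornerStable ι V)
include h

lemma ext {c d : C} (hcd : (ι c : 𝓜(ℂ, B)) = ι d) : c = d := h.injective (coe_inj.1 hcd)

lemma exists_endomorphism : ∃ α : C →⋆ₙₐ[ℂ] C,
    ∀ c, (ι (α c) : 𝓜(ℂ, B)) = V * (ι c : 𝓜(ℂ, B)) * star V := by
  set θ := (DoubleCentralizer.coeHom (𝕜 := ℂ) (A := B)).comp ι
  have hθ_inj : Function.Injective θ := fun c d hcd => h.ext hcd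
  obtain ⟨f, hf⟩ : ∃ f : C → C, ∀ c, θ (f c) = V * θ c * star V :=
    Classical.axiom_of_choice h.conj_mem
  exact ⟨{
    toFun := f
    map_smul' z c := hθ_inj <| by
      simp only [hf, map_smul, mul_smul_comm, smul_mul_assoc, MonoidHom.id_apply]
    map_zero' := hθ_inj <| by simp only [hf, map_zero, mul_zero, zero_mul]
    map_add' c d := hθ_inj <| by simp only [hf, map_add, mul_add, add_mul]
    map_mul' c d := hθ_inj <| by simp only [hf, map_mul, mul_assoc, isometry_cancel h.isometry]
    map_star' c := hθ_inj <| by simp only [hf, map_star, star_mul, star_star, mul_assoc] }, hf⟩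

omit h in
/-- The endomorphism `Ad V` of `C`. -/
def endomorphism (h : IsCornerStable ι V) : C →⋆ₙₐ[ℂ] C := h.exists_endomorphism.choose

lemma coe_endomorphism (c : C) :
    (ι (h.endomorphism c) : 𝓜(ℂ, B)) = V * (ι c : 𝓜(ℂ, B)) * star V :=
  h.exists_endomorphism.choose_spec c

lemma isStaceyCovariant : IsStaceyCovariant h.endomorphism ι V where
  nondegenerate := h.nondegenerate
  isometry := h.isometry
  covariant := h.coe_endomorphism

lemma endomorphism_injective : Function.Injective h.endomorphism := fun c d hcd => h.ext <| by
  have hconj : V * (ι c : 𝓜(ℂ, B)) * star V = V * (ι d : 𝓜(ℂ, B)) * star V := by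
    rw [← h.coe_endomorphism, hcd, h.coe_endomorphism]
  have hcancel := congrArg (fun T => star V * T * V) hconj
  simpa only [mul_assoc, isometry_cancel h.isometry, h.isometry, mul_one] using hcancel

lemma exists_coe_eq_proj_mul (c : C) :
    ∃ d, (ι d : 𝓜(ℂ, B)) = V * star V * (ι c : 𝓜(ℂ, B)) := by
  have hclosed : IsClosed (Set.range ι) :=
    (NonUnitalStarAlgHom.isometry ι h.injective).isClosedEmbedding.isClosed_range
  have hlim : Tendsto (fun e => ι (h.endomorphism e * c)) (approxUnit C)
      (𝓝 (V.fst ((star V).fst (ι c)))) := by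
    refine ((V.fst.continuous.tendsto _).comp
      (h.nondegenerate.tendsto_mul ((star V).fst (ι c)))).congr fun e => coe_inj.1 ?_
    rw [Function.comp_apply, ← mul_coe_eq, coe_mul, ← mul_coe_eq, map_mul, coe_mul,
      h.coe_endomorphism]
    simp only [mul_assoc]
  obtain ⟨d, hd⟩ := hclosed.mem_of_tendsto hlim (Eventually.of_forall fun e => ⟨_, rfl⟩)
  exact ⟨d, by rw [hd, ← mul_coe_eq, ← mul_coe_eq, mul_assoc]⟩

lemma exists_eq_endomorphism {s : C} (hs : V * star V * (ι s : 𝓜(ℂ, B)) * (V * star V) = ι s) :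
    ∃ e, s = h.endomorphism e := by
  obtain ⟨e, he⟩ := h.compress_mem s
  refine ⟨e, h.ext ?_⟩
  rw [h.coe_endomorphism, he, ← hs]
  simp only [mul_assoc, isometry_cancel h.isometry]

lemma exists_factor_proj_mul (c : C) : ∃ e y,
    (ι (h.endomorphism e * y) : 𝓜(ℂ, B)) = V * star V * (ι c : 𝓜(ℂ, B)) := by
  obtain ⟨d, hd⟩ := h.exists_coe_eq_proj_mul c
  obtain ⟨s, y, hs, hsd, rfl⟩ := exists_eq_selfAdjoint_mul d
  set θ := (DoubleCentralizer.coeHom (𝕜 := ℂ) (A := B)).comp ι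
  have hθs : star (θ s) = θ s := by rw [← map_star, hs]
  have hproj_d : V * star V * θ (s * y) = θ (s * y) := by
    change V * star V * (ι (s * y) : 𝓜(ℂ, B)) = ι (s * y)
    rw [hd]
    simp only [mul_assoc, isometry_cancel h.isometry]
  have hproj_s : V * star V * θ s = θ s := by
    have hzero : (1 - V * star V) * θ s = 0 := mul_eq_zero_of_mul_pow_four hθs <| by
      rw [← map_mul, ← map_mul, hsd, map_mul, ← mul_assoc, sub_mul, hproj_d, one_mul, sub_self,
        zero_mul]
    rw [sub_mul, one_mul, sub_eq_zero] at hzero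
    exact hzero.symm
  have hs_proj : θ s * (V * star V) = θ s := by
    simpa only [star_mul, star_star, hθs] using congrArg star hproj_s
  obtain ⟨e, rfl⟩ := h.exists_eq_endomorphism (s := s) <| by
    change V * star V * θ s * (V * star V) = θ s
    rw [hproj_s, hs_proj]
  exact ⟨e, y, hd⟩

/- This factorization makes `T ↦ V T V⋆` strictly continuous on all of `M(C)`, not merely on
bounded sets. -/
lemma exists_conj_fst_eq (c : C) : ∃ e y, ∀ T R, Intertwines ι T R →
    (V * R * star V).fst (ι c) = ι (h.endomorphism (T.fst e) * y) := by
  obtain ⟨e, y, hey⟩ := h.exists_factor_proj_mul c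
  refine ⟨e, y, fun T R hTR => coe_inj.1 ?_⟩
  calc (((V * R * star V).fst (ι c) : B) : 𝓜(ℂ, B))
      = V * R * star V * (V * star V * (ι c : 𝓜(ℂ, B))) := by
        rw [← mul_coe_eq]
        simp only [mul_assoc, isometry_cancel h.isometry]
    _ = V * (R * (ι e : 𝓜(ℂ, B))) * star V * (ι y : 𝓜(ℂ, B)) := by
        rw [← hey, map_mul, coe_mul, h.coe_endomorphism]
        simp only [mul_assoc, isometry_cancel h.isometry]
    _ = (ι (h.endomorphism (T.fst e) * y) : B) := by
        rw [mul_coe_eq R, hTR.fst, map_mul, coe_mul, h.coe_endomorphism]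

lemma exists_intertwines_conj (T : 𝓜(ℂ, C)) :
    ∃ T' : 𝓜(ℂ, C), ∀ R, Intertwines ι T R → Intertwines ι T' (V * R * star V) := by
  obtain ⟨R, hR⟩ := h.nondegenerate.exists_intertwines T
  have hfst {T R} (hTR : Intertwines ι T R) (c : C) : ∃ d, ι d = (V * R * star V).fst (ι c) := by
    obtain ⟨e, y, hey⟩ := h.exists_conj_fst_eq c
    exact ⟨_, (hey T R hTR).symm⟩
  have hsnd (c : C) : ∃ d, ι d = (V * R * star V).snd (ι c) := by
    obtain ⟨d, hd⟩ := hfst hR.star (star c)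
    refine ⟨star d, ?_⟩
    rw [map_star, hd, map_star, ← star_snd]
    simp only [star_mul, star_star, mul_assoc]
  obtain ⟨T', hT'⟩ := exists_intertwines_of_mem_range h.injective (hfst hR) hsnd
  refine ⟨T', fun R' hR' => ?_⟩
  rwa [hR'.right_unique h.nondegenerate hR]

lemma exists_endomorphismBar : ∃ αbar : 𝓜(ℂ, C) →⋆ₙₐ[ℂ] 𝓜(ℂ, C),
    ∀ T R, Intertwines ι T R → Intertwines ι (αbar T) (V * R * star V) := by
  choose f hf using h.exists_intertwines_conj
  choose g hg using h.nondegenerate.exists_intertwines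
  refine ⟨{
    toFun := f
    map_smul' z T := (hf _ _ ((hg T).smul z)).left_unique h.injective <| by
      simpa only [mul_smul_comm, smul_mul_assoc, MonoidHom.id_apply] using (hf T _ (hg T)).smul z
    map_zero' := (hf 0 0 .zero).left_unique h.injective <| by
      simpa only [mul_zero, zero_mul] using Intertwines.zero
    map_add' T T' := (hf _ _ ((hg T).add (hg T'))).left_unique h.injective <| by
      simpa only [mul_add, add_mul] using (hf T _ (hg T)).add (hf T' _ (hg T'))
    map_mul' T T' := (hf _ _ ((hg T).mul (hg T'))).left_unique h.injective <| by
      simpa only [mul_assoc, isometry_cancel h.isometry] using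
        (hf T _ (hg T)).mul (hf T' _ (hg T'))
    map_star' T := (hf _ _ (hg T).star).left_unique h.injective <| by
      simpa only [star_mul, star_star, mul_assoc] using (hf T _ (hg T)).star }, hf⟩

omit h in
/-- The extension `T ↦ V T V⋆` of `IsCornerStable.endomorphism` to the multiplier algebra. -/
def endomorphismBar (h : IsCornerStable ι V) : 𝓜(ℂ, C) →⋆ₙₐ[ℂ] 𝓜(ℂ, C) :=
  h.exists_endomorphismBar.choose

lemma intertwines_endomorphismBar {T : 𝓜(ℂ, C)} {R : 𝓜(ℂ, B)} (hTR : Intertwines ι T R) :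
    Intertwines ι (h.endomorphismBar T) (V * R * star V) :=
  h.exists_endomorphismBar.choose_spec T R hTR

lemma intertwines_endomorphismBar_one : Intertwines ι (h.endomorphismBar 1) (V * star V) := by
  simpa only [mul_one] using h.intertwines_endomorphismBar .one

lemma endomorphismBar_coe (c : C) :
    h.endomorphismBar (c : 𝓜(ℂ, C)) = (h.endomorphism c : 𝓜(ℂ, C)) :=
  (h.intertwines_endomorphismBar (.coe c)).left_unique h.injective <| by
    simpa only [h.coe_endomorphism] using Intertwines.coe (π := ι) (h.endomorphism c)

lemma continuous_endomorphismBar :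
    @Continuous _ _ (strictTopology C) (strictTopology C) h.endomorphismBar := by
  let _ := strictTopology C
  have hcoord : Continuous fun T : 𝓜(ℂ, C) =>
      (((fun c => T.fst c), fun c => T.snd c) : (C → C) × (C → C)) := continuous_induced_dom
  have cont_fst (c : C) : Continuous fun T : 𝓜(ℂ, C) => T.fst c :=
    (continuous_apply c).comp (continuous_fst.comp hcoord)
  have cont_snd (c : C) : Continuous fun T : 𝓜(ℂ, C) => T.snd c :=
    (continuous_apply c).comp (continuous_snd.comp hcoord)
  have cont_star : Continuous (star : 𝓜(ℂ, C) → 𝓜(ℂ, C)) :=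
    continuous_induced_rng.2 <| (continuous_pi fun c => (cont_snd (star c)).star).prodMk
      (continuous_pi fun c => (cont_fst (star c)).star)
  have cont_bar_fst (c : C) : Continuous fun T => (h.endomorphismBar T).fst c := by
    obtain ⟨e, y, hey⟩ := h.exists_conj_fst_eq c
    have hfst (T) : (h.endomorphismBar T).fst c = h.endomorphism (T.fst e) * y := by
      obtain ⟨R, hR⟩ := h.nondegenerate.exists_intertwines T
      exact h.injective <| by rw [← (h.intertwines_endomorphismBar hR).fst, hey T R hR]
    simp only [hfst]
    exact ((continuous_hom h.endomorphism).comp (cont_fst e)).mul continuous_const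
  refine continuous_induced_rng.2 ((continuous_pi cont_bar_fst).prodMk (continuous_pi fun c => ?_))
  refine ((cont_bar_fst (star c)).comp cont_star).star.congr fun T => ?_
  rw [Function.comp_apply, map_star h.endomorphismBar, star_fst, star_star, star_star]

lemma isStrictExtension : IsStrictExtension h.endomorphism h.endomorphismBar where
  map_coe := h.endomorphismBar_coe
  strictly_continuous := h.continuous_endomorphismBar

lemma range_endomorphism : Set.range h.endomorphism =
    Set.range fun c => (h.endomorphismBar 1).fst ((h.endomorphismBar 1).snd c) := by
  have hcut (c : C) : (ι ((h.endomorphismBar 1).fst ((h.endomorphismBar 1).snd c)) : 𝓜(ℂ, B))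
      = V * star V * (ι c : 𝓜(ℂ, B)) * (V * star V) := by
    rw [← h.intertwines_endomorphismBar_one.fst, ← h.intertwines_endomorphismBar_one.snd,
      ← mul_coe_eq, ← coe_mul_eq, ← mul_assoc]
  refine Set.Subset.antisymm (Set.range_subset_iff.2 fun c => ⟨h.endomorphism c, h.ext ?_⟩)
    (Set.range_subset_iff.2 fun c => ?_)
  · simp only [hcut, h.coe_endomorphism, mul_assoc, isometry_cancel h.isometry]
  · obtain ⟨e, he⟩ := h.exists_eq_endomorphism
      (s := (h.endomorphismBar 1).fst ((h.endomorphismBar 1).snd c)) <| by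
        simp only [hcut, mul_assoc, isometry_cancel h.isometry]
    exact ⟨e, he.symm⟩

end IsCornerStable

end Corners

section Smallness

lemma small_closure_set {X : Type v} [TopologicalSpace X] [T2Space X] [FrechetUrysohnSpace X]
    (s : Set X) [Small.{u} s] : Small.{u} (closure s) := by
  rcases isEmpty_or_nonempty X with _ | _
  · exact small_of_injective (β := PEmpty.{u + 1}) (f := fun x => isEmptyElim x.1)
      fun x => isEmptyElim x.1
  refine small_subset (s := Set.range fun f : ℕ → s => limUnder atTop fun n => (f n : X)) ?_
  intro x hx
  obtain ⟨f, hf, hx⟩ := mem_closure_iff_seq_limit.1 hx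
  exact ⟨fun n => ⟨f n, hf n⟩, hx.limUnder_eq⟩

lemma small_subsemigroup_closure {X : Type v} [Semigroup X] (s : Set X) [Small.{u} s] :
    Small.{u} (Subsemigroup.closure s : Set X) := by
  let f : FreeSemigroup (Shrink.{u} s) →ₙ* X :=
    FreeSemigroup.lift fun x => ((equivShrink s).symm x : X)
  refine small_subset (s := Set.range f) ?_
  change Subsemigroup.closure s ≤ f.srange
  rw [Subsemigroup.closure_le]
  intro x hx
  refine ⟨FreeSemigroup.of (equivShrink s ⟨x, hx⟩), ?_⟩
  simp [f]

lemma small_adjoin_closure {B : Type v} [NonUnitalCStarAlgebra B] (s : Set B) [Small.{u} s] :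
    Small.{u} (NonUnitalStarAlgebra.adjoin ℂ s).topologicalClosure := by
  have small_star : Small.{u} (star s : Set B) :=
    small_of_injective (β := s) (f := fun x => ⟨star x.1, x.2⟩) fun x y h =>
      Subtype.ext (star_injective (congrArg Subtype.val h))
  have small_words := small_subsemigroup_closure.{u} (s ∪ star s)
  have small_span :=
    Submodule.small_span.{u} (R := ℂ) (Subsemigroup.closure (s ∪ star s) : Set B)
  have adjoin_eq : (NonUnitalStarAlgebra.adjoin ℂ s : Set B)
      = (Submodule.span ℂ (Subsemigroup.closure (s ∪ star s) : Set B) : Set B) := by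
    rw [← NonUnitalAlgebra.adjoin_eq_span]
    rfl
  have small_adjoin : Small.{u} (NonUnitalStarAlgebra.adjoin ℂ s : Set B) := by
    rw [adjoin_eq]
    exact small_span
  exact small_closure_set.{u} (NonUnitalStarAlgebra.adjoin ℂ s : Set B)

/-- Transport of a C⋆-algebra structure along a bijection. -/
abbrev nonUnitalCStarAlgebraOfEquiv {X : Type u} {D : Type v} [NonUnitalCStarAlgebra D]
    (e : X ≃ D) : NonUnitalCStarAlgebra X :=
  letI : NonUnitalRing X := e.nonUnitalRing
  letI : Module ℂ X := e.module ℂ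
  letI f : X →ₙ+* D := { toFun := e, map_mul' := fun x y => e.apply_symm_apply _,
                         map_zero' := e.apply_symm_apply _,
                         map_add' := fun x y => e.apply_symm_apply _ }
  letI : NonUnitalNormedRing X := NonUnitalNormedRing.induced X D f e.injective
  { (inferInstance : NonUnitalNormedRing X), (inferInstance : Module ℂ X) with
    star := fun x => e.symm (star (e x))
    star_involutive := fun x => by
      change e.symm (star (e (e.symm (star (e x))))) = x
      simp
    star_mul := fun x y => by
      change e.symm (star (e (e.symm (e x * e y)))) =
        e.symm (e (e.symm (star (e y))) * e (e.symm (star (e x))))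
      simp
    star_add := fun x y => by
      change e.symm (star (e (e.symm (e x + e y)))) =
        e.symm (e (e.symm (star (e x))) + e (e.symm (star (e y))))
      simp
    complete := by
      have h : IsUniformInducing e := ⟨rfl⟩
      have : CompleteSpace X :=
        (completeSpace_congr (e := e) ⟨h, e.injective⟩).2 inferInstance
      exact fun {f} hf => CompleteSpace.complete hf
    norm_mul_self_le := fun x => by
      change ‖e x‖ * ‖e x‖ ≤ ‖e (e.symm (e (e.symm (star (e x))) * e x))‖
      simp [CStarRing.norm_star_mul_self]
    norm_smul_le := fun c x => by
      change ‖e (e.symm (c • e x))‖ ≤ ‖c‖ * ‖e x‖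
      rw [e.apply_symm_apply]
      exact norm_smul_le c (e x)
    smul_assoc := fun c x y => by
      change e.symm (e (e.symm (c • e x)) * e y) = e.symm (c • e (e.symm (e x * e y)))
      simp [smul_mul_assoc]
    smul_comm := fun c x y => by
      change e.symm (c • e (e.symm (e x * e y))) = e.symm (e x * e (e.symm (c • e y)))
      simp [mul_smul_comm]
    star_smul := fun c x => by
      change e.symm (star (e (e.symm (c • e x)))) = e.symm (star c • e (e.symm (star (e x))))
      simp }

lemma exists_starAlgEquiv_of_small (D : Type v) [NonUnitalCStarAlgebra D] [Small.{u} D] :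
    ∃ (X : Type u) (_ : NonUnitalCStarAlgebra X), Nonempty (X ≃⋆ₐ[ℂ] D) := by
  let e := (equivShrink.{u} D).symm
  refine ⟨Shrink.{u} D, nonUnitalCStarAlgebraOfEquiv e, ⟨?_⟩⟩
  letI := nonUnitalCStarAlgebraOfEquiv e
  exact
    { e with
      map_mul' := fun x y => e.apply_symm_apply _
      map_add' := fun x y => e.apply_symm_apply _
      map_star' := fun x => e.apply_symm_apply _
      map_smul' := fun c x => e.apply_symm_apply _ }

end Smallness

section CompactOperators

variable {A : Type u} [NonUnitalCStarAlgebra A] [PartialOrder A] [StarOrderedRing A]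

namespace HilbertBimodule

variable (E : HilbertBimodule A)

lemma rankOne_apply (m n p : E.carrier) : E.rankOne m n p = E.ract (E.inner n p) m := rfl

lemma inner_sum_rankOne {ι : Type*} (s : Finset ι) (m n : ι → E.carrier) (x y : E.carrier) :
    E.inner x ((∑ i ∈ s, E.rankOne (m i) (n i)) y)
      = E.inner ((∑ i ∈ s, E.rankOne (n i) (m i)) x) y := by
  simp only [sum_apply, map_sum, LinearMap.sum_apply, E.rankOne_apply,
    E.inner_ract, E.inner_ract_left, E.star_inner]

lemma norm_sum_rankOne_le {ι : Type*} (s : Finset ι) (m n : ι → E.carrier) :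
    ‖∑ i ∈ s, E.rankOne (m i) (n i)‖ ≤ ‖∑ i ∈ s, E.rankOne (n i) (m i)‖ := by
  set Θ := ∑ i ∈ s, E.rankOne (m i) (n i)
  set Θ' := ∑ i ∈ s, E.rankOne (n i) (m i)
  refine ContinuousLinearMap.opNorm_le_bound _ (norm_nonneg _) fun x => ?_
  have mul_norm_le : ‖Θ x‖ * ‖Θ x‖ ≤ ‖Θ'‖ * ‖x‖ * ‖Θ x‖ := by
    rw [← sq, E.norm_sq, E.inner_sum_rankOne]
    refine (E.norm_inner_le _ _).trans ?_
    calc ‖Θ' (Θ x)‖ * ‖x‖ ≤ ‖Θ'‖ * ‖Θ x‖ * ‖x‖ := by gcongr; exact Θ'.le_opNorm _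
      _ = _ := by ring
  rcases (norm_nonneg (Θ x)).eq_or_lt with h | h
  · rw [← h]; positivity
  · exact le_of_mul_le_mul_right mul_norm_le h

lemma compacts_induction {p : E.compacts → Prop} (hp : IsClosed {K | p K})
    (h : ∀ K (hK : K ∈ E.compacts), K ∈ Submodule.span ℂ
      (Set.range fun p : E.carrier × E.carrier => E.rankOne p.1 p.2) → p ⟨K, hK⟩)
    (K : E.compacts) : p K := by
  obtain ⟨K, hK⟩ := K
  obtain ⟨f, hf, hfK⟩ := mem_closure_iff_seq_limit.1 hK
  have tendsto_compacts :
      Tendsto (fun n => (⟨f n, Submodule.le_topologicalClosure _ (hf n)⟩ : E.compacts))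
        atTop (𝓝 ⟨K, hK⟩) := tendsto_subtype_rng.2 hfK
  exact hp.mem_of_tendsto tendsto_compacts (Eventually.of_forall fun n => h _ _ (hf n))

lemma compacts_mem {B : Type v} [NonUnitalCStarAlgebra B] {D : Submodule ℂ B}
    (hD : IsClosed (D : Set B)) {T : E.compacts →L[ℂ] B}
    (h : ∀ m n, T ⟨E.rankOne m n, E.rankOne_mem m n⟩ ∈ D) (K : E.compacts) : T K ∈ D := by
  refine E.compacts_induction (p := fun K => T K ∈ D) (hD.preimage T.continuous)
    (fun K hK hKs => ?_) K
  induction hKs using Submodule.span_induction with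
  | mem K hKs =>
    obtain ⟨p, rfl⟩ := hKs
    exact h _ _
  | zero => exact (map_zero T).symm ▸ zero_mem D
  | add K K' hKs hKs' ih ih' =>
    have := add_mem (ih (Submodule.le_topologicalClosure _ hKs))
      (ih' (Submodule.le_topologicalClosure _ hKs'))
    rwa [← map_add] at this
  | smul c K hKs ih =>
    have := D.smul_mem c (ih (Submodule.le_topologicalClosure _ hKs))
    rwa [← map_smul] at this

end HilbertBimodule

lemma le_of_forall_pow_two_pow_le {x t c : ℝ} (ht : 0 ≤ t) (hc : 0 ≤ c)
    (h : ∀ j : ℕ, x ^ 2 ^ j ≤ t ^ (2 ^ j - 1) * c) : x ≤ t := by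
  refine le_of_forall_gt_imp_ge_of_dense fun s hs => ?_
  have s_pos : 0 < s := ht.trans_lt hs
  by_contra! hlt
  have one_lt : 1 < x / s := (one_lt_div s_pos).2 hlt
  obtain ⟨N, hN⟩ := pow_unbounded_of_one_lt (c / s) one_lt
  have pow_le : (x / s) ^ 2 ^ N ≤ c / s := by
    rw [div_pow, div_le_div_iff₀ (by positivity) s_pos]
    calc x ^ 2 ^ N * s ≤ s ^ (2 ^ N - 1) * c * s := by
          gcongr; exact (h N).trans (by gcongr)
      _ = c * s ^ 2 ^ N := by rw [mul_right_comm, pow_sub_one_mul (by positivity), mul_comm]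
  exact (hN.trans_le (pow_le_pow_right₀ one_lt.le Nat.lt_two_pow_self.le)).not_ge pow_le

namespace Rep

variable {E : HilbertBimodule A} {B : Type v} [NonUnitalCStarAlgebra B] {π : A →⋆ₙₐ[ℂ] B}

lemma sum_mul_map (r : Rep E π) {ι : Type*} (s : Finset ι) (m n : ι → E.carrier)
    (p : E.carrier) : (∑ i ∈ s, r.ψ (m i) * star (r.ψ (n i))) * r.ψ p
      = r.ψ ((∑ i ∈ s, E.rankOne (m i) (n i)) p) := by
  simp only [sum_apply, map_sum, E.rankOne_apply, r.map_ract, Finset.sum_mul, mul_assoc,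
    r.star_mul_map]

/- The operator norm on the (possibly degenerate) range of `ψ` does not control the norm of `h`, but
`h ^ (N + 1) = ∑ i, ψ(S ^ N (m i)) ψ(n i)⋆`, and `‖h ^ 2 ^ j‖ = ‖h‖ ^ 2 ^ j` for self-adjoint
`h`. -/
lemma norm_le_of_mul_map (r : Rep E π) {ι : Type*} (s : Finset ι) (m n : ι → E.carrier)
    (S : E.carrier →L[ℂ] E.carrier) {h : B} (h_star : star h = h)
    (h_eq : h = ∑ i ∈ s, r.ψ (m i) * star (r.ψ (n i))) (h_mul : ∀ p, h * r.ψ p = r.ψ (S p)) :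
    ‖h‖ ≤ ‖S‖ := by
  have norm_pow_apply (N : ℕ) (p : E.carrier) : ‖(S ^ N) p‖ ≤ ‖S‖ ^ N * ‖p‖ := by
    induction N with
    | zero => simp
    | succ N ih =>
      rw [pow_succ', pow_succ', mul_assoc]
      exact (S.le_opNorm _).trans (mul_le_mul_of_nonneg_left ih (norm_nonneg _))
  have pow_fst_map (N : ℕ) (p : E.carrier) : ((h : 𝓜(ℂ, B)) ^ N).fst (r.ψ p) = r.ψ ((S ^ N) p) := by
    induction N with
    | zero => rfl
    | succ N ih => rw [pow_succ', mul_fst, ih, coe_fst, h_mul, pow_succ']; rfl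
  have pow_fst (N : ℕ) : ((h : 𝓜(ℂ, B)) ^ N).fst h
      = ∑ i ∈ s, r.ψ ((S ^ N) (m i)) * star (r.ψ (n i)) := by
    refine (congrArg ((h : 𝓜(ℂ, B)) ^ N).fst h_eq).trans ((map_sum _ _ _).trans ?_)
    exact Finset.sum_congr rfl fun i _ => by rw [fst_mul, pow_fst_map]
  have norm_pow_le (N : ℕ) : ‖(h : 𝓜(ℂ, B)) ^ (N + 1)‖ ≤ ‖S‖ ^ N * ∑ i ∈ s, ‖m i‖ * ‖n i‖ := by
    rw [pow_succ, mul_coe_eq, pow_fst, norm_coe, Finset.mul_sum]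
    refine (norm_sum_le _ _).trans (Finset.sum_le_sum fun i _ => (norm_mul_le _ _).trans ?_)
    rw [norm_star, ← mul_assoc]
    gcongr
    · exact (r.norm_le _).trans (norm_pow_apply N _)
    · exact r.norm_le _
  have self_adjoint : IsSelfAdjoint (h : 𝓜(ℂ, B)) := (coe_star h).symm.trans (congrArg _ h_star)
  refine le_of_forall_pow_two_pow_le (c := ∑ i ∈ s, ‖m i‖ * ‖n i‖) (norm_nonneg _)
    (by positivity) fun j => ?_
  rw [← norm_coe, ← self_adjoint.norm_pow_two_pow]
  convert norm_pow_le (2 ^ j - 1)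
  exact (Nat.succ_pred_eq_of_pos (by positivity)).symm

lemma norm_sum_mul_star_le (r : Rep E π) {ι : Type*} (s : Finset ι) (m n : ι → E.carrier) :
    ‖∑ i ∈ s, r.ψ (m i) * star (r.ψ (n i))‖ ≤ ‖∑ i ∈ s, E.rankOne (m i) (n i)‖ := by
  set x := ∑ i ∈ s, r.ψ (m i) * star (r.ψ (n i)) with hx
  set Θ := ∑ i ∈ s, E.rankOne (m i) (n i)
  set Θ' := ∑ i ∈ s, E.rankOne (n i) (m i)
  have star_x : star x = ∑ i ∈ s, r.ψ (n i) * star (r.ψ (m i)) := by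
    simp only [hx, star_sum, star_mul, star_star]
  refine le_of_sq_le_sq ?_ (norm_nonneg _)
  calc ‖x‖ ^ 2 = ‖star x * x‖ := by rw [sq, CStarRing.norm_star_mul_self]
    _ ≤ ‖Θ' * Θ‖ := by
      refine r.norm_le_of_mul_map s (fun i => Θ' (m i)) n (Θ' * Θ) (by rw [star_mul, star_star])
        ?_ fun p => ?_
      · conv_lhs => rw [hx]
        rw [Finset.mul_sum]
        exact Finset.sum_congr rfl fun i _ => by rw [← mul_assoc, star_x, r.sum_mul_map]
      · rw [mul_assoc, r.sum_mul_map, star_x, r.sum_mul_map]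
        rfl
    _ ≤ ‖Θ'‖ * ‖Θ‖ := ContinuousLinearMap.opNorm_comp_le Θ' Θ
    _ ≤ ‖Θ‖ ^ 2 := by
      rw [sq]
      gcongr
      exact E.norm_sum_rankOne_le s n m

lemma norm_compacts_le (r : Rep E π) {T : E.compacts →L[ℂ] B}
    (hT : ∀ m n, T ⟨E.rankOne m n, E.rankOne_mem m n⟩ = r.ψ m * star (r.ψ n)) (K : E.compacts) :
    ‖T K‖ ≤ ‖(K : E.carrier →L[ℂ] E.carrier)‖ := by
  refine E.compacts_induction (p := fun K => ‖T K‖ ≤ ‖(K : E.carrier →L[ℂ] E.carrier)‖)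
    (isClosed_le T.continuous.norm continuous_subtype_val.norm) (fun K hK hKs => ?_) K
  obtain ⟨N, c, g, rfl⟩ := Submodule.mem_span_set'.1 hKs
  choose p hp using fun i => (g i).2
  have sum_eq : ∑ i, c i • (g i : E.carrier →L[ℂ] E.carrier)
      = ∑ i, E.rankOne (c i • (p i).1) (p i).2 :=
    Finset.sum_congr rfl fun i _ => by
      rw [← hp i]
      ext x
      simp [E.rankOne_apply]
  have map_sum_eq : T ⟨_, hK⟩ = ∑ i, r.ψ (c i • (p i).1) * star (r.ψ (p i).2) := by
    have : (⟨_, hK⟩ : E.compacts) = ∑ i, ⟨_, E.rankOne_mem (c i • (p i).1) (p i).2⟩ :=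
      Subtype.ext (sum_eq.trans (by simp))
    rw [this, map_sum]
    exact Finset.sum_congr rfl fun i _ => hT _ _
  rw [map_sum_eq]
  exact (r.norm_sum_mul_star_le _ _ _).trans (congrArg norm sum_eq).ge

end Rep

end CompactOperators

section UniversalProperty

variable {A : Type u} [NonUnitalCStarAlgebra A] [PartialOrder A] [StarOrderedRing A]

namespace Rep

variable {E : HilbertBimodule A} {B : Type v} [NonUnitalCStarAlgebra B] {π : A →⋆ₙₐ[ℂ] B}
  {J : Set A} {hJ : ∀ a ∈ J, E.lact a ∈ E.compacts}

lemma continuous (r : Rep E π) : Continuous r.ψ :=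
  AddMonoidHomClass.continuous_of_bound r.ψ 1 fun m => by rw [one_mul]; exact r.norm_le m

/-- The representation `(f ∘ ψ, f ∘ π)`. -/
def map {C : Type w} [NonUnitalCStarAlgebra C] (r : Rep E π) (f : B →⋆ₙₐ[ℂ] C) :
    Rep E (f.comp π) where
  ψ := (f : B →ₗ[ℂ] C).comp r.ψ
  map_ract a m := (congrArg f (r.map_ract a m)).trans (map_mul f _ _)
  star_mul_map m n := by
    change star (f (r.ψ m)) * f (r.ψ n) = f (π (E.inner m n))
    rw [← map_star, ← map_mul, r.star_mul_map]
  map_lact a m := (congrArg f (r.map_lact a m)).trans (map_mul f _ _)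

lemma IsCoisometric.map {C : Type w} [NonUnitalCStarAlgebra C] {r : Rep E π}
    (hr : r.IsCoisometric J hJ) (f : B →⋆ₙₐ[ℂ] C) : (r.map f).IsCoisometric J hJ := by
  obtain ⟨T, hT, hTJ⟩ := hr
  refine ⟨⟨(f : B →ₗ[ℂ] C).comp T.toLinearMap, (continuous_hom f).comp T.continuous⟩,
    fun m n => ?_, fun a ha => congrArg f (hTJ a ha)⟩
  change f (T _) = f (r.ψ m) * star (f (r.ψ n))
  rw [hT, map_mul, map_star]

/-- The representation `(ψ, π)`, viewed in a closed ⋆-subalgebra that contains both ranges. -/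
def codRestrict (r : Rep E π) (D : NonUnitalStarSubalgebra ℂ B) [IsClosed (D : Set B)]
    (hA : ∀ a, π a ∈ D) (hM : ∀ m, r.ψ m ∈ D) :
    Rep E (NonUnitalStarAlgHom.codRestrict π D hA) where
  ψ := r.ψ.codRestrict D.toNonUnitalSubalgebra.toSubmodule hM
  map_ract a m := Subtype.ext (r.map_ract a m)
  star_mul_map m n := Subtype.ext (r.star_mul_map m n)
  map_lact a m := Subtype.ext (r.map_lact a m)

lemma IsCoisometric.codRestrict {r : Rep E π} (hr : r.IsCoisometric J hJ)
    (D : NonUnitalStarSubalgebra ℂ B) [hD : IsClosed (D : Set B)] (hA : ∀ a, π a ∈ D)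
    (hM : ∀ m, r.ψ m ∈ D) : (r.codRestrict D hA hM).IsCoisometric J hJ := by
  obtain ⟨T, hT, hTJ⟩ := hr
  have T_mem : ∀ K, T K ∈ D := E.compacts_mem (D := D.toNonUnitalSubalgebra.toSubmodule) hD
    fun m n => by rw [hT]; exact D.mul_mem (hM m) (star_mem (s := D) (hM n))
  exact ⟨⟨T.toLinearMap.codRestrict D.toNonUnitalSubalgebra.toSubmodule T_mem,
    T.continuous.subtype_mk T_mem⟩, fun m n => Subtype.ext (hT m n),
    fun a ha => Subtype.ext (hTJ a ha)⟩

end Rep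

variable {E : HilbertBimodule A} {J : Set A} {hJ : ∀ a ∈ J, E.lact a ∈ E.compacts}

namespace RelCP

/-- The coordinate of `𝒪(J, E)` at a coisometric representation. -/
def eval (r : CoisometricRep E J hJ) : RelCP E J hJ →⋆ₙₐ[ℂ] r.B where
  toFun x := (x.1 : ∀ r : CoisometricRep E J hJ, r.B) r
  map_smul' _ _ := rfl
  map_zero' := rfl
  map_add' _ _ := rfl
  map_mul' _ _ := rfl
  map_star' _ := rfl

lemma mem_of_generators {D : NonUnitalStarSubalgebra ℂ (RelCP E J hJ)}
    (hD : IsClosed (D : Set (RelCP E J hJ))) (hA : ∀ a, kA E J hJ a ∈ D)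
    (hM : ∀ m, (k E J hJ).ψ m ∈ D) (x : RelCP E J hJ) : x ∈ D := by
  let ι : RelCP E J hJ →⋆ₙₐ[ℂ] RepProduct E J hJ :=
    NonUnitalStarSubalgebraClass.subtype (relCP E J hJ)
  have hι : Topology.IsClosedEmbedding ι :=
    (inferInstance : IsClosed (relCP E J hJ : Set (RepProduct E J hJ))).isClosedEmbedding_subtypeVal
  have relCP_le : relCP E J hJ ≤ D.map ι := by
    refine NonUnitalStarSubalgebra.topologicalClosure_minimal _
      (NonUnitalStarAlgebra.adjoin_le ?_) ?_
    · rintro _ (⟨a, rfl⟩ | ⟨m, rfl⟩)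
      · exact ⟨_, hA a, rfl⟩
      · exact ⟨_, hM m, rfl⟩
    · rw [NonUnitalStarSubalgebra.coe_map]
      exact hι.isClosedMap _ hD
  obtain ⟨y, hy, hyx⟩ := relCP_le x.2
  exact hι.injective hyx ▸ hy

lemma hom_ext {B : Type v} [NonUnitalCStarAlgebra B] {f g : RelCP E J hJ →⋆ₙₐ[ℂ] B}
    (hA : ∀ a, f (kA E J hJ a) = g (kA E J hJ a))
    (hM : ∀ m, f ((k E J hJ).ψ m) = g ((k E J hJ).ψ m)) : f = g :=
  NonUnitalStarAlgHom.ext fun x =>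
    mem_of_generators (D := NonUnitalStarAlgHom.equalizer f g)
      (isClosed_eq (continuous_hom f) (continuous_hom g)) hA hM x

end RelCP

/- `𝒪(J, E)` is universal by construction for representations in C⋆-algebras in `Type u`; a
C⋆-algebra generated by a representation is small enough to be moved there. -/
lemma Rep.IsCoisometric.exists_lift {B : Type v} [NonUnitalCStarAlgebra B] {π : A →⋆ₙₐ[ℂ] B}
    {r : Rep E π} (hr : r.IsCoisometric J hJ) :
    ∃ θ : RelCP E J hJ →⋆ₙₐ[ℂ] B, (∀ a, θ (kA E J hJ a) = π a) ∧
      ∀ m, θ ((k E J hJ).ψ m) = r.ψ m := by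
  let s : Set B := Set.range π ∪ Set.range r.ψ
  let D := (NonUnitalStarAlgebra.adjoin ℂ s).topologicalClosure
  have : IsClosed (D : Set B) := NonUnitalStarSubalgebra.isClosed_topologicalClosure _
  have s_subset : s ⊆ D := fun x hx => NonUnitalStarSubalgebra.le_topologicalClosure _
    (NonUnitalStarAlgebra.subset_adjoin ℂ _ hx)
  have : Small.{u} D := small_adjoin_closure.{u} s
  obtain ⟨X, _, ⟨e⟩⟩ := exists_starAlgEquiv_of_small.{u} D
  let ε : X →⋆ₙₐ[ℂ] B := (NonUnitalStarSubalgebraClass.subtype D).comp (e : X →⋆ₙₐ[ℂ] D)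
  have ε_symm (d : D) : ε (e.symm d) = d := congrArg Subtype.val (e.apply_symm_apply d)
  have hrX := (hr.codRestrict D (fun a => s_subset (Or.inl ⟨a, rfl⟩))
    fun m => s_subset (Or.inr ⟨m, rfl⟩)).map (e.symm : D →⋆ₙₐ[ℂ] X)
  exact ⟨ε.comp (RelCP.eval ⟨X, _, _, hrX⟩), fun a => ε_symm _, fun m => ε_symm _⟩

lemma isCoisometric_k : (k E J hJ).IsCoisometric J hJ := by
  let prod : Rep E (prodA E J hJ) :=
    { ψ := prodM E J hJ
      map_ract := fun a m => Subtype.ext <| funext fun r => r.rep.map_ract a m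
      star_mul_map := fun m n => Subtype.ext <| funext fun r => r.rep.star_mul_map m n
      map_lact := fun a m => Subtype.ext <| funext fun r => r.rep.map_lact a m }
  choose T hT hTJ using fun r : CoisometricRep E J hJ => r.coisometric
  have norm_T_le : ∀ K r, ‖T r K‖ ≤ ‖(K : E.carrier →L[ℂ] E.carrier)‖ := fun K r =>
    r.rep.norm_compacts_le (hT r) K
  let T' : E.compacts →ₗ[ℂ] RepProduct E J hJ :=
    { toFun := fun K => ⟨fun r => T r K, memℓp_infty ⟨‖(K : E.carrier →L[ℂ] E.carrier)‖, by
        rintro _ ⟨r, rfl⟩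
        exact norm_T_le K r⟩⟩
      map_add' := fun K K' => Subtype.ext <| funext fun r => map_add (T r) K K'
      map_smul' := fun c K => Subtype.ext <| funext fun r => map_smul (T r) c K }
  have T'_continuous : Continuous T' :=
    AddMonoidHomClass.continuous_of_bound T' 1 fun K => by
      rw [one_mul]
      exact lp.norm_le_of_forall_le (norm_nonneg _) (norm_T_le K)
  have prod_coisometric : prod.IsCoisometric J hJ :=
    ⟨⟨T', T'_continuous⟩, fun m n => Subtype.ext <| funext fun r => hT r m n,
      fun a ha => Subtype.ext <| funext fun r => hTJ r a ha⟩
  exact prod_coisometric.codRestrict (relCP E J hJ) (prodA_mem E J hJ) (prodM_mem E J hJ)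

end UniversalProperty

section Isometry

variable {A : Type u} [NonUnitalCStarAlgebra A] [PartialOrder A]

lemma ExelSystem.L_alpha (S : ExelSystem A) (a : A) : S.L (S.α a) = a := by
  have := S.transfer a 1
  rwa [S.Lbar_one] at this

variable [StarOrderedRing A]

lemma HilbertBimodule.tendsto_ract_approxUnit (E : HilbertBimodule A) (m : E.carrier) :
    Tendsto (fun e => E.ract e m) (approxUnit A) (𝓝 m) := by
  have norm_sq_eq (e : A) : ‖E.ract e m - m‖ ^ 2 =
      ‖star e * (E.inner m m * e - E.inner m m) - (E.inner m m * e - E.inner m m)‖ := by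
    rw [E.norm_sq]
    simp only [map_sub, LinearMap.sub_apply, E.inner_ract, E.inner_ract_left]
    congr 1
    noncomm_ring
  have norm_sq_le {e : A} (he : ‖e‖ ≤ 1) :
      ‖E.ract e m - m‖ ^ 2 ≤ 2 * ‖E.inner m m * e - E.inner m m‖ := by
    rw [norm_sq_eq, two_mul]
    refine (norm_sub_le _ _).trans ?_
    gcongr
    refine (norm_mul_le _ _).trans ?_
    rw [norm_star]
    exact mul_le_of_le_one_left (norm_nonneg _) he
  have inner_tendsto : Tendsto (fun e => 2 * ‖E.inner m m * e - E.inner m m‖) (approxUnit A)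
      (𝓝 0) := by
    simpa using ((tendsto_mul_approxUnit (E.inner m m)).sub_const (E.inner m m)).norm.const_mul 2
  have norm_sq_tendsto : Tendsto (fun e => ‖E.ract e m - m‖ ^ 2) (approxUnit A) (𝓝 0) :=
    squeeze_zero' (Eventually.of_forall fun e => sq_nonneg _)
      (eventually_norm_approxUnit.mono fun e he => norm_sq_le he) inner_tendsto
  rw [tendsto_iff_norm_sub_tendsto_zero]
  simpa [Real.sqrt_sq (norm_nonneg _)] using norm_sq_tendsto.sqrt

namespace ExelSystem

variable (S : ExelSystem A)

lemma q_mul (a b : A) : S.q (a * b) = S.M.lact a (S.q b) :=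
  (S.preModule.lactC_coe a b).symm

lemma q_mul_alpha (a b : A) : S.q (a * S.α b) = S.M.ract b (S.q a) :=
  (S.preModule.ractC_coe b a).symm

lemma inner_q (a b : A) : S.M.inner (S.q a) (S.q b) = S.L (star a * b) :=
  S.preModule.innerC_coe a b

lemma denseRange_q : DenseRange S.q :=
  UniformSpace.Completion.denseRange_coe (α := S.preModule.carrier)

lemma exists_norm_q_le : ∃ C : ℝ, ∀ a : A, ‖S.q a‖ ≤ C * ‖a‖ := by
  obtain ⟨C, hC⟩ := S.L.exists_norm_apply_le
  refine ⟨√C, fun a => le_of_sq_le_sq ?_ (by positivity)⟩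
  rw [S.M.norm_sq, inner_q, mul_pow, Real.sq_sqrt C.coe_nonneg]
  refine (hC _).trans ?_
  rw [CStarRing.norm_star_mul_self, sq]

lemma continuous_q : Continuous S.q := by
  obtain ⟨C, hC⟩ := S.exists_norm_q_le
  exact AddMonoidHomClass.continuous_of_bound S.q C hC

end ExelSystem

variable {S : ExelSystem A} {B : Type v} [NonUnitalCStarAlgebra B] {π : A →⋆ₙₐ[ℂ] B}

namespace Rep

variable (r : Rep S.M π)

lemma map_q_mul (a b : A) : r.ψ (S.q (a * b)) = π a * r.ψ (S.q b) := by
  rw [S.q_mul, r.map_lact]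

lemma map_q_mul_alpha (a b : A) : r.ψ (S.q (a * S.α b)) = r.ψ (S.q a) * π b := by
  rw [S.q_mul_alpha, r.map_ract]

lemma continuous_map_q : Continuous fun a => r.ψ (S.q a) := r.continuous.comp S.continuous_q

lemma exists_isometry (hπ : Nondegenerate π) : ∃ V : 𝓜(ℂ, B),
    (∀ a, V.fst (π a) = r.ψ (S.q (S.α a))) ∧ ∀ a, V.snd (π a) = r.ψ (S.q a) := by
  obtain ⟨C, hC⟩ := S.exists_norm_q_le
  have bounded : ∀ᶠ e in approxUnit A, ‖r.ψ (S.q e)‖ ≤ max C 0 :=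
    eventually_norm_approxUnit.mono fun e he => calc
      ‖r.ψ (S.q e)‖ ≤ C * ‖e‖ := (r.norm_le _).trans (hC e)
      _ ≤ max C 0 * ‖e‖ := by gcongr; exact le_max_left C 0
      _ ≤ max C 0 := mul_le_of_le_one_right (le_max_right C 0) he
  have tendsto_fst (a : A) :
      Tendsto (fun e => r.ψ (S.q e) * π a) (approxUnit A) (𝓝 (r.ψ (S.q (S.α a)))) :=
    ((r.continuous_map_q.tendsto _).comp (tendsto_approxUnit_mul (S.α a))).congr fun e =>
      r.map_q_mul_alpha e a
  have tendsto_snd (a : A) :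
      Tendsto (fun e => π a * r.ψ (S.q e)) (approxUnit A) (𝓝 (r.ψ (S.q a))) :=
    ((r.continuous_map_q.tendsto _).comp (tendsto_mul_approxUnit a)).congr fun e =>
      r.map_q_mul a e
  obtain ⟨V, hfst, hsnd⟩ := exists_multiplier_of_tendsto bounded hπ hπ.dense_right
    (by
      rintro _ ⟨p, rfl⟩
      exact ⟨_, ((tendsto_fst p.1).mul_const p.2).congr fun e => mul_assoc _ _ _⟩)
    (by
      rintro _ ⟨p, rfl⟩
      exact ⟨_, ((tendsto_snd p.2).const_mul p.1).congr fun e => (mul_assoc _ _ _).symm⟩)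
  exact ⟨V, fun a => tendsto_nhds_unique (hfst _) (tendsto_fst a),
    fun a => tendsto_nhds_unique (hsnd _) (tendsto_snd a)⟩

/-- The isometry `V ∈ M(B)` implementing a representation `(ψ, π)` of `M_L` with `π`
nondegenerate: `ψ(q(a)) = π(a) V`. It is the strict limit of `ψ(q(e))` along the approximate unit
of `A`. -/
def isometry (hπ : Nondegenerate π) : 𝓜(ℂ, B) := (r.exists_isometry hπ).choose

variable (hπ : Nondegenerate π)

lemma isometry_fst (a : A) : (r.isometry hπ).fst (π a) = r.ψ (S.q (S.α a)) :=
  (r.exists_isometry hπ).choose_spec.1 a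

lemma isometry_snd (a : A) : (r.isometry hπ).snd (π a) = r.ψ (S.q a) :=
  (r.exists_isometry hπ).choose_spec.2 a

lemma star_isometry_mul_isometry : star (r.isometry hπ) * r.isometry hπ = 1 :=
  let V := r.isometry hπ
  hπ.ext_fst fun a => hπ.eq_of_forall_mul fun b => calc
    π b * (star V * V).fst (π a)
    _ = star (V.fst (π (star b))) * V.fst (π a) := by
      rw [mul_fst, ← (star V).central, star_snd, ← map_star π]
    _ = π (S.L (S.α b * S.α a)) := by
      rw [isometry_fst, isometry_fst, r.star_mul_map, S.inner_q, ← map_star, star_star]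
    _ = π b * (1 : 𝓜(ℂ, B)).fst (π a) := by
      rw [S.L_alpha_mul, S.L_alpha, map_mul]; rfl

lemma eq_isometry {W : 𝓜(ℂ, B)} (hW : ∀ a, W.snd (π a) = r.ψ (S.q a)) : W = r.isometry hπ :=
  hπ.ext_snd fun a => by rw [hW, isometry_snd]

end Rep

end Isometry

section Homogeneous

lemma Intertwines.of_fst_comp {D : Type w} {C : Type u} {B : Type v} [NonUnitalCStarAlgebra D]
    [NonUnitalCStarAlgebra C] [NonUnitalCStarAlgebra B] {ρ : D →⋆ₙₐ[ℂ] C} {π : C →⋆ₙₐ[ℂ] B}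
    (hρ : Nondegenerate ρ) (hπ : Nondegenerate π) {T : 𝓜(ℂ, C)} {R : 𝓜(ℂ, B)}
    (h : ∀ d, R.fst (π (ρ d)) = π (T.fst (ρ d))) : Intertwines π T R :=
  .of_fst hπ <| hρ.eq_of_left (R.fst.continuous.comp (continuous_hom π))
    ((continuous_hom π).comp T.fst.continuous) fun d x => by
      simp only [map_mul, fst_mul, h]

variable {A : Type u} [NonUnitalCStarAlgebra A] [PartialOrder A] [StarOrderedRing A]
variable {E : HilbertBimodule A} {J : Set A} {hJ : ∀ a ∈ J, E.lact a ∈ E.compacts}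

lemma gauge_gauge_inv (z : Circle) (x : RelCP E J hJ) :
    gauge E J hJ z (gauge E J hJ z⁻¹ x) = x := by
  have comp_eq_id :
      (gauge E J hJ z).comp (gauge E J hJ z⁻¹) = NonUnitalStarAlgHom.id ℂ (RelCP E J hJ) := by
    refine RelCP.hom_ext (fun a => ?_) fun m => ?_
    · rw [NonUnitalStarAlgHom.comp_apply, gauge_kA, gauge_kA]; rfl
    · rw [NonUnitalStarAlgHom.comp_apply, gauge_kM, map_smul, gauge_kM, smul_smul,
        ← Circle.coe_mul, inv_mul_cancel, Circle.coe_one, one_smul]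
      rfl
  exact DFunLike.congr_fun comp_eq_id x

lemma gauge_surjective (z : Circle) : Function.Surjective (gauge E J hJ z) := fun x =>
  ⟨gauge E J hJ z⁻¹ x, gauge_gauge_inv z x⟩

/-- The multiplier `T` of `𝒪(J, E)` is homogeneous of degree `n` for the gauge action:
`γ_z(T) = zⁿ T`. -/
def IsHomogeneous (n : ℤ) (T : 𝓜(ℂ, RelCP E J hJ)) : Prop :=
  ∀ z : Circle, Intertwines (gauge E J hJ z) T (((z : ℂ) ^ n) • T)

lemma isHomogeneous_coe {n : ℤ} {x : RelCP E J hJ} :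
    IsHomogeneous n (x : 𝓜(ℂ, RelCP E J hJ)) ↔
      ∀ z : Circle, gauge E J hJ z x = ((z : ℂ) ^ n) • x := by
  refine forall_congr' fun z => ?_
  have smul_coe : ((z : ℂ) ^ n) • (x : 𝓜(ℂ, RelCP E J hJ)) = (((z : ℂ) ^ n) • x : RelCP E J hJ) :=
    (map_smul (DoubleCentralizer.coeHom (𝕜 := ℂ) (A := RelCP E J hJ)) _ x).symm
  rw [smul_coe]
  refine ⟨fun h => (eq_of_forall_mul_right fun y => ?_).symm, fun h => h ▸ .coe x⟩
  obtain ⟨y, rfl⟩ := gauge_surjective z y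
  exact (h.fst y).trans (map_mul _ x y)

namespace IsHomogeneous

variable {m n : ℤ} {S T : 𝓜(ℂ, RelCP E J hJ)}

lemma mul (hS : IsHomogeneous m S) (hT : IsHomogeneous n T) : IsHomogeneous (m + n) (S * T) :=
  fun z => by
    simpa only [smul_mul_smul_comm, zpow_add₀ z.coe_ne_zero] using (hS z).mul (hT z)

lemma star (hT : IsHomogeneous n T) : IsHomogeneous (-n) (star T) := fun z => by
  have hz : (z : ℂ) ^ (-n) = Star.star ((z : ℂ) ^ n) := by
    rw [zpow_neg, star_zpow₀, Complex.star_def, ← Circle.coe_inv_eq_conj, Circle.coe_inv, inv_zpow]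
  simpa only [hz, star_smul] using (hT z).star

lemma one : IsHomogeneous 0 (1 : 𝓜(ℂ, RelCP E J hJ)) := fun z => by
  simpa only [zpow_zero, one_smul] using Intertwines.one

lemma pow (hT : IsHomogeneous n T) (i : ℕ) : IsHomogeneous (i * n) (T ^ i) := by
  induction i with
  | zero => simpa only [pow_zero, Nat.cast_zero, zero_mul] using one
  | succ i ih => simpa only [pow_succ, Nat.cast_succ, add_mul, one_mul] using ih.mul hT

lemma kM (m : E.carrier) : IsHomogeneous 1 ((k E J hJ).ψ m : 𝓜(ℂ, RelCP E J hJ)) :=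
  isHomogeneous_coe.2 fun z => by rw [zpow_one, gauge_kM]

lemma coreIncl (c : Core E J hJ) : IsHomogeneous 0 (coreIncl E J hJ c : 𝓜(ℂ, RelCP E J hJ)) :=
  isHomogeneous_coe.2 fun z => by rw [zpow_zero, one_smul]; exact c.2 z

lemma exists_coreIncl_eq {x : RelCP E J hJ} (hx : IsHomogeneous 0 (x : 𝓜(ℂ, RelCP E J hJ))) :
    ∃ c, ExelStacey.coreIncl E J hJ c = x :=
  ⟨⟨x, fun z => by simpa only [zpow_zero, one_smul] using isHomogeneous_coe.1 hx z⟩, rfl⟩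

end IsHomogeneous

lemma isHomogeneous_pow (i : ℕ) (m : (E.pow i).carrier) :
    IsHomogeneous i (((k E J hJ).pow i).ψ m : 𝓜(ℂ, RelCP E J hJ)) := by
  rw [isHomogeneous_coe]
  intro z
  induction i with
  | zero =>
    rw [Nat.cast_zero, zpow_zero, one_smul]
    exact gauge_kA E J hJ z m
  | succ i ih =>
    refine Rep.tensor_induction (E := E) (F := E.pow i) (p := fun m => gauge E J hJ z
      (((k E J hJ).pow (i + 1)).ψ m) = ((z : ℂ) ^ ((i + 1 : ℕ) : ℤ)) •
        ((k E J hJ).pow (i + 1)).ψ m) m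
      (isClosed_eq ((continuous_hom _).comp (Rep.continuous _))
        ((Rep.continuous ((k E J hJ).pow (i + 1))).const_smul ((z : ℂ) ^ ((i + 1 : ℕ) : ℤ))))
      fun y => ?_
    have pow_coe : ((k E J hJ).pow (i + 1)).ψ ((E.tensorPre (E.pow i)).toCompletion y)
        = (k E J hJ).tensorAlg ((k E J hJ).pow i) y := Rep.tensorL_coe _ _ y
    rw [pow_coe]
    change E.carrier ⊗[ℂ] (E.pow i).carrier at y
    induction y with
    | zero => simp
    | add x y hx hy =>
      rw [map_add, map_add, smul_add, hx, hy]
      all_goals exact Rep.tensorL_coe _ _ _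
    | tmul m n =>
      rw [Rep.tensorAlg_tmul, map_mul, ih, gauge_kM, smul_mul_smul_comm, Nat.cast_succ,
        zpow_add_one₀ z.coe_ne_zero, mul_comm (z : ℂ)]

end Homogeneous

section CoreEndomorphism

/-- The elements on which the approximate unit of `C` acts as the identity from both sides. -/
def approxUnitSubalgebra {C : Type u} {B : Type v} [NonUnitalCStarAlgebra C]
    [NonUnitalCStarAlgebra B] (π : C →⋆ₙₐ[ℂ] B) : NonUnitalStarSubalgebra ℂ B where
  carrier := {x | Tendsto (fun e => π e * x) (approxUnit C) (𝓝 x) ∧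
    Tendsto (fun e => π e * star x) (approxUnit C) (𝓝 (star x))}
  add_mem' {x y} hx hy := ⟨by simpa only [mul_add] using hx.1.add hy.1,
    by simpa only [mul_add, star_add] using hx.2.add hy.2⟩
  zero_mem' := by simp
  mul_mem' {x y} hx hy := ⟨by simpa only [mul_assoc] using hx.1.mul_const y,
    by simpa only [mul_assoc, star_mul] using hy.2.mul_const (star x)⟩
  smul_mem' c x hx := ⟨by simpa only [mul_smul_comm] using hx.1.const_smul c,
    by simpa only [mul_smul_comm, star_smul] using hx.2.const_smul (star c)⟩
  star_mem' hx := ⟨hx.2, by simpa only [star_star] using hx.1⟩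

lemma isClosed_tendsto_mul {C : Type u} {B : Type v} [NonUnitalCStarAlgebra C]
    [NonUnitalCStarAlgebra B] (π : C →⋆ₙₐ[ℂ] B) :
    IsClosed {x | Tendsto (fun e => π e * x) (approxUnit C) (𝓝 x)} := by
  rw [← closure_subset_iff_isClosed]
  intro x hx
  rw [Set.mem_ofPred_eq, Metric.tendsto_nhds]
  intro ε hε
  obtain ⟨y, hy, hxy⟩ := Metric.mem_closure_iff.1 hx (ε / 3) (by positivity)
  filter_upwards [Metric.tendsto_nhds.1 hy (ε / 3) (by positivity),
    eventually_norm_map_approxUnit π] with e dist_lt norm_le_one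
  have dist_mul_le : dist (π e * x) (π e * y) ≤ dist x y := by
    rw [dist_eq_norm, ← mul_sub, dist_eq_norm]
    exact (norm_mul_le _ _).trans (mul_le_of_le_one_left (norm_nonneg _) norm_le_one)
  linarith [dist_triangle4 (π e * x) (π e * y) y x, dist_comm x y]

lemma isClosed_approxUnitSubalgebra {C : Type u} {B : Type v} [NonUnitalCStarAlgebra C]
    [NonUnitalCStarAlgebra B] (π : C →⋆ₙₐ[ℂ] B) :
    IsClosed (approxUnitSubalgebra π : Set B) :=
  (isClosed_tendsto_mul π).inter ((isClosed_tendsto_mul π).preimage continuous_star)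

variable {A : Type u} [NonUnitalCStarAlgebra A] [PartialOrder A] [StarOrderedRing A]

lemma Rep.map_mem_approxUnitSubalgebra {S : ExelSystem A} {B : Type v} [NonUnitalCStarAlgebra B]
    {π : A →⋆ₙₐ[ℂ] B} (r : Rep S.M π) (m : S.M.carrier) : r.ψ m ∈ approxUnitSubalgebra π := by
  constructor
  · refine S.denseRange_q.induction_on
      (p := fun m => Tendsto (fun e => π e * r.ψ m) (approxUnit A) (𝓝 (r.ψ m))) m
      ((isClosed_tendsto_mul π).preimage r.continuous) fun a => ?_
    exact ((r.continuous_map_q.tendsto a).comp (tendsto_approxUnit_mul a)).congr fun e =>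
      r.map_q_mul e a
  · refine (((r.continuous.tendsto m).comp (S.M.tendsto_ract_approxUnit m)).star).congr'
      (eventually_star_approxUnit.mono fun e he => ?_)
    rw [Function.comp_apply, r.map_ract, star_mul, ← map_star, he]

variable (S : ExelSystem A) (J : Set A) (hJ : ∀ a ∈ J, S.M.lact a ∈ S.M.compacts)

lemma nondegenerate_kA : Nondegenerate (kA S.M J hJ) := by
  have tendsto_kA (a : A) : Tendsto (fun e => kA S.M J hJ e * kA S.M J hJ a) (approxUnit A)
      (𝓝 (kA S.M J hJ a)) := by
    simpa only [Function.comp_def, map_mul] using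
      ((continuous_hom (kA S.M J hJ)).tendsto a).comp (tendsto_approxUnit_mul a)
  refine .of_tendsto fun x => (RelCP.mem_of_generators
    (isClosed_approxUnitSubalgebra (kA S.M J hJ)) (fun a => ⟨tendsto_kA a, ?_⟩)
    (k S.M J hJ).map_mem_approxUnitSubalgebra x).1
  simpa only [map_star] using tendsto_kA (star a)

/-- The isometry `V ∈ M(𝒪(J, M_L))` with `k_M(q(a)) = k_A(a) V`. -/
def isom : 𝓜(ℂ, RelCP S.M J hJ) := (k S.M J hJ).isometry (nondegenerate_kA S J hJ)

lemma star_isom_mul_isom : star (isom S J hJ) * isom S J hJ = 1 :=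
  (k S.M J hJ).star_isometry_mul_isometry _

lemma kA_mul_isom (a : A) : (kA S.M J hJ a : 𝓜(ℂ, RelCP S.M J hJ)) * isom S J hJ
    = ((k S.M J hJ).ψ (S.q a) : RelCP S.M J hJ) := by
  rw [coe_mul_eq, isom, Rep.isometry_snd]

lemma isom_mul_kA (a : A) : isom S J hJ * (kA S.M J hJ a : 𝓜(ℂ, RelCP S.M J hJ))
    = ((k S.M J hJ).ψ (S.q (S.α a)) : RelCP S.M J hJ) := by
  rw [mul_coe_eq, isom, Rep.isometry_fst]

lemma eq_isom {W : 𝓜(ℂ, RelCP S.M J hJ)} (hW : ∀ a : A,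
    ((k S.M J hJ).ψ (S.q a) : 𝓜(ℂ, RelCP S.M J hJ)) = kA S.M J hJ a * W) : W = isom S J hJ :=
  (k S.M J hJ).eq_isometry _ fun a => coe_inj.1 <| by rw [← coe_mul_eq, hW]

lemma isHomogeneous_isom : IsHomogeneous 1 (isom S J hJ) := fun z => by
  have hkA := nondegenerate_kA S J hJ
  have comp_kA : (gauge S.M J hJ z).comp (kA S.M J hJ) = kA S.M J hJ := rfl
  refine .of_fst_comp hkA (.of_comp (ρ := kA S.M J hJ) (comp_kA ▸ hkA)) fun a => ?_
  change ((z : ℂ) ^ (1 : ℤ)) • (isom S J hJ).fst (kA S.M J hJ a) = _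
  rw [isom, Rep.isometry_fst, gauge_kM, zpow_one]

/-- The homomorphism `A → 𝒪(J, M_L)^γ` induced by `k_A`. -/
def kACore : A →⋆ₙₐ[ℂ] Core S.M J hJ :=
  NonUnitalStarAlgHom.codRestrict (kA S.M J hJ) (core S.M J hJ) fun a z => gauge_kA S.M J hJ z a

lemma coreIncl_kACore (a : A) : coreIncl S.M J hJ (kACore S J hJ a) = kA S.M J hJ a := rfl

lemma isCornerStable_coreIncl : IsCornerStable (coreIncl S.M J hJ) (isom S J hJ) where
  injective := Subtype.val_injective
  nondegenerate := .of_comp (ρ := kACore S J hJ) (nondegenerate_kA S J hJ)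
  isometry := star_isom_mul_isom S J hJ
  conj_mem c := by
    have hV := isHomogeneous_isom S J hJ
    have homogeneous := (hV.mul (.coreIncl c)).mul hV.star
    rw [mul_coe_eq, coe_mul_eq] at homogeneous ⊢
    exact homogeneous.exists_coreIncl_eq.imp fun d hd => congrArg _ hd
  compress_mem c := by
    have hV := isHomogeneous_isom S J hJ
    have homogeneous := (hV.star.mul (.coreIncl c)).mul hV
    rw [mul_coe_eq, coe_mul_eq] at homogeneous ⊢
    exact homogeneous.exists_coreIncl_eq.imp fun d hd => congrArg _ hd

/-- The endomorphism `α'` of the core given by `Ad V`. -/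
def adIsom : Core S.M J hJ →⋆ₙₐ[ℂ] Core S.M J hJ := (isCornerStable_coreIncl S J hJ).endomorphism

lemma coe_adIsom (c : Core S.M J hJ) : (coreIncl S.M J hJ (adIsom S J hJ c) : 𝓜(ℂ, RelCP S.M J hJ))
    = isom S J hJ * (coreIncl S.M J hJ c : 𝓜(ℂ, RelCP S.M J hJ)) * star (isom S J hJ) :=
  (isCornerStable_coreIncl S J hJ).coe_endomorphism c

lemma isom_mul_pow_lact (i : ℕ) (a : A) (m : (S.M.pow i).carrier) :
    isom S J hJ * (((k S.M J hJ).pow i).ψ ((S.M.pow i).lact a m) : RelCP S.M J hJ)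
      = (((k S.M J hJ).pow (i + 1)).ψ (S.M.tmul (S.M.pow i) (S.q (S.α a)) m) : RelCP S.M J hJ) := by
  have pow_succ_tmul : ((k S.M J hJ).pow (i + 1)).ψ (S.M.tmul (S.M.pow i) (S.q (S.α a)) m)
      = (k S.M J hJ).ψ (S.q (S.α a)) * ((k S.M J hJ).pow i).ψ m := Rep.tensorL_tmul _ _ _ _
  rw [pow_succ_tmul, ((k S.M J hJ).pow i).map_lact, coe_mul, coe_mul, ← mul_assoc, isom_mul_kA]

lemma adIsom_spanning (i : ℕ) (a b : A) (m n : (S.M.pow i).carrier) : ∃ c : Core S.M J hJ,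
    coreIncl S.M J hJ c = ((k S.M J hJ).pow i).ψ ((S.M.pow i).lact a m) *
      star (((k S.M J hJ).pow i).ψ ((S.M.pow i).lact b n)) ∧
    coreIncl S.M J hJ (adIsom S J hJ c) =
      ((k S.M J hJ).pow (i + 1)).ψ (S.M.tmul (S.M.pow i) (S.q (S.α a)) m) *
        star (((k S.M J hJ).pow (i + 1)).ψ (S.M.tmul (S.M.pow i) (S.q (S.α b)) n)) := by
  have homogeneous := (isHomogeneous_pow (hJ := hJ) i ((S.M.pow i).lact a m)).mul
    (isHomogeneous_pow (hJ := hJ) i ((S.M.pow i).lact b n)).star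
  rw [← coe_star, ← coe_mul, add_neg_cancel] at homogeneous
  obtain ⟨c, hc⟩ := homogeneous.exists_coreIncl_eq
  refine ⟨c, hc, coe_inj.1 ?_⟩
  rw [coe_adIsom, hc, coe_mul, coe_mul, coe_star, coe_star, ← isom_mul_pow_lact,
    ← isom_mul_pow_lact, star_mul]
  simp only [mul_assoc]

end CoreEndomorphism

section GaugeAverage

variable {A : Type u} [NonUnitalCStarAlgebra A] [PartialOrder A] [StarOrderedRing A]
variable {E : HilbertBimodule A} {J : Set A} {hJ : ∀ a ∈ J, E.lact a ∈ E.compacts}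

/-- The `N`-th root of unity `exp(2πi/N)`. -/
def rootOfUnity (N : ℕ) : Circle := Circle.exp (2 * Real.pi / N)

lemma isPrimitiveRoot_rootOfUnity {N : ℕ} (hN : N ≠ 0) :
    IsPrimitiveRoot (rootOfUnity N : ℂ) N := by
  have coe_eq : (rootOfUnity N : ℂ) = Complex.exp (2 * Real.pi * Complex.I / N) := by
    rw [rootOfUnity, Circle.coe_exp]
    congr 1
    push_cast
    ring
  exact coe_eq ▸ Complex.isPrimitiveRoot_exp N hN

variable (E J hJ) in
/-- The average of the gauge action over the `N`-th roots of unity. Unlike the average over the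
whole circle it needs no integration, and it still annihilates the homogeneous elements of degree
`n` with `0 < |n| < N`. -/
def gaugeAverage (N : ℕ) : RelCP E J hJ →ₗ[ℂ] RelCP E J hJ :=
  (N : ℂ)⁻¹ • ∑ i ∈ Finset.range N, (gauge E J hJ (rootOfUnity N ^ i) : RelCP E J hJ →ₗ[ℂ] _)

lemma gaugeAverage_apply (N : ℕ) (x : RelCP E J hJ) : gaugeAverage E J hJ N x =
    (N : ℂ)⁻¹ • ∑ i ∈ Finset.range N, gauge E J hJ (rootOfUnity N ^ i) x := by
  simp only [gaugeAverage, LinearMap.smul_apply, LinearMap.sum_apply]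
  rfl

lemma norm_gaugeAverage_le (N : ℕ) (x : RelCP E J hJ) : ‖gaugeAverage E J hJ N x‖ ≤ ‖x‖ := by
  rw [gaugeAverage_apply, norm_smul, norm_inv, Complex.norm_natCast]
  have norm_sum_le : ‖∑ i ∈ Finset.range N, gauge E J hJ (rootOfUnity N ^ i) x‖ ≤ N * ‖x‖ := calc
    _ ≤ ∑ _i ∈ Finset.range N, ‖x‖ :=
      norm_sum_le_of_le _ fun i _ => NonUnitalStarAlgHom.norm_apply_le _ x
    _ = N * ‖x‖ := by rw [Finset.sum_const, Finset.card_range, nsmul_eq_mul]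
  rcases Nat.eq_zero_or_pos N with rfl | hN
  · simp
  · rwa [inv_mul_le_iff₀ (by exact_mod_cast hN)]

lemma gaugeAverage_coreIncl {N : ℕ} (hN : N ≠ 0) (c : Core E J hJ) :
    gaugeAverage E J hJ N (coreIncl E J hJ c) = coreIncl E J hJ c := by
  have gauge_coreIncl (z : Circle) : gauge E J hJ z (coreIncl E J hJ c) = coreIncl E J hJ c := c.2 z
  simp only [gaugeAverage_apply, gauge_coreIncl, Finset.sum_const, Finset.card_range]
  rw [← Nat.cast_smul_eq_nsmul ℂ, smul_smul, inv_mul_cancel₀ (by exact_mod_cast hN), one_smul]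

lemma gaugeAverage_eq_zero {N : ℕ} {n : ℤ} (hn : n ≠ 0) (hN : n.natAbs < N) {x : RelCP E J hJ}
    (hx : IsHomogeneous n (x : 𝓜(ℂ, RelCP E J hJ))) : gaugeAverage E J hJ N x = 0 := by
  have hζ := isPrimitiveRoot_rootOfUnity (N := N) (by lia)
  set ζ := (rootOfUnity N : ℂ)
  have zpow_pow (i : ℕ) : ((rootOfUnity N ^ i : Circle) : ℂ) ^ n = (ζ ^ n) ^ i := by
    rw [Circle.coe_pow, ← zpow_natCast, ← zpow_natCast, zpow_comm]
  have zpow_ne_one : ζ ^ n ≠ 1 := by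
    rw [Ne, hζ.zpow_eq_one_iff_dvd]
    exact fun h => hn (Int.eq_zero_of_dvd_of_natAbs_lt_natAbs h (by simpa using hN))
  have zpow_pow_eq_one : (ζ ^ n) ^ N = 1 := by
    rw [← zpow_natCast, zpow_comm, zpow_natCast, hζ.pow_eq_one, one_zpow]
  simp only [gaugeAverage_apply, isHomogeneous_coe.1 hx, zpow_pow]
  rw [← Finset.sum_smul, geom_sum_eq zpow_ne_one, zpow_pow_eq_one, sub_self, zero_div, zero_smul,
    smul_zero]

end GaugeAverage

section Generation

variable {A : Type w} {C : Type u} {B : Type v} [NonUnitalCStarAlgebra A] [NonUnitalCStarAlgebra C]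
  [NonUnitalCStarAlgebra B]

/-- The elements of `B` that, together with their adjoints, map `F` into itself by left
multiplication. -/
def leftStabilizer (F : Submodule ℂ B) : NonUnitalStarSubalgebra ℂ B where
  carrier := {x | ∀ f ∈ F, x * f ∈ F ∧ star x * f ∈ F}
  add_mem' {x y} hx hy f hf := by
    rw [star_add, add_mul, add_mul]
    exact ⟨F.add_mem (hx f hf).1 (hy f hf).1, F.add_mem (hx f hf).2 (hy f hf).2⟩
  zero_mem' f _ := by simp
  mul_mem' {x y} hx hy f hf := by
    rw [star_mul, mul_assoc, mul_assoc]
    exact ⟨(hx _ (hy f hf).1).1, (hy _ (hx f hf).2).2⟩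
  smul_mem' c x hx f hf := by
    rw [star_smul, smul_mul_assoc, smul_mul_assoc]
    exact ⟨F.smul_mem c (hx f hf).1, F.smul_mem _ (hx f hf).2⟩
  star_mem' {x} hx f hf := by
    rw [star_star]
    exact (hx f hf).symm

lemma isClosed_leftStabilizer {F : Submodule ℂ B} (hF : IsClosed (F : Set B)) :
    IsClosed (leftStabilizer F : Set B) := by
  have carrier_eq : (leftStabilizer F : Set B) = ⋂ f ∈ F, {x | x * f ∈ F ∧ star x * f ∈ F} := by
    ext x
    simp only [Set.mem_iInter]
    rfl
  rw [carrier_eq]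
  exact isClosed_biInter fun f _ => (hF.preimage (continuous_mul_const f)).inter
    (hF.preimage (continuous_star.mul continuous_const))

/-- The subalgebra `D` of `C` is invariant under `Ad V` and under the compression `Ad V⋆`, where
`C` is mapped to `B` by `ι` and `V ∈ M(B)`. -/
structure IsAdInvariant (ι : C →⋆ₙₐ[ℂ] B) (V : 𝓜(ℂ, B)) (D : NonUnitalStarSubalgebra ℂ C) :
    Prop where
  conj_mem : ∀ d ∈ D, ∃ c ∈ D, (ι c : 𝓜(ℂ, B)) = V * (ι d : 𝓜(ℂ, B)) * star V
  compress_mem : ∀ d ∈ D, ∃ c ∈ D, (ι c : 𝓜(ℂ, B)) = star V * (ι d : 𝓜(ℂ, B)) * V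

/-- The span of the elements `d Vⁿ` and `V⋆ⁿ d` with `d ∈ D`. -/
def isomSpan (ι : C →⋆ₙₐ[ℂ] B) (V : 𝓜(ℂ, B)) (D : NonUnitalStarSubalgebra ℂ C) : Submodule ℂ B :=
  Submodule.span ℂ ((Set.range fun p : ℕ × D => (V ^ p.1).snd (ι p.2)) ∪
    Set.range fun p : ℕ × D => (star (V ^ p.1)).fst (ι p.2))

variable {ι : C →⋆ₙₐ[ℂ] B} {V : 𝓜(ℂ, B)} {D : NonUnitalStarSubalgebra ℂ C}

lemma mem_isomSpan_of_eq_mul_pow {x : B} {d : C} (hd : d ∈ D) (n : ℕ)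
    (hx : (x : 𝓜(ℂ, B)) = (ι d : 𝓜(ℂ, B)) * V ^ n) :
    x ∈ (isomSpan ι V D).topologicalClosure := by
  rw [coe_mul_eq, coe_inj] at hx
  exact Submodule.le_topologicalClosure _ (Submodule.subset_span (.inl ⟨(n, ⟨d, hd⟩), hx.symm⟩))

lemma mem_isomSpan_of_eq_star_pow_mul {x : B} {d : C} (hd : d ∈ D) (n : ℕ)
    (hx : (x : 𝓜(ℂ, B)) = star (V ^ n) * (ι d : 𝓜(ℂ, B))) :
    x ∈ (isomSpan ι V D).topologicalClosure := by
  rw [mul_coe_eq, coe_inj] at hx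
  exact Submodule.le_topologicalClosure _ (Submodule.subset_span (.inr ⟨(n, ⟨d, hd⟩), hx.symm⟩))

lemma fst_mem_isomSpan {T : 𝓜(ℂ, B)}
    (hpow : ∀ d ∈ D, ∀ n (x : B), (x : 𝓜(ℂ, B)) = T * ((ι d : 𝓜(ℂ, B)) * V ^ n) →
      x ∈ (isomSpan ι V D).topologicalClosure)
    (hstar_pow : ∀ d ∈ D, ∀ n (x : B), (x : 𝓜(ℂ, B)) = T * (star (V ^ n) * (ι d : 𝓜(ℂ, B))) →
      x ∈ (isomSpan ι V D).topologicalClosure)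
    {f : B} (hf : f ∈ (isomSpan ι V D).topologicalClosure) :
    T.fst f ∈ (isomSpan ι V D).topologicalClosure := by
  have span_le : isomSpan ι V D ≤ (isomSpan ι V D).topologicalClosure.comap T.fst.toLinearMap := by
    refine Submodule.span_le.2 ?_
    rintro _ (⟨⟨n, d, hd⟩, rfl⟩ | ⟨⟨n, d, hd⟩, rfl⟩)
    · exact hpow d hd n (T.fst ((V ^ n).snd (ι d))) (by rw [coe_mul_eq, mul_coe_eq])
    · exact hstar_pow d hd n (T.fst ((star (V ^ n)).fst (ι d))) (by rw [mul_coe_eq, mul_coe_eq])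
  exact Submodule.topologicalClosure_minimal _ span_le
    ((Submodule.isClosed_topologicalClosure _).preimage T.fst.continuous) hf

namespace IsAdInvariant

variable (h : IsAdInvariant ι V D)
include h

lemma pow_conj_mem (n : ℕ) : ∀ d ∈ D, ∃ c ∈ D,
    (ι c : 𝓜(ℂ, B)) = V ^ n * (ι d : 𝓜(ℂ, B)) * star (V ^ n) := by
  induction n with
  | zero => exact fun d hd => ⟨d, hd, by simp⟩
  | succ n ih =>
    intro d hd
    obtain ⟨c, hc, hcd⟩ := ih d hd
    obtain ⟨c', hc', hcc'⟩ := h.conj_mem c hc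
    refine ⟨c', hc', ?_⟩
    rw [hcc', hcd, pow_succ', star_mul]
    simp only [mul_assoc]

lemma star_isom_mul_mem_isomSpan {f : B} (hf : f ∈ (isomSpan ι V D).topologicalClosure) :
    (star V).fst f ∈ (isomSpan ι V D).topologicalClosure := by
  refine fst_mem_isomSpan (fun d hd n x hx => ?_) (fun d hd n x hx => ?_) hf
  · rcases n with _ | n
    · exact mem_isomSpan_of_eq_star_pow_mul hd 1 (by rw [hx, pow_zero, mul_one, pow_one])
    · obtain ⟨c, hc, hcd⟩ := h.compress_mem d hd
      refine mem_isomSpan_of_eq_mul_pow hc n ?_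
      rw [hx, hcd, pow_succ']
      simp only [mul_assoc]
  · exact mem_isomSpan_of_eq_star_pow_mul hd (n + 1) (by rw [hx, pow_succ, star_mul, mul_assoc])

variable (hV : star V * V = 1)
include hV

lemma mul_mem_isomSpan {d : C} (hd : d ∈ D) {f : B}
    (hf : f ∈ (isomSpan ι V D).topologicalClosure) :
    ι d * f ∈ (isomSpan ι V D).topologicalClosure := by
  refine fst_mem_isomSpan (T := (ι d : 𝓜(ℂ, B))) (fun c hc n x hx => ?_) (fun c hc n x hx => ?_) hf
  · refine mem_isomSpan_of_eq_mul_pow (D.mul_mem hd hc) n ?_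
    rw [hx, map_mul, coe_mul, mul_assoc]
  · obtain ⟨d', hd', hdd'⟩ := h.pow_conj_mem n d hd
    have hVn : star (V ^ n) * V ^ n = 1 := by rw [star_pow, pow_mul_pow_eq_one n hV]
    refine mem_isomSpan_of_eq_star_pow_mul (D.mul_mem hd' hc) n ?_
    rw [hx, map_mul, coe_mul, hdd']
    simp only [mul_assoc, isometry_cancel hVn]

lemma isom_mul_mem_isomSpan {ρ : A →⋆ₙₐ[ℂ] C} (hρ : Nondegenerate (ι.comp ρ))
    (hρD : ∀ a, ρ a ∈ D) {f : B} (hf : f ∈ (isomSpan ι V D).topologicalClosure) :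
    V.fst f ∈ (isomSpan ι V D).topologicalClosure := by
  have mul_pow_mem (d) (hd : d ∈ D) (n : ℕ) (x : B)
      (hx : (x : 𝓜(ℂ, B)) = V * ((ι d : 𝓜(ℂ, B)) * V ^ n)) :
      x ∈ (isomSpan ι V D).topologicalClosure := by
    obtain ⟨c, hc, hcd⟩ := h.conj_mem d hd
    refine mem_isomSpan_of_eq_mul_pow hc (n + 1) ?_
    rw [hx, hcd, pow_succ']
    simp only [mul_assoc, isometry_cancel hV]
  refine fst_mem_isomSpan mul_pow_mem (fun d hd n x hx => ?_) hf
  rcases n with _ | n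
  · exact mul_pow_mem d hd 0 x (by rw [hx, pow_zero, star_one, one_mul, mul_one])
  -- `V V⋆ⁿ⁺¹ d` is the limit of `V ρ(e) V⋆ ⬝ V⋆ⁿ d`.
  set y := (star (V ^ n)).fst (ι d)
  have hy : y ∈ (isomSpan ι V D).topologicalClosure :=
    mem_isomSpan_of_eq_star_pow_mul hd n (mul_coe_eq _ _).symm
  have hxy : x = V.fst ((star V).fst y) := coe_inj.1 <| by
    rw [hx, ← mul_coe_eq, ← mul_coe_eq, ← mul_coe_eq, pow_succ, star_mul, mul_assoc]
  rw [hxy]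
  refine (Submodule.isClosed_topologicalClosure _).mem_of_tendsto
    ((V.fst.continuous.tendsto _).comp (hρ.tendsto_mul ((star V).fst y)))
    (Eventually.of_forall fun e => ?_)
  obtain ⟨c, hc, hce⟩ := h.conj_mem (ρ e) (hρD e)
  have hmul : V.fst (ι (ρ e) * (star V).fst y) = ι c * y := coe_inj.1 <| by
    rw [← mul_coe_eq, coe_mul, coe_mul, hce, ← mul_coe_eq]
    simp only [mul_assoc]
  rw [Function.comp_apply, NonUnitalStarAlgHom.comp_apply, hmul]
  exact h.mul_mem_isomSpan hV hc hy

end IsAdInvariant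

end Generation

section CoreGeneration

variable {A : Type u} [NonUnitalCStarAlgebra A] [PartialOrder A] [StarOrderedRing A]
variable {S : ExelSystem A} {J : Set A} {hJ : ∀ a ∈ J, S.M.lact a ∈ S.M.compacts}

lemma RelCP.mem_of_isom {D : NonUnitalStarSubalgebra ℂ (RelCP S.M J hJ)}
    (hD : IsClosed (D : Set (RelCP S.M J hJ))) (hA : ∀ a, kA S.M J hJ a ∈ D)
    (hV : ∀ a, (isom S J hJ).snd (kA S.M J hJ a) ∈ D) (x : RelCP S.M J hJ) : x ∈ D :=
  RelCP.mem_of_generators hD hA (fun m => S.denseRange_q.induction_on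
    (p := fun m => (k S.M J hJ).ψ m ∈ D) m (hD.preimage (k S.M J hJ).continuous) fun a => by
      simpa only [isom, Rep.isometry_snd] using hV a) x

variable {D : NonUnitalStarSubalgebra ℂ (Core S.M J hJ)}

lemma IsAdInvariant.dense_isomSpan (h : IsAdInvariant (coreIncl S.M J hJ) (isom S J hJ) D)
    (hD : ∀ a, kACore S J hJ a ∈ D) (x : RelCP S.M J hJ) :
    x ∈ (isomSpan (coreIncl S.M J hJ) (isom S J hJ) D).topologicalClosure := by
  set F := (isomSpan (coreIncl S.M J hJ) (isom S J hJ) D).topologicalClosure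
  have hV := star_isom_mul_isom S J hJ
  have kA_mul_mem (a : A) (f) (hf : f ∈ F) : kA S.M J hJ a * f ∈ F :=
    h.mul_mem_isomSpan hV (hD a) hf
  have mem_stabilizer : x ∈ leftStabilizer F := by
    refine RelCP.mem_of_isom (isClosed_leftStabilizer (Submodule.isClosed_topologicalClosure _))
      (fun a f hf => ⟨kA_mul_mem a f hf, ?_⟩) (fun a f hf => ⟨?_, ?_⟩) x
    · rw [← map_star]
      exact kA_mul_mem (star a) f hf
    · rw [(isom S J hJ).central]
      exact kA_mul_mem a _
        (h.isom_mul_mem_isomSpan hV (ρ := kACore S J hJ) (nondegenerate_kA S J hJ) hD hf)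
    · have star_snd_mul : star ((isom S J hJ).snd (kA S.M J hJ a)) * f
          = (star (isom S J hJ)).fst (kA S.M J hJ (star a) * f) := by
        rw [fst_mul, star_fst, map_star (kA S.M J hJ), star_star]
      rw [star_snd_mul]
      exact h.star_isom_mul_mem_isomSpan (kA_mul_mem (star a) f hf)
  exact (Submodule.isClosed_topologicalClosure _).mem_of_tendsto
    ((nondegenerate_kA S J hJ).tendsto_mul_right x) (Eventually.of_forall fun e =>
      (mem_stabilizer _ (mem_isomSpan_of_eq_mul_pow (hD e) 0 (by rw [pow_zero, mul_one]; rfl))).1)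

lemma eventually_gaugeAverage_eq_zero {n : ℤ} (hn : n ≠ 0) {x : RelCP S.M J hJ}
    (hx : IsHomogeneous n (x : 𝓜(ℂ, RelCP S.M J hJ))) :
    ∀ᶠ N in atTop, gaugeAverage S.M J hJ N x = 0 :=
  (eventually_gt_atTop n.natAbs).mono fun _ hN => gaugeAverage_eq_zero hn hN hx

lemma eventually_gaugeAverage_mem {x : RelCP S.M J hJ}
    (hx : x ∈ isomSpan (coreIncl S.M J hJ) (isom S J hJ) D) :
    ∀ᶠ N in atTop, ∃ d ∈ D, coreIncl S.M J hJ d = gaugeAverage S.M J hJ N x := by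
  have average_coreIncl (d) (hd : d ∈ D) : ∀ᶠ N in atTop,
      ∃ c ∈ D, coreIncl S.M J hJ c = gaugeAverage S.M J hJ N (coreIncl S.M J hJ d) :=
    (eventually_ne_atTop 0).mono fun N hN => ⟨d, hd, (gaugeAverage_coreIncl hN d).symm⟩
  have average_homogeneous {n : ℤ} (hn : n ≠ 0) (y : RelCP S.M J hJ)
      (hy : IsHomogeneous n (y : 𝓜(ℂ, RelCP S.M J hJ))) : ∀ᶠ N in atTop,
      ∃ c ∈ D, coreIncl S.M J hJ c = gaugeAverage S.M J hJ N y :=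
    (eventually_gaugeAverage_eq_zero hn hy).mono fun N hN =>
      ⟨0, D.zero_mem, by rw [hN, map_zero]⟩
  have hVpow (n : ℕ) := (isHomogeneous_isom S J hJ).pow n
  induction hx using Submodule.span_induction with
  | mem x hx =>
    rcases hx with ⟨⟨_ | n, d, hd⟩, rfl⟩ | ⟨⟨_ | n, d, hd⟩, rfl⟩
    · exact average_coreIncl d hd
    · refine average_homogeneous (n := n + 1) (by lia) _ ?_
      simpa only [coe_mul_eq, zero_add, mul_one, Nat.cast_succ] using
        (IsHomogeneous.coreIncl d).mul (hVpow (n + 1))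
    · simpa only [pow_zero, star_one] using! average_coreIncl d hd
    · refine average_homogeneous (n := -(n + 1)) (by lia) _ ?_
      simpa only [mul_coe_eq, add_zero, mul_one, Nat.cast_succ] using
        (hVpow (n + 1)).star.mul (IsHomogeneous.coreIncl d)
  | zero => exact .of_forall fun N => ⟨0, D.zero_mem, by rw [map_zero, map_zero]⟩
  | add x y _ _ hx hy =>
    filter_upwards [hx, hy] with N ⟨c, hc, hcx⟩ ⟨d, hd, hdy⟩
    exact ⟨c + d, D.add_mem hc hd, by rw [map_add, map_add, hcx, hdy]⟩
  | smul z x _ hx =>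
    filter_upwards [hx] with N ⟨c, hc, hcx⟩
    exact ⟨z • c, D.smul_mem z hc, by rw [map_smul, map_smul, hcx]⟩

lemma IsAdInvariant.mem_of_isClosed (h : IsAdInvariant (coreIncl S.M J hJ) (isom S J hJ) D)
    (hD : ∀ a, kACore S J hJ a ∈ D) (hD_closed : IsClosed (D : Set (Core S.M J hJ)))
    (c : Core S.M J hJ) : c ∈ D := by
  rw [← SetLike.mem_coe, ← hD_closed.closure_eq, Metric.mem_closure_iff]
  intro ε hε
  obtain ⟨x, hx, hxc⟩ := Metric.mem_closure_iff.1
    (h.dense_isomSpan hD (coreIncl S.M J hJ c)) ε hε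
  obtain ⟨N, ⟨d, hd, hdx⟩, hN⟩ :=
    ((eventually_gaugeAverage_mem hx).and (eventually_ne_atTop 0)).exists
  refine ⟨d, hd, ?_⟩
  calc dist c d = ‖gaugeAverage S.M J hJ N (coreIncl S.M J hJ c - x)‖ := by
        rw [map_sub, gaugeAverage_coreIncl hN, ← hdx]
        exact dist_eq_norm c d
    _ ≤ ‖coreIncl S.M J hJ c - x‖ := norm_gaugeAverage_le _ _
    _ < ε := by rwa [← dist_eq_norm]

end CoreGeneration

section StaceyIntegration

namespace IsStaceyCovariant

variable {C : Type u} {B : Type v} [NonUnitalCStarAlgebra C] [NonUnitalCStarAlgebra B]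
  {β : C →⋆ₙₐ[ℂ] C} {ρ : C →⋆ₙₐ[ℂ] B} {W : 𝓜(ℂ, B)}

lemma intertwines (h : IsStaceyCovariant β ρ W) {βbar : 𝓜(ℂ, C) →⋆ₙₐ[ℂ] 𝓜(ℂ, C)}
    (hβ : IsStrictExtension β βbar) {T : 𝓜(ℂ, C)} {R : 𝓜(ℂ, B)} (hTR : Intertwines ρ T R) :
    Intertwines ρ (βbar T) (W * R * star W) := by
  let _ := strictTopology C
  refine .of_fst h.nondegenerate fun c => ?_
  have tendsto_T : Tendsto (fun e => ((T.fst e : C) : 𝓜(ℂ, C))) (approxUnit C) (𝓝 T) := by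
    have isInducing : IsInducing fun R : 𝓜(ℂ, C) =>
        (((fun c => R.fst c), fun c => R.snd c) : (C → C) × (C → C)) := ⟨rfl⟩
    refine isInducing.tendsto_nhds_iff.2 (.prodMk_nhds (tendsto_pi_nhds.2 fun x => ?_)
      (tendsto_pi_nhds.2 fun x => ?_))
    · simpa only [Function.comp_def, coe_fst, fst_mul] using
        (T.fst.continuous.tendsto x).comp (tendsto_approxUnit_mul x)
    · simpa only [coe_snd, T.central] using tendsto_mul_approxUnit (T.snd x)
  have tendsto_map : Tendsto (fun e => ρ (β (T.fst e) * c)) (approxUnit C)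
      (𝓝 (ρ ((βbar T).fst c))) := by
    have continuous_eval : Continuous fun S : 𝓜(ℂ, C) => ρ (S.fst c) :=
      (continuous_hom ρ).comp ((continuous_apply c).comp
        (continuous_fst.comp (continuous_induced_dom (f := fun S : 𝓜(ℂ, C) =>
          (((fun c => S.fst c), fun c => S.snd c) : (C → C) × (C → C))))))
    simpa only [Function.comp_def, hβ.map_coe, coe_fst] using
      ((continuous_eval.comp hβ.strictly_continuous).tendsto T).comp tendsto_T
  refine tendsto_nhds_unique (((W * R).fst.continuous.tendsto _).comp
    (h.nondegenerate.tendsto_mul ((star W).fst (ρ c)))) (tendsto_map.congr fun e => coe_inj.1 ?_)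
  rw [map_mul, coe_mul, h.covariant, ← hTR.fst, Function.comp_apply, ← mul_coe_eq, ← mul_coe_eq,
    coe_mul, ← mul_coe_eq]
  simp only [mul_assoc]

variable {B' : Type w} [NonUnitalCStarAlgebra B'] {ι : C →⋆ₙₐ[ℂ] B'} {V : 𝓜(ℂ, B')}
  {hι : IsCornerStable ι V} (h : IsStaceyCovariant hι.endomorphism ρ W)
include h

lemma intertwines_proj : Intertwines ρ (hι.endomorphismBar 1) (W * star W) := by
  simpa only [mul_one] using h.intertwines hι.isStrictExtension .one

lemma map_mul_proj {c d : C}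
    (hd : (ι d : 𝓜(ℂ, B')) = (ι c : 𝓜(ℂ, B')) * (V * star V)) :
    (ρ d : 𝓜(ℂ, B)) = (ρ c : 𝓜(ℂ, B)) * (W * star W) := by
  have hd_eq : d = (hι.endomorphismBar 1).snd c := hι.ext <| by
    rw [hd, coe_mul_eq, hι.intertwines_endomorphismBar_one.snd]
  rw [hd_eq, coe_mul_eq, h.intertwines_proj.snd]

lemma map_compress {c d : C}
    (hd : (ι d : 𝓜(ℂ, B')) = star V * (ι c : 𝓜(ℂ, B')) * V) :
    (ρ d : 𝓜(ℂ, B)) = star W * (ρ c : 𝓜(ℂ, B)) * W := by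
  have hα : hι.endomorphism d = (hι.endomorphismBar 1).fst ((hι.endomorphismBar 1).snd c) :=
    hι.ext <| by
      rw [hι.coe_endomorphism, hd, ← hι.intertwines_endomorphismBar_one.fst,
        ← hι.intertwines_endomorphismBar_one.snd, ← mul_coe_eq, ← coe_mul_eq]
      simp only [mul_assoc]
  have hW : W * (ρ d : 𝓜(ℂ, B)) * star W
      = W * star W * ((ρ c : 𝓜(ℂ, B)) * (W * star W)) := by
    rw [← h.covariant, hα, ← h.intertwines_proj.fst, ← h.intertwines_proj.snd, ← mul_coe_eq,
      ← coe_mul_eq]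
  have hcancel := congrArg (fun T => star W * T * W) hW
  simpa only [mul_assoc, isometry_cancel h.isometry, h.isometry, mul_one] using hcancel

end IsStaceyCovariant

end StaceyIntegration

section StaceyToCuntzPimsner

variable {A : Type u} [NonUnitalCStarAlgebra A] [PartialOrder A] [StarOrderedRing A]
variable (S : ExelSystem A) (J : Set A) (hJ : ∀ a ∈ J, S.M.lact a ∈ S.M.compacts)

lemma star_isom_snd_kM_mem_core (m : S.M.carrier) :
    (star (isom S J hJ)).snd ((k S.M J hJ).ψ m) ∈ core S.M J hJ := by
  have homogeneous : IsHomogeneous 0 (((k S.M J hJ).ψ m : 𝓜(ℂ, RelCP S.M J hJ))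
      * star (isom S J hJ)) := (IsHomogeneous.kM m).mul (isHomogeneous_isom S J hJ).star
  rw [coe_mul_eq] at homogeneous
  obtain ⟨c, hc⟩ := homogeneous.exists_coreIncl_eq
  exact hc ▸ c.2

/-- The elements `k_M(m) V⋆` of the core, from which `k_M(m)` is recovered on right multiplication
by `V`. -/
def kMCore : S.M.carrier →ₗ[ℂ] Core S.M J hJ :=
  ((star (isom S J hJ)).snd.toLinearMap ∘ₗ (k S.M J hJ).ψ).codRestrict
    (core S.M J hJ).toNonUnitalSubalgebra.toSubmodule (star_isom_snd_kM_mem_core S J hJ)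

lemma coe_kMCore (m : S.M.carrier) :
    (coreIncl S.M J hJ (kMCore S J hJ m) : 𝓜(ℂ, RelCP S.M J hJ))
      = ((k S.M J hJ).ψ m : RelCP S.M J hJ) * star (isom S J hJ) := by
  rw [coe_mul_eq]
  rfl

lemma nondegenerate_kACore : Nondegenerate (kACore S J hJ) :=
  .of_injective_comp (isCornerStable_coreIncl S J hJ).injective (nondegenerate_kA S J hJ)

lemma coreIncl_kMCore_mul_star (m n : S.M.carrier) :
    coreIncl S.M J hJ (kMCore S J hJ m * star (kMCore S J hJ n))
      = (k S.M J hJ).ψ m * star ((k S.M J hJ).ψ n) := coe_inj.1 <| by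
  rw [map_mul, map_star, coe_mul, coe_star, coe_kMCore, coe_kMCore, coe_mul, coe_star, star_mul,
    star_star]
  simp only [mul_assoc, isometry_cancel (star_isom_mul_isom S J hJ)]

lemma exists_compacts_core : ∃ T : S.M.compacts →L[ℂ] Core S.M J hJ,
    (∀ m n, T ⟨S.M.rankOne m n, S.M.rankOne_mem m n⟩
      = kMCore S J hJ m * star (kMCore S J hJ n)) ∧
    ∀ a (ha : a ∈ J), T ⟨S.M.lact a, hJ a ha⟩ = kACore S J hJ a := by
  obtain ⟨T, hT, hTJ⟩ := isCoisometric_k (E := S.M) (J := J) (hJ := hJ)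
  have T_rankOne (m n) : T ⟨S.M.rankOne m n, S.M.rankOne_mem m n⟩
      = coreIncl S.M J hJ (kMCore S J hJ m * star (kMCore S J hJ n)) := by
    rw [hT, coreIncl_kMCore_mul_star]
  have T_mem (K) : T K ∈ core S.M J hJ :=
    S.M.compacts_mem (D := (core S.M J hJ).toNonUnitalSubalgebra.toSubmodule)
      (inferInstance : IsClosed (core S.M J hJ : Set (RelCP S.M J hJ)))
      (fun m n => by rw [T_rankOne]; exact Subtype.prop _) K
  exact ⟨⟨T.toLinearMap.codRestrict (core S.M J hJ).toNonUnitalSubalgebra.toSubmodule T_mem,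
    T.continuous.subtype_mk T_mem⟩, fun m n => Subtype.ext (T_rankOne m n),
    fun a ha => Subtype.ext (hTJ a ha)⟩

variable {S J hJ}

lemma core_ext {c d : Core S.M J hJ} (hcd : (coreIncl S.M J hJ c : 𝓜(ℂ, RelCP S.M J hJ))
    = coreIncl S.M J hJ d) : c = d :=
  (isCornerStable_coreIncl S J hJ).ext hcd

lemma adIsom_kACore (a : A) :
    adIsom S J hJ (kACore S J hJ a) = kMCore S J hJ (S.q (S.α a)) :=
  core_ext <| by rw [coe_adIsom, coe_kMCore, coreIncl_kACore, isom_mul_kA]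

lemma star_kMCore_mul (m n : S.M.carrier) :
    star (kMCore S J hJ m) * kMCore S J hJ n = adIsom S J hJ (kACore S J hJ (S.M.inner m n)) :=
  core_ext <| by
    rw [coe_adIsom, coreIncl_kACore, map_mul, map_star, coe_mul, coe_star, coe_kMCore, coe_kMCore,
      star_mul, star_star, ← (k S.M J hJ).star_mul_map, coe_mul, coe_star]
    simp only [mul_assoc]

lemma kMCore_lact (a : A) (m : S.M.carrier) :
    kMCore S J hJ (S.M.lact a m) = kACore S J hJ a * kMCore S J hJ m :=
  core_ext <| by
    rw [map_mul, coe_mul, coe_kMCore, coe_kMCore, coreIncl_kACore, (k S.M J hJ).map_lact, coe_mul,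
      mul_assoc]

lemma kMCore_ract (a : A) (m : S.M.carrier) :
    kMCore S J hJ (S.M.ract a m) = kMCore S J hJ m * adIsom S J hJ (kACore S J hJ a) :=
  core_ext <| by
    rw [map_mul, coe_mul, coe_kMCore, coe_kMCore, coe_adIsom, coreIncl_kACore,
      (k S.M J hJ).map_ract, coe_mul]
    simp only [mul_assoc, isometry_cancel (star_isom_mul_isom S J hJ)]

namespace IsStaceyCovariant

variable {B : Type w} [NonUnitalCStarAlgebra B] {ρ : Core S.M J hJ →⋆ₙₐ[ℂ] B} {W : 𝓜(ℂ, B)}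
  (h : IsStaceyCovariant (adIsom S J hJ) ρ W)

/-- The representation `m ↦ ρ(k_M(m) V⋆) W` of `M_L` defined by a Stacey-covariant representation
`(ρ, W)` of the core. -/
def toRep : Rep S.M (ρ.comp (kACore S J hJ)) where
  ψ := W.snd.toLinearMap ∘ₗ (ρ : Core S.M J hJ →ₗ[ℂ] B) ∘ₗ kMCore S J hJ
  map_ract a m := coe_inj.1 <| by
    change (W.snd (ρ (kMCore S J hJ _)) : 𝓜(ℂ, B))
      = (W.snd (ρ (kMCore S J hJ m)) * ρ (kACore S J hJ a) : B)
    rw [coe_mul, ← coe_mul_eq, ← coe_mul_eq, kMCore_ract, map_mul, coe_mul, h.covariant]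
    simp only [mul_assoc, h.isometry, mul_one]
  star_mul_map m n := coe_inj.1 <| by
    change (star (W.snd (ρ (kMCore S J hJ m))) * W.snd (ρ (kMCore S J hJ n)) : B)
      = (ρ (kACore S J hJ (S.M.inner m n)) : 𝓜(ℂ, B))
    have hρ := h.covariant (kACore S J hJ (S.M.inner m n))
    rw [← star_kMCore_mul, map_mul, map_star, coe_mul] at hρ
    rw [coe_mul, coe_star, ← coe_mul_eq, ← coe_mul_eq, star_mul, ← coe_star,
      mul_assoc, ← mul_assoc (_ : 𝓜(ℂ, B)) _ W, hρ]
    simp only [mul_assoc, h.isometry, mul_one, isometry_cancel h.isometry]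
  map_lact a m := by
    change W.snd (ρ (kMCore S J hJ _)) = ρ (kACore S J hJ a) * W.snd (ρ (kMCore S J hJ m))
    rw [kMCore_lact, map_mul, snd_mul]

include h

lemma coe_toRep (m : S.M.carrier) :
    (h.toRep.ψ m : 𝓜(ℂ, B)) = (ρ (kMCore S J hJ m) : 𝓜(ℂ, B)) * W := by
  rw [coe_mul_eq]
  rfl

lemma toRep_mul_star_toRep (m n : S.M.carrier) :
    h.toRep.ψ m * star (h.toRep.ψ n) = ρ (kMCore S J hJ m * star (kMCore S J hJ n)) := by
  have kMCore_mul_proj : (ρ (kMCore S J hJ m) : 𝓜(ℂ, B))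
      = (ρ (kMCore S J hJ m) : 𝓜(ℂ, B)) * (W * star W) := by
    refine h.map_mul_proj (hι := isCornerStable_coreIncl S J hJ) ?_
    rw [coe_kMCore]
    simp only [mul_assoc, isometry_cancel (star_isom_mul_isom S J hJ)]
  rw [← coe_inj, coe_mul, coe_star, coe_toRep, coe_toRep, map_mul, map_star, coe_mul, coe_star,
    star_mul, mul_assoc, ← mul_assoc W, ← mul_assoc, ← kMCore_mul_proj]

lemma isCoisometric_toRep : h.toRep.IsCoisometric J hJ := by
  obtain ⟨T, hT, hTJ⟩ := exists_compacts_core S J hJ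
  exact ⟨⟨(ρ : Core S.M J hJ →ₗ[ℂ] B) ∘ₗ T.toLinearMap, (continuous_hom ρ).comp T.continuous⟩,
    fun m n => (congrArg ρ (hT m n)).trans (h.toRep_mul_star_toRep m n).symm,
    fun a ha => congrArg ρ (hTJ a ha)⟩

lemma intertwines_isom {θ : RelCP S.M J hJ →⋆ₙₐ[ℂ] B}
    (hA : ∀ a, θ (kA S.M J hJ a) = ρ (kACore S J hJ a))
    (hM : ∀ m, θ ((k S.M J hJ).ψ m) = h.toRep.ψ m) : Intertwines θ (isom S J hJ) W := by
  have comp_kA : θ.comp (kA S.M J hJ) = ρ.comp (kACore S J hJ) := NonUnitalStarAlgHom.ext hA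
  have hθ : Nondegenerate θ :=
    .of_comp (comp_kA ▸ h.nondegenerate.comp (nondegenerate_kACore S J hJ))
  refine .of_fst_comp (nondegenerate_kA S J hJ) hθ fun a => coe_inj.1 ?_
  rw [← mul_coe_eq, hA, coe_inj.1 ((mul_coe_eq _ _).symm.trans (isom_mul_kA S J hJ a)), hM,
    coe_toRep, ← adIsom_kACore, h.covariant]
  simp only [mul_assoc, h.isometry, mul_one]

lemma isAdInvariant_equalizer {θ : RelCP S.M J hJ →⋆ₙₐ[ℂ] B}
    (hθ : Intertwines θ (isom S J hJ) W) :
    IsAdInvariant (coreIncl S.M J hJ) (isom S J hJ)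
      (NonUnitalStarAlgHom.equalizer (θ.comp (coreIncl S.M J hJ)) ρ) where
  conj_mem d hd := by
    have hd : θ (coreIncl S.M J hJ d) = ρ d := hd
    refine ⟨adIsom S J hJ d, ?_, coe_adIsom S J hJ d⟩
    refine coe_inj.1 ?_
    rw [NonUnitalStarAlgHom.comp_apply, hθ.map_mul_mul hθ.star (coe_adIsom S J hJ d), hd,
      h.covariant]
  compress_mem d hd := by
    have hd : θ (coreIncl S.M J hJ d) = ρ d := hd
    obtain ⟨c, hc⟩ := (isCornerStable_coreIncl S J hJ).compress_mem d
    refine ⟨c, coe_inj.1 ?_, hc⟩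
    rw [NonUnitalStarAlgHom.comp_apply, hθ.star.map_mul_mul hθ hc, hd,
      h.map_compress (hι := isCornerStable_coreIncl S J hJ) hc]

lemma exists_integrated : ∃ θ : RelCP S.M J hJ →⋆ₙₐ[ℂ] B,
    (∀ c, θ (coreIncl S.M J hJ c) = ρ c) ∧ Intertwines θ (isom S J hJ) W := by
  obtain ⟨θ, hθA, hθM⟩ := h.isCoisometric_toRep.exists_lift
  have hθ := h.intertwines_isom hθA hθM
  exact ⟨θ, (h.isAdInvariant_equalizer hθ).mem_of_isClosed hθA
    (isClosed_eq (continuous_hom _) (continuous_hom ρ)), hθ⟩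

end IsStaceyCovariant

end StaceyToCuntzPimsner

section CrossedProductRecognition

variable {C : Type w} [NonUnitalCStarAlgebra C] {β : C →⋆ₙₐ[ℂ] C}

/-- `B` is generated as a C⋆-algebra by `ι(C)` together with the multiplier `V`, in the sense in
which the Stacey crossed product is: it has no proper C⋆-subalgebra that contains `ι(C)` and is
invariant under left and right multiplication by `V`. -/
def IsGeneratedBy {B : Type v} [NonUnitalCStarAlgebra B] (ι : C →⋆ₙₐ[ℂ] B) (V : 𝓜(ℂ, B)) : Prop :=
  ∀ D : NonUnitalStarSubalgebra ℂ B, IsClosed (D : Set B) → (∀ c, ι c ∈ D) →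
    (∀ x ∈ D, V.fst x ∈ D ∧ V.snd x ∈ D) → ∀ x, x ∈ D

lemma mem_staceyCrossedProduct {x : StaceyProduct β} : x ∈ staceyCrossedProduct β ↔
    ∀ D : NonUnitalStarSubalgebra ℂ (StaceyProduct β), IsClosed (D : Set (StaceyProduct β)) →
      (∀ c, staceyProdA β c ∈ D) →
      (∀ y ∈ D, (staceyProdV β).fst y ∈ D ∧ (staceyProdV β).snd y ∈ D) → x ∈ D := by
  simp only [staceyCrossedProduct, NonUnitalStarAlgebra.mem_sInf, Set.mem_ofPred_eq, and_imp]

namespace StaceyProduct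

/-- The homomorphism `x ↦ (θ_r(x))_r`. -/
def lift {B : Type v} [NonUnitalCStarAlgebra B] (θ : ∀ r : StaceyRep β, B →⋆ₙₐ[ℂ] r.B) :
    B →⋆ₙₐ[ℂ] StaceyProduct β where
  toFun x := ⟨fun r => θ r x, memℓp_infty ⟨‖x‖, by
    rintro _ ⟨r, rfl⟩
    exact NonUnitalStarAlgHom.norm_apply_le (θ r) x⟩⟩
  map_smul' z x := Subtype.ext <| funext fun r => map_smul (θ r) z x
  map_zero' := Subtype.ext <| funext fun r => map_zero (θ r)
  map_add' x y := Subtype.ext <| funext fun r => map_add (θ r) x y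
  map_mul' x y := Subtype.ext <| funext fun r => map_mul (θ r) x y
  map_star' x := Subtype.ext <| funext fun r => map_star (θ r) x

/-- The projection of the product onto the factor with index `r`. -/
def eval (r : StaceyRep β) : StaceyProduct β →⋆ₙₐ[ℂ] r.B where
  toFun x := (x : ∀ r : StaceyRep β, r.B) r
  map_smul' _ _ := rfl
  map_zero' := rfl
  map_add' _ _ := rfl
  map_mul' _ _ := rfl
  map_star' _ := rfl

section Lift

variable {B : Type v} [NonUnitalCStarAlgebra B] {ι : C →⋆ₙₐ[ℂ] B} {V : 𝓜(ℂ, B)}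
  {θ : ∀ r : StaceyRep β, B →⋆ₙₐ[ℂ] r.B}

lemma lift_coe (hι : ∀ r c, θ r (ι c) = r.π c) (c : C) : lift θ (ι c) = staceyProdA β c :=
  Subtype.ext <| funext fun r => hι r c

lemma intertwines_lift (hV : ∀ r, Intertwines (θ r) V r.V) :
    Intertwines (lift θ) V (staceyProdV β) :=
  ⟨fun x => Subtype.ext <| funext fun r => (hV r).fst x,
    fun x => Subtype.ext <| funext fun r => (hV r).snd x⟩

lemma lift_mem (hι : ∀ r c, θ r (ι c) = r.π c) (hV : ∀ r, Intertwines (θ r) V r.V)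
    (hB : IsGeneratedBy ι V) (x : B) : lift θ x ∈ staceyCrossedProduct β := by
  refine mem_staceyCrossedProduct.2 fun D hD hDA hDV => hB (D.comap (lift θ))
    (hD.preimage (continuous_hom (lift θ))) (fun c => ?_) (fun y hy => ?_) x
  · change lift θ (ι c) ∈ D
    rw [lift_coe hι]
    exact hDA c
  · have hlift := intertwines_lift hV
    have hy : lift θ y ∈ D := hy
    have hVy := hDV _ hy
    rw [hlift.fst, hlift.snd] at hVy
    exact hVy

end Lift

lemma lift_eval {r : StaceyRep β} {θ : ∀ s : StaceyRep β, r.B →⋆ₙₐ[ℂ] s.B}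
    (hι : ∀ s c, θ s (r.π c) = s.π c) (hV : ∀ s, Intertwines (θ s) r.V s.V)
    {x : StaceyProduct β} (hx : x ∈ staceyCrossedProduct β) : lift θ (eval r x) = x := by
  refine mem_staceyCrossedProduct.1 hx (NonUnitalStarAlgHom.equalizer ((lift θ).comp (eval r))
    (NonUnitalStarAlgHom.id ℂ _)) (isClosed_eq (continuous_hom _) continuous_id) (lift_coe hι)
    fun y hy => ?_
  have hy : lift θ (eval r y) = y := hy
  have hlift := intertwines_lift hV
  exact ⟨(hlift.fst (eval r y)).symm.trans (congrArg _ hy),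
    (hlift.snd (eval r y)).symm.trans (congrArg _ hy)⟩

end StaceyProduct

variable {B : Type w} [NonUnitalCStarAlgebra B] {ι : C →⋆ₙₐ[ℂ] B} {V : 𝓜(ℂ, B)}

lemma IsGeneratedBy.eq_id (hB : IsGeneratedBy ι V) {θ : B →⋆ₙₐ[ℂ] B} (hι : ∀ c, θ (ι c) = ι c)
    (hV : Intertwines θ V V) : θ = NonUnitalStarAlgHom.id ℂ B :=
  NonUnitalStarAlgHom.ext <| hB (NonUnitalStarAlgHom.equalizer θ (NonUnitalStarAlgHom.id ℂ B))
    (isClosed_eq (continuous_hom θ) continuous_id) hι fun x hx => by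
      have hx : θ x = x := hx
      exact ⟨(hV.fst x).symm.trans (congrArg _ hx), (hV.snd x).symm.trans (congrArg _ hx)⟩

theorem IsStaceyCovariant.exists_crossedProduct_equiv (h : IsStaceyCovariant β ι V)
    (hB : IsGeneratedBy ι V) (hint : ∀ r : StaceyRep β, ∃ θ : B →⋆ₙₐ[ℂ] r.B,
      (∀ c, θ (ι c) = r.π c) ∧ Intertwines θ V r.V) :
    ∃ Φ : StaceyCrossedProduct β ≃⋆ₐ[ℂ] B, (∀ c, Φ (staceyI β c) = ι c) ∧
      ∀ x, Φ ((staceyV β).fst x) = V.fst (Φ x) ∧ Φ ((staceyV β).snd x) = V.snd (Φ x) := by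
  choose θ hι hV using hint
  let r : StaceyRep β := ⟨B, ι, V, h⟩
  exact ⟨{
    toFun := fun x => StaceyProduct.eval r x.1
    invFun := fun x => ⟨StaceyProduct.lift θ x, StaceyProduct.lift_mem hι hV hB x⟩
    left_inv := fun x => Subtype.ext (StaceyProduct.lift_eval (r := r) hι hV x.2)
    right_inv := fun x => DFunLike.congr_fun (hB.eq_id (hι r) (hV r)) x
    map_mul' := fun _ _ => rfl
    map_add' := fun _ _ => rfl
    map_star' := fun _ => rfl
    map_smul' := fun _ _ => rfl }, fun c => rfl, fun x => ⟨rfl, rfl⟩⟩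

end CrossedProductRecognition

section CuntzPimsnerCrossedProduct

variable {A : Type u} [NonUnitalCStarAlgebra A] [PartialOrder A] [StarOrderedRing A]
variable (S : ExelSystem A) (J : Set A) (hJ : ∀ a ∈ J, S.M.lact a ∈ S.M.compacts)

lemma isStaceyCovariant_coreIncl :
    IsStaceyCovariant (adIsom S J hJ) (coreIncl S.M J hJ) (isom S J hJ) :=
  (isCornerStable_coreIncl S J hJ).isStaceyCovariant

lemma isGeneratedBy_coreIncl_isom : IsGeneratedBy (coreIncl S.M J hJ) (isom S J hJ) :=
  fun _ hD hι hV => RelCP.mem_of_isom hD (fun a => hι (kACore S J hJ a))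
    fun a => (hV _ (hι (kACore S J hJ a))).2

theorem exists_staceyCrossedProduct_equiv :
    ∃ Φ : StaceyCrossedProduct (adIsom S J hJ) ≃⋆ₐ[ℂ] RelCP S.M J hJ,
      (∀ c, Φ (staceyI (adIsom S J hJ) c) = coreIncl S.M J hJ c) ∧
      ∀ x, Φ ((staceyV (adIsom S J hJ)).fst x) = (isom S J hJ).fst (Φ x) ∧
        Φ ((staceyV (adIsom S J hJ)).snd x) = (isom S J hJ).snd (Φ x) :=
  (isStaceyCovariant_coreIncl S J hJ).exists_crossedProduct_equiv
    (isGeneratedBy_coreIncl_isom S J hJ) fun r => r.isStacey.exists_integrated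

end CuntzPimsnerCrossedProduct

theorem theorem3p1_general {A : Type u} [NonUnitalCStarAlgebra A] [PartialOrder A]
    [StarOrderedRing A] (S : ExelSystem A) (J : Set A)
    (hJ : ∀ a ∈ J, S.M.lact a ∈ S.M.compacts) :
    ∃ V : 𝓜(ℂ, RelCP S.M J hJ),
      (star V * V = 1 ∧
        ∀ a : A, ((k S.M J hJ).ψ (S.q a) : 𝓜(ℂ, RelCP S.M J hJ)) = kA S.M J hJ a * V) ∧
      (∀ W : 𝓜(ℂ, RelCP S.M J hJ),
        (star W * W = 1 ∧
          ∀ a : A, ((k S.M J hJ).ψ (S.q a) : 𝓜(ℂ, RelCP S.M J hJ)) = kA S.M J hJ a * W) →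
        W = V) ∧
      ∃ α' : Core S.M J hJ →⋆ₙₐ[ℂ] Core S.M J hJ,
        (∀ c : Core S.M J hJ,
          (coreIncl S.M J hJ (α' c) : 𝓜(ℂ, RelCP S.M J hJ)) =
            V * (coreIncl S.M J hJ c : 𝓜(ℂ, RelCP S.M J hJ)) * star V) ∧
        (∀ (i : ℕ) (a b : A) (m n : (S.M.pow i).carrier), ∃ c : Core S.M J hJ,
          coreIncl S.M J hJ c =
            ((k S.M J hJ).pow i).ψ ((S.M.pow i).lact a m) *
              star (((k S.M J hJ).pow i).ψ ((S.M.pow i).lact b n)) ∧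
          coreIncl S.M J hJ (α' c) =
            ((k S.M J hJ).pow (i + 1)).ψ (S.M.tmul (S.M.pow i) (S.q (S.α a)) m) *
              star (((k S.M J hJ).pow (i + 1)).ψ (S.M.tmul (S.M.pow i) (S.q (S.α b)) n))) ∧
        (∃ αbar : 𝓜(ℂ, Core S.M J hJ) →⋆ₙₐ[ℂ] 𝓜(ℂ, Core S.M J hJ),
          IsStrictExtension α' αbar ∧
          (∀ c : Core S.M J hJ,
            coreIncl S.M J hJ ((αbar 1).fst c) = (V * star V).fst (coreIncl S.M J hJ c) ∧
            coreIncl S.M J hJ ((αbar 1).snd c) = (V * star V).snd (coreIncl S.M J hJ c)) ∧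
          Set.range α' = Set.range fun c => (αbar 1).fst ((αbar 1).snd c)) ∧
        Function.Injective α' ∧
        IsStaceyCovariant α' (coreIncl S.M J hJ) V ∧
        ∃ Φ : StaceyCrossedProduct α' ≃⋆ₐ[ℂ] RelCP S.M J hJ,
          (∀ c : Core S.M J hJ, Φ (staceyI α' c) = coreIncl S.M J hJ c) ∧
          ∀ x : StaceyCrossedProduct α',
            Φ ((staceyV α').fst x) = V.fst (Φ x) ∧ Φ ((staceyV α').snd x) = V.snd (Φ x) := by
  have hcorner := isCornerStable_coreIncl S J hJ
  have hproj := hcorner.intertwines_endomorphismBar_one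
  exact ⟨isom S J hJ, ⟨star_isom_mul_isom S J hJ, fun a => (kA_mul_isom S J hJ a).symm⟩,
    fun W hW => eq_isom S J hJ hW.2,
    adIsom S J hJ, coe_adIsom S J hJ, adIsom_spanning S J hJ,
    ⟨hcorner.endomorphismBar, hcorner.isStrictExtension,
      fun c => ⟨(hproj.fst c).symm, (hproj.snd c).symm⟩, hcorner.range_endomorphism⟩,
    hcorner.endomorphism_injective, isStaceyCovariant_coreIncl S J hJ,
    exists_staceyCrossedProduct_equiv S J hJ⟩

end ExelStacey

end

theorem theorem3p1 {A : Type u} [NonUnitalCStarAlgebra A] [PartialOrder A] [StarOrderedRing A]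
    (S : ExelSystem A) (J : TwoSidedIdeal A) (hJ_closed : IsClosed (J : Set A))
    (hJ : ∀ a ∈ (J : Set A), S.M.lact a ∈ S.M.compacts) :
    ∃ V : 𝓜(ℂ, RelCP S.M J hJ),
      -- `V` is the unique isometry with `k_M(q(a)) = k_A(a) V`
      (star V * V = 1 ∧
        ∀ a : A, ((k S.M J hJ).ψ (S.q a) : 𝓜(ℂ, RelCP S.M J hJ)) = kA S.M J hJ a * V) ∧
      (∀ W : 𝓜(ℂ, RelCP S.M J hJ),
        (star W * W = 1 ∧
          ∀ a : A, ((k S.M J hJ).ψ (S.q a) : 𝓜(ℂ, RelCP S.M J hJ)) = kA S.M J hJ a * W) →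
        W = V) ∧
      ∃ α' : Core S.M J hJ →⋆ₙₐ[ℂ] Core S.M J hJ,
        -- the endomorphism `α'` of the core is the restriction of `Ad V`
        (∀ c : Core S.M J hJ,
          (coreIncl S.M J hJ (α' c) : 𝓜(ℂ, RelCP S.M J hJ)) =
            V * (coreIncl S.M J hJ c : 𝓜(ℂ, RelCP S.M J hJ)) * star V) ∧
        -- the formula for `α'` on the spanning elements of the core
        (∀ (i : ℕ) (a b : A) (m n : (S.M.pow i).carrier), ∃ c : Core S.M J hJ,
          coreIncl S.M J hJ c =
            ((k S.M J hJ).pow i).ψ ((S.M.pow i).lact a m) *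
              star (((k S.M J hJ).pow i).ψ ((S.M.pow i).lact b n)) ∧
          coreIncl S.M J hJ (α' c) =
            ((k S.M J hJ).pow (i + 1)).ψ (S.M.tmul (S.M.pow i) (S.q (S.α a)) m) *
              star (((k S.M J hJ).pow (i + 1)).ψ (S.M.tmul (S.M.pow i) (S.q (S.α b)) n))) ∧
        -- `α'` is extendible, its extension sends `1` to `VV⋆`, and its range is the corner
        (∃ αbar : 𝓜(ℂ, Core S.M J hJ) →⋆ₙₐ[ℂ] 𝓜(ℂ, Core S.M J hJ),
          IsStrictExtension α' αbar ∧
          (∀ c : Core S.M J hJ,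
            coreIncl S.M J hJ ((αbar 1).fst c) = (V * star V).fst (coreIncl S.M J hJ c) ∧
            coreIncl S.M J hJ ((αbar 1).snd c) = (V * star V).snd (coreIncl S.M J hJ c)) ∧
          Set.range α' = Set.range fun c => (αbar 1).fst ((αbar 1).snd c)) ∧
        Function.Injective α' ∧
        -- `(id, V)` is Stacey-covariant and `id × V` is an isomorphism
        IsStaceyCovariant α' (coreIncl S.M J hJ) V ∧
        ∃ Φ : StaceyCrossedProduct α' ≃⋆ₐ[ℂ] RelCP S.M J hJ,
          (∀ c : Core S.M J hJ, Φ (staceyI α' c) = coreIncl S.M J hJ c) ∧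
          ∀ x : StaceyCrossedProduct α',
            Φ ((staceyV α').fst x) = V.fst (Φ x) ∧ Φ ((staceyV α').snd x) = V.snd (Φ x) :=
  theorem3p1_general S J hJ
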